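/- For $\varepsilon,\eta>0$ let $(u_{\varepsilon,\eta},\rho_{\varepsilon,\eta})\in C(\mathbb R\times[0,1])\times C([0,1];\mathcal P(\mathbb R))$ be the solution, classical in $\mathbb R\times(0,1)$ (that is, $u_{\varepsilon,\eta}$ and the density of $\rho_{\varepsilon,\eta}$ are of class $C^{2,1}$ there), of the system $$\begin{cases}\partial_t u_{\varepsilon,\eta}-\varepsilon\,\partial_x^2u_{\varepsilon,\eta}+\tfrac12(\partial_xu_{\varepsilon,\eta})^2=\rho_{\varepsilon,\eta}&\text{in }\mathbb R\times(0,1),\\ \partial_t\rho_{\varepsilon,\eta}+\varepsilon\,\partial_x^2\rho_{\varepsilon,\eta}+\partial_x(\partial_xu_{\varepsilon,\eta}\,\rho_{\varepsilon,\eta})=0&\text{in }\mathbb R\times(0,1),\\ u_{\varepsilon,\eta}(x,0)=\dfrac{x^2}{2\eta},\qquad \rho_{\varepsilon,\eta}(\cdot,1)=\delta_0,\end{cases}$$ where $\mathcal P(\mathbb R)$ is the set of Borel probability measures on $\mathbb R$ with the topology of weak convergence and $\delta_0$ is the Dirac mass at $0$. For a function $f$ on $\mathbb R$ and $\alpha\in(0,1)$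 write $[f]_{C^{0,\alpha}}=\sup_{x\ne y}|f(x)-f(y)|/|x-y|^\alpha\in[0,\infty]$. Then for every $\theta\in(0,1)$ and every $\alpha\in(0,1/2)$ there is a constant $C>0$, depending only on $\theta$ and $\alpha$ and not on $\varepsilon$ and $\eta$, such that, for all $\varepsilon,\eta>0$, $$\int_\theta^1[\rho_{\varepsilon,\eta}(\cdot,t)]_{C^{0,\alpha}}\,dt\le C .$$ -/

import Mathlib

open MeasureTheory Set
open scoped NNReal ENNReal

namespace MFGPlanning

/-- The time derivative `∂_t f (x, t)` of a function of `(x, t)`. -/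
noncomputable def dt (f : ℝ → ℝ → ℝ) (x t : ℝ) : ℝ := deriv (fun s => f x s) t

/-- The space derivative `∂_x f (x, t)` of a function of `(x, t)`. -/
noncomputable def dx (f : ℝ → ℝ → ℝ) (x t : ℝ) : ℝ := deriv (fun y => f y t) x

/-- The open strip `ℝ × (0, 1)`. -/
def strip : Set (ℝ × ℝ) := univ ×ˢ Ioo (0 : ℝ) 1

/-- `f` is of class `C^{2,1}` on `ℝ × (0, 1)`: the derivatives `∂_t f`, `∂_x f`, `∂_x² f` exist at
every point of the strip and are, together with `f`, continuous there. -/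
structure IsC21 (f : ℝ → ℝ → ℝ) : Prop where
  differentiableAt_t : ∀ x : ℝ, ∀ t ∈ Ioo (0 : ℝ) 1, DifferentiableAt ℝ (fun s => f x s) t
  differentiableAt_x : ∀ x : ℝ, ∀ t ∈ Ioo (0 : ℝ) 1, DifferentiableAt ℝ (fun y => f y t) x
  differentiableAt_xx : ∀ x : ℝ, ∀ t ∈ Ioo (0 : ℝ) 1, DifferentiableAt ℝ (fun y => dx f y t) x
  continuousOn : ContinuousOn (fun p : ℝ × ℝ => f p.1 p.2) strip
  continuousOn_t : ContinuousOn (fun p : ℝ × ℝ => dt f p.1 p.2) strip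
  continuousOn_x : ContinuousOn (fun p : ℝ × ℝ => dx f p.1 p.2) strip
  continuousOn_xx : ContinuousOn (fun p : ℝ × ℝ => dx (dx f) p.1 p.2) strip

/-- `(u, ρ)` solves the viscous mean field game planning system with parameters `ε, η`:
`∂_t u - ε ∂_x² u + (∂_x u)² / 2 = ρ` and `∂_t ρ + ε ∂_x² ρ + ∂_x (∂_x u ρ) = 0` in `ℝ × (0, 1)`,
`u (x, 0) = x² / (2 η)`, `ρ (·, 1) = δ₀`,
in the class `u ∈ C(ℝ × [0, 1])`, `ρ ∈ C([0, 1]; 𝒫(ℝ))`, both classical in `ℝ × (0, 1)`.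
The curve of probability measures is `m` (continuous for the weak convergence of measures), and the
function `ρ (·, t)` is the density of `m t` for `t ∈ (0, 1)`. -/
structure IsSolution (ε η : ℝ) (u ρ : ℝ → ℝ → ℝ) (m : ℝ → ProbabilityMeasure ℝ) : Prop where
  u_continuousOn : ContinuousOn (fun p : ℝ × ℝ => u p.1 p.2) (univ ×ˢ Icc (0 : ℝ) 1)
  m_continuousOn : ContinuousOn m (Icc (0 : ℝ) 1)
  u_classical : IsC21 u
  ρ_classical : IsC21 ρ
  ρ_nonneg : ∀ x : ℝ, ∀ t ∈ Ioo (0 : ℝ) 1, 0 ≤ ρ x t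
  ρ_density : ∀ t ∈ Ioo (0 : ℝ) 1,
    (m t : Measure ℝ) = volume.withDensity (fun x => ENNReal.ofReal (ρ x t))
  hamilton_jacobi : ∀ x : ℝ, ∀ t ∈ Ioo (0 : ℝ) 1,
    dt u x t - ε * dx (dx u) x t + 1 / 2 * (dx u x t) ^ 2 = ρ x t
  fokker_planck : ∀ x : ℝ, ∀ t ∈ Ioo (0 : ℝ) 1,
    dt ρ x t + ε * dx (dx ρ) x t + dx (fun y s => dx u y s * ρ y s) x t = 0
  initial : ∀ x : ℝ, u x 0 = x ^ 2 / (2 * η)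
  terminal : (m 1 : Measure ℝ) = Measure.dirac 0

end MFGPlanning

namespace MFGPlanning

open Filter Topology

/-! With `f = u` and `g = -2ε log ρ - u` the system becomes two Hamilton–Jacobi equations, one
forward and one backward in time, with the common source `ρ = exp (-(f + g) / (2ε))` (`MFGPair`). In
the variables `ℓ = log ρ` and `ψ = (f - g) / 2` it is a quantum Euler flow: `ρ_t + (ρ ψ_x)_x = 0`
and `ψ_t + ψ_x² / 2 = ρ - 2ε² Q` with `Q = (√ρ)_xx / √ρ = ℓ_xx / 2 + ℓ_x² / 4`.

The estimate is displacement convexity of `∫ U(ρ)` for `U = ρ · ρ^k / (1 + ρ^k)`, with pressure `p =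
ρ U' - U` and `0 < k < 1/2`. Formally the first time derivative is `-∫ p ψ_xx`, and the second is `∫
p' ψ_xx² + ∫ p' ρ ℓ_x²` plus `2ε²` times a quantum term, where `p'` is the derivative in `ℓ`. For `k
< 1/2` the quantum term is a coercive quartic form in `(ℓ_x, Q)`, so it has a good sign
(`exists_quantum_lower_bound`). Since `0 ≤ U ≤ ρ` and the mass is at most one, testing with `(t -
a)(b - t)` bounds the weighted space-time integral of `ρ^k (1 + ρ^k)⁻² ρ_x²` by a constant of `k`
alone (`weighted_gradient_estimate`). This is where the independence of `ε` and `η` comes from.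

No decay at infinity is known beforehand, so everything is done with a cutoff on `[-R, R]`. Its
errors vanish as `R → ∞` once `ρ (ψ_x² + ρ) / (1 + x²)` is integrable (`exists_energy_bound`); this
bound may depend on `ε` and on the solution, because it disappears in the limit. It follows from a
weighted duality identity for `∫ ρ f`, given that the potentials grow at most quadratically. The
growth is obtained by transporting averages of subsolutions along moving bumps and upgrading them to
pointwise upper bounds with a localised heat kernel. The same tools, applied to a regularised
backward potential, give the strict positivity of `ρ` that is needed to define `g`.

On a time slice, the mass and the weighted gradient energy `Z ≥ 1` give `sup ρ ≲ Z^(1 / (3 - k))`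
and a Hölder seminorm `≲ Z^q` with `q = (1 + α) / (3 - k)` (`abs_sub_le_of_weighted_gradient`). For
`k = 1/2 - α` one has `q < 1/2`, so Young's inequality `Z^q ≤ (1 - t) Z + (1 - t)^(-q / (1 - q))`
compensates the degeneracy of the time weight at `t = 1` with an integrable remainder. -/

/-- Joint continuity of a function of `(x, t)` on the strip `ℝ × (α, β)`. -/
abbrev ContStrip (α β : ℝ) (g : ℝ → ℝ → ℝ) : Prop :=
  ContinuousOn (fun p : ℝ × ℝ => g p.1 p.2) (univ ×ˢ Ioo α β)

/-! ### Integrals over a space interval depending on time. -/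

section Parametric

variable {α β : ℝ} {g g' : ℝ → ℝ → ℝ}

theorem ContStrip.continuous_slice (hg : ContStrip α β g) {t : ℝ} (ht : t ∈ Ioo α β) :
    Continuous fun x => g x t := by
  rw [← continuousOn_univ]
  exact hg.comp (f := fun x : ℝ => (x, t)) (by fun_prop) fun x _ => ⟨mem_univ _, ht⟩

theorem ContStrip.comp_continuous (hg : ContStrip α β g) {X : Type*} [TopologicalSpace X]
    {x t : X → ℝ} (hx : Continuous x) (ht : Continuous t) (h : ∀ y, t y ∈ Ioo α β) :
    Continuous fun y => g (x y) (t y) := by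
  rw [← continuousOn_univ]
  exact hg.comp (f := fun y : X => (x y, t y)) (by fun_prop) fun y _ => ⟨mem_univ _, h y⟩

theorem ContStrip.mono (hg : ContStrip α β g) {α' β' : ℝ} (h₁ : α ≤ α') (h₂ : β' ≤ β) :
    ContStrip α' β' g :=
  ContinuousOn.mono hg fun _ hp => ⟨mem_univ _, h₁.trans_lt hp.2.1, hp.2.2.trans_le h₂⟩

theorem contStrip_of_continuous {k : ℝ → ℝ} (hk : Continuous k) :
    ContStrip α β fun x _ => k x := by
  unfold ContStrip; fun_prop

theorem ContStrip.exists_bound (hg : ContStrip α β g) {a b : ℝ} (ha : α < a) (hb : b < β)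
    (l r : ℝ) : ∃ C, 0 ≤ C ∧ ∀ x ∈ uIcc l r, ∀ t ∈ Icc a b, |g x t| ≤ C := by
  have hK : IsCompact (uIcc l r ×ˢ Icc a b) := isCompact_uIcc.prod isCompact_Icc
  obtain ⟨C, hC⟩ := hK.exists_bound_of_continuousOn (f := fun p : ℝ × ℝ => g p.1 p.2)
    (ContinuousOn.mono hg fun p hp => ⟨mem_univ _, ha.trans_le hp.2.1, hp.2.2.trans_lt hb⟩)
  exact ⟨max C 0, le_max_right _ _, fun x hx t ht => (hC (x, t) ⟨hx, ht⟩).trans (le_max_left _ _)⟩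

theorem exists_Icc_mem_nhds {t : ℝ} (ht : t ∈ Ioo α β) :
    ∃ a b, α < a ∧ a < t ∧ t < b ∧ b < β := by
  obtain ⟨a, ha, ha'⟩ := exists_between ht.1
  obtain ⟨b, hb, hb'⟩ := exists_between ht.2
  exact ⟨a, b, ha, ha', hb, hb'⟩

theorem hasDerivAt_integral_strip (hg : ContStrip α β g) (hg' : ContStrip α β g')
    (hd : ∀ x, ∀ t ∈ Ioo α β, HasDerivAt (fun s => g x s) (g' x t) t) (l r : ℝ) {t : ℝ}
    (ht : t ∈ Ioo α β) :
    HasDerivAt (fun s => ∫ x in l..r, g x s) (∫ x in l..r, g' x t) t := by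
  obtain ⟨a, b, ha, hat, htb, hb⟩ := exists_Icc_mem_nhds ht
  obtain ⟨C, -, hC⟩ := hg'.exists_bound ha hb l r
  have hmem : ∀ s ∈ Icc a b, s ∈ Ioo α β := fun s hs => ⟨ha.trans_le hs.1, hs.2.trans_lt hb⟩
  refine (intervalIntegral.hasDerivAt_integral_of_dominated_loc_of_deriv_le
    (F := fun s x => g x s) (F' := fun s x => g' x s) (bound := fun _ => C) (s := Icc a b)
    (Icc_mem_nhds hat htb) ?_ ((hg.continuous_slice ht).intervalIntegrable _ _)
    (hg'.continuous_slice ht).aestronglyMeasurable ?_ intervalIntegrable_const ?_).2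
  · filter_upwards [Icc_mem_nhds hat htb] with s hs
    exact (hg.continuous_slice (hmem s hs)).aestronglyMeasurable
  · exact Eventually.of_forall fun x hx s hs => hC x (uIoc_subset_uIcc hx) s hs
  · exact Eventually.of_forall fun x _ s hs => hd x s (hmem s hs)

theorem continuousOn_integral_strip (hg : ContStrip α β g) (l r : ℝ) :
    ContinuousOn (fun s => ∫ x in l..r, g x s) (Ioo α β) := by
  intro t ht
  obtain ⟨a, b, ha, hat, htb, hb⟩ := exists_Icc_mem_nhds ht
  have hab : a ≤ b := (hat.trans htb).le
  -- Clamping the time to `[a, b]` makes the integrand continuous on the whole plane without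
  -- changing it near `t`.
  have hc : Continuous fun s : ℝ => ∫ x in l..r, g x (projIcc a b hab s) := by
    apply intervalIntegral.continuous_parametric_intervalIntegral_of_continuous'
    refine hg.comp_continuous (x := fun p : ℝ × ℝ => p.2)
      (t := fun p : ℝ × ℝ => (projIcc a b hab p.1 : ℝ)) (by fun_prop) ?_ ?_
    · exact continuous_subtype_val.comp (continuous_projIcc.comp continuous_fst)
    · exact fun y => ⟨ha.trans_le (projIcc a b hab y.1).2.1, (projIcc a b hab y.1).2.2.trans_lt hb⟩
  refine (hc.continuousAt.congr ?_).continuousWithinAt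
  filter_upwards [Icc_mem_nhds hat htb] with s hs
  simp [projIcc_of_mem hab hs]

theorem intervalIntegrable_integral_strip (hg : ContStrip α β g) (l r : ℝ) {a b : ℝ}
    (ha : α < a) (hab : a ≤ b) (hb : b < β) :
    IntervalIntegrable (fun s => ∫ x in l..r, g x s) volume a b := by
  refine ((continuousOn_integral_strip hg l r).mono ?_).intervalIntegrable
  rw [uIcc_of_le hab]
  exact fun s hs => ⟨ha.trans_le hs.1, hs.2.trans_lt hb⟩

theorem sub_le_integral_of_hasDerivAt {Y Y' e : ℝ → ℝ} {a b : ℝ} (hab : a ≤ b)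
    (hY : ∀ t ∈ Icc a b, HasDerivAt Y (Y' t) t) (he : IntervalIntegrable e volume a b)
    (hle : ∀ t ∈ Ioo a b, Y' t ≤ e t) : Y b - Y a ≤ ∫ t in a..b, e t :=
  intervalIntegral.sub_le_integral_of_hasDeriv_right_of_le hab
    (fun t ht => (hY t ht).continuousAt.continuousWithinAt)
    (fun t ht => (hY t (Ioo_subset_Icc_self ht)).hasDerivWithinAt)
    ((intervalIntegrable_iff_integrableOn_Icc_of_le hab).1 he) hle

theorem integral_eq_zero_of_hasDerivAt {Y Y' : ℝ → ℝ} {l r : ℝ}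
    (hY : ∀ x, HasDerivAt Y (Y' x) x) (hc : Continuous Y') (hl : Y l = 0) (hr : Y r = 0) :
    ∫ x in l..r, Y' x = 0 := by
  rw [intervalIntegral.integral_eq_sub_of_hasDerivAt (fun x _ => hY x)
    (hc.intervalIntegrable _ _), hl, hr, sub_zero]

theorem integral_add_of_continuous {f g : ℝ → ℝ} (hf : Continuous f) (hg : Continuous g)
    (l r : ℝ) : ∫ x in l..r, (f x + g x) = (∫ x in l..r, f x) + ∫ x in l..r, g x :=
  intervalIntegral.integral_add (hf.intervalIntegrable _ _) (hg.intervalIntegrable _ _)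

theorem integral_sub_of_continuous {f g : ℝ → ℝ} (hf : Continuous f) (hg : Continuous g)
    (l r : ℝ) : ∫ x in l..r, (f x - g x) = (∫ x in l..r, f x) - ∫ x in l..r, g x :=
  intervalIntegral.integral_sub (hf.intervalIntegrable _ _) (hg.intervalIntegrable _ _)

theorem integral_mono_of_continuous {f g : ℝ → ℝ} (hf : Continuous f) (hg : Continuous g)
    {l r : ℝ} (hlr : l ≤ r) (h : ∀ x ∈ Icc l r, f x ≤ g x) :
    ∫ x in l..r, f x ≤ ∫ x in l..r, g x :=
  intervalIntegral.integral_mono_on hlr (hf.intervalIntegrable _ _) (hg.intervalIntegrable _ _) h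

end Parametric

/-! ### Calculus in the class `C^{2,1}`. -/

/-- `f` is of class `C^{2,1}` on the strip `ℝ × (0, 1)` with derivatives
`∂_t f = ft`, `∂_x f = fx`, `∂_x² f = fxx`. -/
structure C21 (f ft fx fxx : ℝ → ℝ → ℝ) : Prop where
  t : ∀ x, ∀ t ∈ Ioo (0 : ℝ) 1, HasDerivAt (fun s => f x s) (ft x t) t
  x : ∀ x, ∀ t ∈ Ioo (0 : ℝ) 1, HasDerivAt (fun y => f y t) (fx x t) x
  xx : ∀ x, ∀ t ∈ Ioo (0 : ℝ) 1, HasDerivAt (fun y => fx y t) (fxx x t) x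
  c : ContStrip 0 1 f
  ct : ContStrip 0 1 ft
  cx : ContStrip 0 1 fx
  cxx : ContStrip 0 1 fxx

theorem IsC21.c21 {f : ℝ → ℝ → ℝ} (hf : IsC21 f) : C21 f (dt f) (dx f) (dx (dx f)) where
  t x t ht := (hf.differentiableAt_t x t ht).hasDerivAt
  x x t ht := (hf.differentiableAt_x x t ht).hasDerivAt
  xx x t ht := (hf.differentiableAt_xx x t ht).hasDerivAt
  c := hf.continuousOn
  ct := hf.continuousOn_t
  cx := hf.continuousOn_x
  cxx := hf.continuousOn_xx

namespace C21

variable {f ft fx fxx g gt gx gxx : ℝ → ℝ → ℝ}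

theorem add (hf : C21 f ft fx fxx) (hg : C21 g gt gx gxx) :
    C21 (fun x t => f x t + g x t) (fun x t => ft x t + gt x t) (fun x t => fx x t + gx x t)
      (fun x t => fxx x t + gxx x t) where
  t x t ht := (hf.t x t ht).add (hg.t x t ht)
  x x t ht := (hf.x x t ht).add (hg.x x t ht)
  xx x t ht := (hf.xx x t ht).add (hg.xx x t ht)
  c := hf.c.add hg.c
  ct := hf.ct.add hg.ct
  cx := hf.cx.add hg.cx
  cxx := hf.cxx.add hg.cxx

theorem const_mul (c : ℝ) (hf : C21 f ft fx fxx) :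
    C21 (fun x t => c * f x t) (fun x t => c * ft x t) (fun x t => c * fx x t)
      (fun x t => c * fxx x t) where
  t x t ht := (hf.t x t ht).const_mul c
  x x t ht := (hf.x x t ht).const_mul c
  xx x t ht := (hf.xx x t ht).const_mul c
  c := continuousOn_const.mul hf.c
  ct := continuousOn_const.mul hf.ct
  cx := continuousOn_const.mul hf.cx
  cxx := continuousOn_const.mul hf.cxx

theorem mul (hf : C21 f ft fx fxx) (hg : C21 g gt gx gxx) :
    C21 (fun x t => f x t * g x t) (fun x t => ft x t * g x t + f x t * gt x t)
      (fun x t => fx x t * g x t + f x t * gx x t)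
      (fun x t => fxx x t * g x t + 2 * (fx x t * gx x t) + f x t * gxx x t) where
  t x t ht := (hf.t x t ht).mul (hg.t x t ht)
  x x t ht := (hf.x x t ht).mul (hg.x x t ht)
  xx x t ht := (((hf.xx x t ht).mul (hg.x x t ht)).add ((hf.x x t ht).mul (hg.xx x t ht))).congr_deriv
    (by ring)
  c := hf.c.mul hg.c
  ct := (hf.ct.mul hg.c).add (hf.c.mul hg.ct)
  cx := (hf.cx.mul hg.c).add (hf.c.mul hg.cx)
  cxx := ((hf.cxx.mul hg.c).add (continuousOn_const.mul (hf.cx.mul hg.cx))).add (hf.c.mul hg.cxx)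

theorem comp {Φ Φ' Φ'' : ℝ → ℝ} {s : Set ℝ} (hf : C21 f ft fx fxx)
    (hs : ∀ x, ∀ t ∈ Ioo (0 : ℝ) 1, f x t ∈ s)
    (h₁ : ∀ y ∈ s, HasDerivAt Φ (Φ' y) y) (h₂ : ∀ y ∈ s, HasDerivAt Φ' (Φ'' y) y)
    (h₃ : ContinuousOn Φ'' s) :
    C21 (fun x t => Φ (f x t)) (fun x t => Φ' (f x t) * ft x t) (fun x t => Φ' (f x t) * fx x t)
      (fun x t => Φ'' (f x t) * fx x t ^ 2 + Φ' (f x t) * fxx x t) := by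
  have hm : MapsTo (fun p : ℝ × ℝ => f p.1 p.2) (univ ×ˢ Ioo 0 1) s := fun p hp => hs _ _ hp.2
  have hΦ : ContinuousOn Φ s := fun y hy => (h₁ y hy).continuousAt.continuousWithinAt
  have hΦ' : ContinuousOn Φ' s := fun y hy => (h₂ y hy).continuousAt.continuousWithinAt
  refine ⟨fun x t ht => ?_, fun x t ht => ?_, fun x t ht => ?_, hΦ.comp hf.c hm,
    (hΦ'.comp hf.c hm).mul hf.ct, (hΦ'.comp hf.c hm).mul hf.cx,
    ((h₃.comp hf.c hm).mul (hf.cx.pow 2)).add ((hΦ'.comp hf.c hm).mul hf.cxx)⟩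
  · exact (h₁ _ (hs x t ht)).comp t (hf.t x t ht)
  · exact (h₁ _ (hs x t ht)).comp x (hf.x x t ht)
  · exact (((h₂ _ (hs x t ht)).comp x (hf.x x t ht)).mul (hf.xx x t ht)).congr_deriv
      (by simp only [Function.comp_apply]; ring)

theorem reverse (hf : C21 f ft fx fxx) :
    C21 (fun x t => f x (1 - t)) (fun x t => -ft x (1 - t)) (fun x t => fx x (1 - t))
      (fun x t => fxx x (1 - t)) := by
  have hm : ∀ {t : ℝ}, t ∈ Ioo (0 : ℝ) 1 → 1 - t ∈ Ioo (0 : ℝ) 1 := fun h =>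
    ⟨by linarith [h.2], by linarith [h.1]⟩
  have hc : ∀ {g : ℝ → ℝ → ℝ}, ContStrip 0 1 g → ContStrip 0 1 fun x t => g x (1 - t) :=
    fun hg => ContinuousOn.comp hg (f := fun p : ℝ × ℝ => (p.1, 1 - p.2)) (by fun_prop)
      fun p hp => ⟨mem_univ _, hm hp.2⟩
  refine ⟨fun x t ht => ?_, fun x t ht => hf.x x _ (hm ht), fun x t ht => hf.xx x _ (hm ht),
    hc hf.c, (hc hf.ct).neg, hc hf.cx, hc hf.cxx⟩
  exact ((hf.t x _ (hm ht)).comp t ((hasDerivAt_id t).const_sub 1)).congr_deriv (by simp)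

/-- Continuous partial derivatives give joint differentiability, which is what the chain rule along
oblique lines in `shift` requires. -/
theorem hasFDerivAt (hf : C21 f ft fx fxx) (x : ℝ) {t : ℝ} (ht : t ∈ Ioo (0 : ℝ) 1) :
    HasFDerivAt (fun p : ℝ × ℝ => f p.1 p.2)
      ((ContinuousLinearMap.toSpanSingleton ℝ (fx x t)).coprod
        (ContinuousLinearMap.toSpanSingleton ℝ (ft x t))) (x, t) := by
  have hnhds : univ ×ˢ Ioo (0 : ℝ) 1 ∈ 𝓝 ((x, t) : ℝ × ℝ) :=
    (isOpen_univ.prod isOpen_Ioo).mem_nhds ⟨mem_univ _, ht⟩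
  have hL : Continuous fun y : ℝ => ContinuousLinearMap.toSpanSingleton ℝ y :=
    (ContinuousLinearMap.toSpanSingletonCLE (𝕜 := ℝ) (E := ℝ)).continuous
  exact (hasStrictFDerivAt_uncurry_coprod (u := (x, t)) (f := f)
    (f₁ := fun x t => ContinuousLinearMap.toSpanSingleton ℝ (fx x t))
    (f₂ := fun x t => ContinuousLinearMap.toSpanSingleton ℝ (ft x t))
    (by filter_upwards [hnhds] with p hp using (hf.x p.1 p.2 hp.2).hasFDerivAt)
    (by filter_upwards [hnhds] with p hp using (hf.t p.1 p.2 hp.2).hasFDerivAt)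
    (hL.continuousAt.comp (hf.cx.continuousAt hnhds))
    (hL.continuousAt.comp (hf.ct.continuousAt hnhds))).hasFDerivAt

/-- The class `C^{2,1}` is stable under translations of the space variable with constant speed. -/
theorem shift (hf : C21 f ft fx fxx) (y v : ℝ) :
    C21 (fun x t => f (x + y + v * t) t)
      (fun x t => ft (x + y + v * t) t + v * fx (x + y + v * t) t)
      (fun x t => fx (x + y + v * t) t) (fun x t => fxx (x + y + v * t) t) := by
  have hc : ∀ {g : ℝ → ℝ → ℝ}, ContStrip 0 1 g → ContStrip 0 1 fun x t => g (x + y + v * t) t :=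
    fun hg => ContinuousOn.comp hg (f := fun p : ℝ × ℝ => (p.1 + y + v * p.2, p.2)) (by fun_prop)
      fun p hp => ⟨mem_univ _, hp.2⟩
  refine ⟨fun x t ht => ?_, fun x t ht => ?_, fun x t ht => ?_, hc hf.c,
    (hc hf.ct).add (continuousOn_const.mul (hc hf.cx)), hc hf.cx, hc hf.cxx⟩
  · have h := HasFDerivAt.comp_hasDerivAt (f := fun s : ℝ => (x + y + v * s, s)) t
      (hf.hasFDerivAt (x + y + v * t) ht)
      ((((hasDerivAt_id t).const_mul v).const_add (x + y)).prodMk (hasDerivAt_id t))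
    refine h.congr_deriv ?_
    simp; ring
  · exact ((hf.x _ t ht).comp x (((hasDerivAt_id x).add_const y).add_const (v * t))).congr_deriv
      (by simp)
  · exact ((hf.xx _ t ht).comp x (((hasDerivAt_id x).add_const y).add_const (v * t))).congr_deriv
      (by simp)

end C21

/-- Derivative in time of `∫ q ∂_x² ψ`: no mixed derivative of `ψ` is needed. -/
theorem C21.hasDerivAt_integral_mul_xx {q qt qx qxx ψ ψt ψx ψxx : ℝ → ℝ → ℝ}
    (hq : C21 q qt qx qxx) (hψ : C21 ψ ψt ψx ψxx) {l r : ℝ}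
    (hl : ∀ t ∈ Ioo (0 : ℝ) 1, q l t = 0) (hr : ∀ t ∈ Ioo (0 : ℝ) 1, q r t = 0)
    (hl' : ∀ t ∈ Ioo (0 : ℝ) 1, qx l t = 0) (hr' : ∀ t ∈ Ioo (0 : ℝ) 1, qx r t = 0)
    {t : ℝ} (ht : t ∈ Ioo (0 : ℝ) 1) :
    HasDerivAt (fun s => ∫ x in l..r, q x s * ψxx x s)
      (∫ x in l..r, (qt x t * ψxx x t + qxx x t * ψt x t)) t := by
  have hqs : ∀ {g : ℝ → ℝ → ℝ}, ContStrip 0 1 g → Continuous fun x => g x t :=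
    fun hg => hg.continuous_slice ht
  -- With `q` frozen at time `t`, two integrations by parts move both space derivatives from `ψ` to
  -- `q`, so that only `ψ` itself has to be differentiated in time.
  have hparts : ∀ s ∈ Ioo (0 : ℝ) 1,
      ∫ x in l..r, q x t * ψxx x s = ∫ x in l..r, qxx x t * ψ x s := by
    intro s hs
    rw [← sub_eq_zero, ← integral_sub_of_continuous
      ((hqs hq.c).fun_mul (hψ.cxx.continuous_slice hs))
      ((hqs hq.cxx).fun_mul (hψ.c.continuous_slice hs))]
    refine integral_eq_zero_of_hasDerivAt (Y := fun x => q x t * ψx x s - qx x t * ψ x s)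
      (fun x => ((((hq.x x t ht).mul (hψ.xx x s hs)).sub
        ((hq.xx x t ht).mul (hψ.x x s hs))).congr_deriv (by ring)))
      (((hqs hq.c).mul (hψ.cxx.continuous_slice hs)).sub
        ((hqs hq.cxx).mul (hψ.c.continuous_slice hs))) ?_ ?_
    · simp [hl t ht, hl' t ht]
    · simp [hr t ht, hr' t ht]
  have h₂ : HasDerivAt (fun s => ∫ x in l..r, qxx x t * ψ x s) (∫ x in l..r, qxx x t * ψt x t) t :=
    hasDerivAt_integral_strip ((contStrip_of_continuous (hqs hq.cxx)).mul hψ.c)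
      ((contStrip_of_continuous (hqs hq.cxx)).mul hψ.ct)
      (fun x s hs => (hψ.t x s hs).const_mul _) l r ht
  -- The complementary part of the product has a first factor vanishing at `s = t`, so continuity of
  -- `ψxx` is enough for the difference quotients to converge.
  have h₁ : HasDerivAt (fun s => ∫ x in l..r, (q x s - q x t) * ψxx x s)
      (∫ x in l..r, qt x t * ψxx x t) t := by
    obtain ⟨a, b, ha, hat, htb, hb⟩ := exists_Icc_mem_nhds ht
    have hmem : ∀ s ∈ Icc a b, s ∈ Ioo (0 : ℝ) 1 := fun s hs =>
      ⟨ha.trans_le hs.1, hs.2.trans_lt hb⟩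
    obtain ⟨C₁, hC₁0, hC₁⟩ := hq.ct.exists_bound ha hb l r
    obtain ⟨C₂, hC₂0, hC₂⟩ := hψ.cxx.exists_bound ha hb l r
    have hnear : ∀ᶠ s in 𝓝[≠] t, s ∈ Icc a b := nhdsWithin_le_nhds (Icc_mem_nhds hat htb)
    rw [hasDerivAt_iff_tendsto_slope]
    have hslope : ∀ᶠ s in 𝓝[≠] t,
        ∫ x in l..r, slope (fun τ => q x τ) t s * ψxx x s =
          slope (fun s => ∫ x in l..r, (q x s - q x t) * ψxx x s) t s := by
      filter_upwards [hnear] with s hs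
      simp only [slope_def_field, sub_self, zero_mul, intervalIntegral.integral_zero, sub_zero]
      rw [← intervalIntegral.integral_div]
      congr 1; ext x; ring
    refine Tendsto.congr' hslope ?_
    refine intervalIntegral.tendsto_integral_filter_of_dominated_convergence (fun _ => C₁ * C₂)
      ?_ ?_ intervalIntegrable_const ?_
    · filter_upwards [hnear] with s hs
      have : Continuous fun x => slope (fun τ => q x τ) t s * ψxx x s := by
        simp only [slope_def_field]
        exact (((hq.c.continuous_slice (hmem s hs)).sub (hqs hq.c)).div_const _).mul
          (hψ.cxx.continuous_slice (hmem s hs))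
      exact this.aestronglyMeasurable
    · filter_upwards [hnear, self_mem_nhdsWithin] with s hs hne
      refine Eventually.of_forall fun x hx => ?_
      have hx' := uIoc_subset_uIcc hx
      rw [Real.norm_eq_abs, abs_mul]
      refine mul_le_mul ?_ (hC₂ x hx' s hs) (abs_nonneg _) hC₁0
      have := (convex_Icc a b).norm_image_sub_le_of_norm_hasDerivWithin_le
        (f := fun τ => q x τ) (f' := fun τ => qt x τ) (C := C₁)
        (fun τ hτ => (hq.t x τ (hmem τ hτ)).hasDerivWithinAt) (fun τ hτ => hC₁ x hx' τ hτ)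
        ⟨hat.le, htb.le⟩ hs
      rw [slope_def_field, abs_div, div_le_iff₀ (abs_pos.2 (sub_ne_zero.2 hne))]
      simpa using this
    · refine Eventually.of_forall fun x _ => ?_
      refine Tendsto.mul (hasDerivAt_iff_tendsto_slope.1 (hq.t x t ht)) ?_
      have : ContinuousAt (fun s => ψxx x s) t :=
        (hψ.cxx.continuousAt ((isOpen_univ.prod isOpen_Ioo).mem_nhds ⟨mem_univ _, ht⟩)).comp
          (f := fun s : ℝ => (x, s)) (by fun_prop)
      exact this.tendsto.mono_left nhdsWithin_le_nhds
  have hsum := h₁.add h₂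
  rw [← integral_add_of_continuous ((hqs hq.ct).fun_mul (hqs hψ.cxx))
    ((hqs hq.cxx).fun_mul (hqs hψ.ct))] at hsum
  refine hsum.congr_of_eventuallyEq ?_
  filter_upwards [isOpen_Ioo.mem_nhds ht] with s hs
  have hss : ∀ {g : ℝ → ℝ → ℝ}, ContStrip 0 1 g → Continuous fun x => g x s :=
    fun hg => hg.continuous_slice hs
  simp only [Pi.add_apply]
  rw [← hparts s hs, ← integral_add_of_continuous
    (((hss hq.c).fun_sub (hqs hq.c)).fun_mul (hss hψ.cxx)) ((hqs hq.c).fun_mul (hss hψ.cxx))]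
  congr 1; ext x; ring

/-! ### Hamilton–Jacobi subsolutions tested against bumps. -/

/-- `f` is a `C^{2,1}` subsolution of `∂_t f - ε ∂_x² f + (∂_x f)² / 2 = S` on `ℝ × (0, 1)`, where
the source `S ≥ 0` has mass at most one at each time. -/
structure HJSub (ε : ℝ) (f ft fx fxx S : ℝ → ℝ → ℝ) : Prop where
  reg : C21 f ft fx fxx
  source_cont : ContStrip 0 1 S
  source_nonneg : ∀ x, ∀ t ∈ Ioo (0 : ℝ) 1, 0 ≤ S x t
  source_mass : ∀ t ∈ Ioo (0 : ℝ) 1, ∀ l r, l ≤ r → ∫ x in l..r, S x t ≤ 1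
  le_source : ∀ x, ∀ t ∈ Ioo (0 : ℝ) 1,
    ft x t - ε * fxx x t + 1 / 2 * fx x t ^ 2 ≤ S x t

/-- The bump `(1 - (z / L)²)²`, used on `[-L, L]`. -/
noncomputable def bump (L z : ℝ) : ℝ := (1 - (z / L) ^ 2) ^ 2

theorem bump_nonneg (L z : ℝ) : 0 ≤ bump L z := sq_nonneg _

theorem div_sq_le_one {L z : ℝ} (hL : 0 < L) (hz : z ∈ Icc (-L) L) : (z / L) ^ 2 ≤ 1 := by
  rw [sq_le_one_iff_abs_le_one, abs_div, abs_of_pos hL]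
  exact div_le_one_of_le₀ (abs_le.2 hz) hL.le

theorem bump_le_one {L z : ℝ} (hL : 0 < L) (hz : z ∈ Icc (-L) L) : bump L z ≤ 1 := by
  have := div_sq_le_one hL hz
  unfold bump
  exact pow_le_one₀ (by linarith) (by linarith [sq_nonneg (z / L)])

theorem bump_lower {L z : ℝ} (hL : 0 < L) (hz : z ∈ Icc (-(L / 2)) (L / 2)) :
    9 / 16 ≤ bump L z := by
  have := div_sq_le_one (half_pos hL) hz
  rw [div_div_eq_mul_div, mul_div_right_comm, mul_pow] at this
  unfold bump
  nlinarith [this]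

theorem continuous_bump (L : ℝ) : Continuous (bump L) := by unfold bump; fun_prop

theorem hasDerivAt_bump (L z : ℝ) :
    HasDerivAt (bump L) (-(4 * (1 - (z / L) ^ 2) * (z / L) / L)) z := by
  have h := ((((hasDerivAt_id z).div_const L).pow 2).const_sub 1).pow 2
  refine h.congr_deriv ?_
  simp; ring

/-- Testing with the bump, the viscous term (after one integration by parts) and the drift each cost
`1/8` of the quadratic term, which leaves `1/4` of the initial `1/2`. The Young remainders `32 ε² /
L² + 2 v²`, integrated over length `2L`, and the source mass make up the constant. -/
theorem bump_integral_le {ε v L : ℝ} (hL : 0 < L) {f ft fx fxx S : ℝ → ℝ → ℝ}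
    (hf : C21 f ft fx fxx) (hS : ContStrip 0 1 S)
    (hS0 : ∀ x, ∀ t ∈ Ioo (0 : ℝ) 1, 0 ≤ S x t)
    (hS1 : ∀ t ∈ Ioo (0 : ℝ) 1, ∀ l r, l ≤ r → ∫ x in l..r, S x t ≤ 1)
    (hle : ∀ x, ∀ t ∈ Ioo (0 : ℝ) 1,
      ft x t - ε * fxx x t + 1 / 2 * fx x t ^ 2 - v * fx x t ≤ S x t)
    {a b : ℝ} (ha : 0 < a) (hab : a ≤ b) (hb : b < 1) :
    (∫ z in (-L)..L, f z b * bump L z) +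
        1 / 4 * ∫ t in a..b, ∫ z in (-L)..L, fx z t ^ 2 * bump L z ≤
      (∫ z in (-L)..L, f z a * bump L z) + (64 * ε ^ 2 / L + 4 * L * v ^ 2 + 1) * (b - a) := by
  have hmem : ∀ t ∈ Icc a b, t ∈ Ioo (0 : ℝ) 1 := fun t ht =>
    ⟨ha.trans_le ht.1, ht.2.trans_lt hb⟩
  have hk : ContStrip 0 1 fun z _ => bump L z := contStrip_of_continuous (continuous_bump L)
  have hLL : -L ≤ L := by linarith
  have hint : IntervalIntegrable (fun t => ∫ z in (-L)..L, fx z t ^ 2 * bump L z) volume a b :=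
    intervalIntegrable_integral_strip ((hf.cx.pow 2).mul hk) _ _ ha hab hb
  have key := sub_le_integral_of_hasDerivAt hab
    (Y := fun t => ∫ z in (-L)..L, f z t * bump L z)
    (Y' := fun t => ∫ z in (-L)..L, ft z t * bump L z)
    (e := fun t => (64 * ε ^ 2 / L + 4 * L * v ^ 2 + 1) -
      1 / 4 * ∫ z in (-L)..L, fx z t ^ 2 * bump L z)
    (fun t ht => hasDerivAt_integral_strip (hf.c.mul hk) (hf.ct.mul hk)
      (fun x s hs => (hf.t x s hs).mul_const _) _ _ (hmem t ht))
    (intervalIntegrable_const.sub (hint.const_mul _)) ?_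
  · rw [intervalIntegral.integral_sub intervalIntegrable_const (hint.const_mul _),
      intervalIntegral.integral_const, intervalIntegral.integral_const_mul, smul_eq_mul] at key
    linarith [mul_comm (b - a) (64 * ε ^ 2 / L + 4 * L * v ^ 2 + 1)]
  intro t ht
  have ht' := hmem t (Ioo_subset_Icc_self ht)
  have cft := hf.ct.continuous_slice ht'
  have cfx := hf.cx.continuous_slice ht'
  have cfxx := hf.cxx.continuous_slice ht'
  have cS := hS.continuous_slice ht'
  have ck := continuous_bump L
  have hparts : ∫ z in (-L)..L, (fxx z t * bump L z +
      fx z t * (-(4 * (1 - (z / L) ^ 2) * (z / L) / L))) = 0 :=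
    integral_eq_zero_of_hasDerivAt (Y := fun z => fx z t * bump L z)
      (fun z => (hf.xx z t ht').mul (hasDerivAt_bump L z)) (by fun_prop)
      (by simp [bump, neg_div, div_self hL.ne']) (by simp [bump, div_self hL.ne'])
  calc ∫ z in (-L)..L, ft z t * bump L z
      = (∫ z in (-L)..L, ft z t * bump L z) - ε * ∫ z in (-L)..L, (fxx z t * bump L z +
          fx z t * (-(4 * (1 - (z / L) ^ 2) * (z / L) / L))) := by rw [hparts]; ring
    _ = ∫ z in (-L)..L, (ft z t * bump L z - ε * (fxx z t * bump L z +
          fx z t * (-(4 * (1 - (z / L) ^ 2) * (z / L) / L)))) := by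
        rw [← intervalIntegral.integral_const_mul,
          ← integral_sub_of_continuous (by fun_prop) (by fun_prop)]
    _ ≤ ∫ z in (-L)..L, ((S z t + (32 * ε ^ 2 / L ^ 2 + 2 * v ^ 2)) -
          1 / 4 * (fx z t ^ 2 * bump L z)) := by
        refine integral_mono_of_continuous (by fun_prop) (by fun_prop) hLL fun z hz => ?_
        have h1 := hle z t ht'
        have h2 := bump_le_one hL hz
        have h3 := bump_nonneg L z
        have h4 := div_sq_le_one hL hz
        have h5 := hS0 z t ht'
        have h6 : (ft z t - ε * fxx z t) * bump L z ≤
            (S z t - 1 / 2 * fx z t ^ 2 + v * fx z t) * bump L z :=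
          mul_le_mul_of_nonneg_right (by linarith) h3
        have h7 : S z t * bump L z ≤ S z t := mul_le_of_le_one_right h5 h2
        have h8 : v * fx z t * bump L z ≤ 1 / 8 * fx z t ^ 2 * bump L z + 2 * v ^ 2 := by
          have : v * fx z t * bump L z ≤ (1 / 8 * fx z t ^ 2 + 2 * v ^ 2) * bump L z :=
            mul_le_mul_of_nonneg_right (by nlinarith [sq_nonneg (fx z t - 4 * v)]) h3
          nlinarith [sq_nonneg v]
        -- The derivative of the bump keeps one factor `1 - (z / L)²`, the square root of the bump
        -- on `[-L, L]`; this is why the bump is a square.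
        have h9 : 4 * ε * (fx z t * (1 - (z / L) ^ 2)) * ((z / L) / L) ≤
            1 / 8 * fx z t ^ 2 * bump L z + 32 * ε ^ 2 / L ^ 2 := by
          have e1 : 32 * (ε * ((z / L) / L)) ^ 2 ≤ 32 * ε ^ 2 / L ^ 2 := by
            rw [mul_pow, div_pow, ← mul_div_assoc, ← mul_div_assoc]
            gcongr
            nlinarith [sq_nonneg ε]
          unfold bump
          nlinarith [sq_nonneg (fx z t * (1 - (z / L) ^ 2) - 16 * (ε * ((z / L) / L)))]
        linear_combination h6 + h7 + h8 + h9
    _ = (∫ z in (-L)..L, S z t) + 2 * L * (32 * ε ^ 2 / L ^ 2 + 2 * v ^ 2) -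
          1 / 4 * ∫ z in (-L)..L, fx z t ^ 2 * bump L z := by
        rw [integral_sub_of_continuous (by fun_prop) (by fun_prop),
          integral_add_of_continuous (by fun_prop) (by fun_prop),
          intervalIntegral.integral_const, intervalIntegral.integral_const_mul, smul_eq_mul]
        ring
    _ ≤ _ := by
        have h1 := hS1 t ht' _ _ hLL
        have h2 : 2 * L * (32 * ε ^ 2 / L ^ 2 + 2 * v ^ 2) =
            64 * ε ^ 2 / L + 4 * L * v ^ 2 := by field_simp; ring
        rw [h2]
        linarith

theorem integral_shift_mass {S : ℝ → ℝ → ℝ}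
    (hS1 : ∀ t ∈ Ioo (0 : ℝ) 1, ∀ l r, l ≤ r → ∫ x in l..r, S x t ≤ 1) (y v : ℝ) :
    ∀ t ∈ Ioo (0 : ℝ) 1, ∀ l r, l ≤ r → ∫ x in l..r, S (x + y + v * t) t ≤ 1 := by
  intro t ht l r hlr
  simp only [add_assoc]
  rw [intervalIntegral.integral_comp_add_right (fun x => S x t)]
  exact hS1 t ht _ _ (by linarith)

theorem ContStrip.shift {S : ℝ → ℝ → ℝ} (hS : ContStrip 0 1 S) (y v : ℝ) :
    ContStrip 0 1 fun x t => S (x + y + v * t) t :=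
  ContinuousOn.comp hS (f := fun p : ℝ × ℝ => (p.1 + y + v * p.2, p.2)) (by fun_prop)
    fun _ hp => ⟨mem_univ _, hp.2⟩

/-- Averages of a subsolution along a bump moving with constant speed `v`. -/
theorem HJSub.moving_bump_le {ε : ℝ} {f ft fx fxx S : ℝ → ℝ → ℝ} (h : HJSub ε f ft fx fxx S)
    {L : ℝ} (hL : 0 < L) (y v : ℝ) {a b : ℝ} (ha : 0 < a) (hab : a ≤ b) (hb : b < 1) :
    (∫ z in (-L)..L, f (z + y + v * b) b * bump L z) +
        1 / 4 * ∫ t in a..b, ∫ z in (-L)..L, fx (z + y + v * t) t ^ 2 * bump L z ≤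
      (∫ z in (-L)..L, f (z + y + v * a) a * bump L z) +
        (64 * ε ^ 2 / L + 4 * L * v ^ 2 + 1) * (b - a) := by
  refine bump_integral_le hL (h.reg.shift y v) (h.source_cont.shift y v)
    (fun x t ht => h.source_nonneg _ t ht) (integral_shift_mass h.source_mass y v)
    (fun x t ht => ?_) ha hab hb
  have := h.le_source (x + y + v * t) t ht
  linarith

/-! ### The heat kernel and local upper bounds. -/

/-- The heat kernel of `∂_t - ε ∂_x²`. -/
noncomputable def heatKer (ε z τ : ℝ) : ℝ :=
  Real.exp (-z ^ 2 / (4 * ε * τ) - Real.log (4 * Real.pi * ε * τ) / 2)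

theorem heatKer_pos (ε z τ : ℝ) : 0 < heatKer ε z τ := Real.exp_pos _

theorem heatKer_eq {ε τ : ℝ} (hε : 0 < ε) (hτ : 0 < τ) (z : ℝ) :
    heatKer ε z τ = Real.exp (-(z ^ 2 / (4 * ε * τ))) * (√(4 * Real.pi * ε * τ))⁻¹ := by
  have h : 0 < 4 * Real.pi * ε * τ := by positivity
  rw [heatKer, sub_eq_add_neg, Real.exp_add, neg_div, Real.exp_neg (Real.log _ / 2),
    Real.exp_half, Real.exp_log h]

theorem heatKer_le {ε τ : ℝ} (hε : 0 < ε) (hτ : 0 < τ) (z : ℝ) :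
    heatKer ε z τ ≤ (√(4 * Real.pi * ε * τ))⁻¹ := by
  rw [heatKer_eq hε hτ]
  exact mul_le_of_le_one_left (by positivity)
    (Real.exp_le_one_iff.2 (neg_nonpos.2 (by positivity)))

theorem hasDerivAt_heatKer_z (ε τ z : ℝ) :
    HasDerivAt (fun z => heatKer ε z τ) (heatKer ε z τ * (-(2 * z) / (4 * ε * τ))) z := by
  have h := ((((hasDerivAt_pow 2 z).neg).div_const (4 * ε * τ)).sub_const
    (Real.log (4 * Real.pi * ε * τ) / 2)).exp
  refine h.congr_deriv ?_
  simp [heatKer]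

theorem hasDerivAt_heatKer_zz (ε τ z : ℝ) :
    HasDerivAt (fun z => heatKer ε z τ * (-(2 * z) / (4 * ε * τ)))
      (heatKer ε z τ * ((-(2 * z) / (4 * ε * τ)) ^ 2 - 2 / (4 * ε * τ))) z := by
  have h := (hasDerivAt_heatKer_z ε τ z).mul
    ((((hasDerivAt_id z).const_mul 2).neg).div_const (4 * ε * τ))
  refine h.congr_deriv ?_
  simp; ring

theorem hasDerivAt_heatKer_t {ε : ℝ} (hε : 0 < ε) {T t : ℝ} (ht : t < T) (z : ℝ) :
    HasDerivAt (fun t => heatKer ε z (T - t))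
      (-(ε * (heatKer ε z (T - t) *
        ((-(2 * z) / (4 * ε * (T - t))) ^ 2 - 2 / (4 * ε * (T - t)))))) t := by
  have hτ : 0 < T - t := sub_pos.2 ht
  have h0 : HasDerivAt (fun t => T - t) (-1) t := (hasDerivAt_id t).const_sub T
  have h1 : HasDerivAt (fun t => -z ^ 2 / (4 * ε * (T - t))) (-z ^ 2 / (4 * ε * (T - t) ^ 2)) t := by
    refine ((hasDerivAt_const t (-z ^ 2)).fun_div (h0.const_mul (4 * ε))
      (by positivity)).congr_deriv ?_
    field_simp
    ring
  have h2 : HasDerivAt (fun t => Real.log (4 * Real.pi * ε * (T - t)) / 2)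
      (-1 / (2 * (T - t))) t := by
    refine (((h0.const_mul (4 * Real.pi * ε)).log (by positivity)).div_const 2).congr_deriv ?_
    field_simp
  refine (h1.fun_sub h2).exp.congr_deriv ?_
  unfold heatKer
  generalize Real.exp _ = E
  field_simp
  ring

theorem contStrip_heatKer {ε : ℝ} (hε : 0 < ε) (T : ℝ) :
    ContStrip 0 T fun z t => heatKer ε z (T - t) := by
  unfold heatKer ContStrip
  have h : ∀ p ∈ (univ : Set ℝ) ×ˢ Ioo (0 : ℝ) T, 0 < T - p.2 := fun p hp => sub_pos.2 hp.2.2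
  refine ContinuousOn.rexp (ContinuousOn.sub (ContinuousOn.div (by fun_prop) (by fun_prop)
    fun p hp => ?_) (ContinuousOn.div_const (ContinuousOn.log (by fun_prop) fun p hp => ?_) _))
  · have := h p hp; positivity
  · have := h p hp; positivity

/-- A cutoff on `[-L, L]` which is flat to fourth order at the origin. -/
noncomputable def flatBump (L z : ℝ) : ℝ := (1 - (z / L) ^ 4) ^ 2

theorem hasDerivAt_flatBump (L z : ℝ) :
    HasDerivAt (flatBump L) (-(8 * (1 - (z / L) ^ 4) * (z / L) ^ 3 / L)) z := by
  have h := ((((hasDerivAt_id z).div_const L).pow 4).const_sub 1).pow 2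
  refine h.congr_deriv ?_
  simp; ring

theorem hasDerivAt_flatBump' (L z : ℝ) :
    HasDerivAt (fun z => -(8 * (1 - (z / L) ^ 4) * (z / L) ^ 3 / L))
      ((32 * (z / L) ^ 6 - 24 * (1 - (z / L) ^ 4) * (z / L) ^ 2) / L ^ 2) z := by
  have h1 := ((hasDerivAt_id z).div_const L)
  have h := ((((h1.pow 4).const_sub 1).const_mul 8).mul (h1.pow 3)).div_const L |>.neg
  refine h.congr_deriv ?_
  simp; ring

/-- The commutator of the heat operator with the cutoff, applied to the heat kernel, is bounded. -/
theorem commutator_le {ε τ L z : ℝ} (hε : 0 < ε) (hτ : 0 < τ) (hτ1 : τ ≤ 1) (hL : 0 < L)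
    (hz : z ∈ Icc (-L) L) :
    |2 * (heatKer ε z τ * (-(2 * z) / (4 * ε * τ))) * (-(8 * (1 - (z / L) ^ 4) * (z / L) ^ 3 / L)) +
      heatKer ε z τ * ((32 * (z / L) ^ 6 - 24 * (1 - (z / L) ^ 4) * (z / L) ^ 2) / L ^ 2)| ≤
      120 * √(4 * ε) / L ^ 4 := by
  set D := 4 * ε * τ with hD
  have hD0 : 0 < D := by positivity
  set s := z ^ 2 / D with hs
  have hs0 : 0 ≤ s := by positivity
  set m := (z / L) ^ 2 with hm
  have hm0 : 0 ≤ m := sq_nonneg _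
  have hm1 : m ≤ 1 := div_sq_le_one hL hz
  have hm2 : m ^ 2 ≤ 1 := pow_le_one₀ hm0 hm1
  have hzD : z ^ 2 = s * D := by rw [hs]; field_simp
  have hmz : m = z ^ 2 / L ^ 2 := by rw [hm, div_pow]
  have hker : heatKer ε z τ ≤ Real.exp (-s) * (√D)⁻¹ := by
    rw [heatKer_eq hε hτ]
    have : D ≤ 4 * Real.pi * ε * τ := by
      rw [hD]; nlinarith [Real.pi_gt_three, mul_pos hε hτ]
    exact mul_le_mul_of_nonneg_left
      (inv_anti₀ (Real.sqrt_pos.2 hD0) (Real.sqrt_le_sqrt this)) (Real.exp_pos _).le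
  have hsqrt : √D ≤ √(4 * ε) := Real.sqrt_le_sqrt (by rw [hD]; nlinarith)
  have hDs : D * (√D)⁻¹ = √D := by
    rw [← div_eq_mul_inv, Real.div_sqrt]
  have hK := (heatKer_pos ε z τ).le
  have he1 : s * Real.exp (-s) ≤ 1 := by
    rw [Real.exp_neg, ← div_eq_mul_inv, div_le_one (Real.exp_pos _)]
    linarith [Real.add_one_le_exp s]
  have he2 : s ^ 2 * Real.exp (-s) ≤ 2 := by
    rw [Real.exp_neg, ← div_eq_mul_inv, div_le_iff₀ (Real.exp_pos _)]
    nlinarith [Real.quadratic_le_exp_of_nonneg hs0]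
  have hb1 : z ^ 2 * heatKer ε z τ ≤ √(4 * ε) := by
    calc z ^ 2 * heatKer ε z τ ≤ z ^ 2 * (Real.exp (-s) * (√D)⁻¹) := by gcongr
      _ = (s * Real.exp (-s)) * (D * (√D)⁻¹) := by rw [hzD]; ring
      _ ≤ 1 * √D := by rw [hDs]; gcongr
      _ ≤ _ := by linarith
  have hb2 : s * z ^ 2 * heatKer ε z τ ≤ 2 * √(4 * ε) := by
    calc s * z ^ 2 * heatKer ε z τ ≤ s * z ^ 2 * (Real.exp (-s) * (√D)⁻¹) := by gcongr
      _ = (s ^ 2 * Real.exp (-s)) * (D * (√D)⁻¹) := by rw [hzD]; ring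
      _ ≤ 2 * √D := by rw [hDs]; gcongr
      _ ≤ _ := by linarith
  -- Flatness of the cutoff at the origin puts a factor `z²` in every term. It compensates the
  -- blow-up of the kernel as `τ → 0`, through `s e^{-s} ≤ 1` and `s² e^{-s} ≤ 2`.
  have hexpand : 2 * (heatKer ε z τ * (-(2 * z) / D)) *
        (-(8 * (1 - (z / L) ^ 4) * (z / L) ^ 3 / L)) +
      heatKer ε z τ * ((32 * (z / L) ^ 6 - 24 * (1 - (z / L) ^ 4) * (z / L) ^ 2) / L ^ 2) =
      (32 * (1 - m ^ 2) * (s * z ^ 2 * heatKer ε z τ) +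
        (32 * m ^ 2 - 24 * (1 - m ^ 2)) * (z ^ 2 * heatKer ε z τ)) / L ^ 4 := by
    rw [hm, hs]; field_simp; ring
  rw [hexpand, abs_div, abs_of_pos (show 0 < L ^ 4 by positivity)]
  gcongr
  have q1 : 0 ≤ s * z ^ 2 * heatKer ε z τ := by positivity
  have q2 : 0 ≤ z ^ 2 * heatKer ε z τ := by positivity
  have q3 : 0 ≤ m ^ 2 := sq_nonneg _
  rw [abs_le]
  constructor <;> linarith [mul_nonneg q1 q3, mul_nonneg q2 q3, mul_nonneg q1 (sub_nonneg.2 hm2),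
    mul_nonneg q2 (sub_nonneg.2 hm2)]

theorem flatBump_nonneg (L z : ℝ) : 0 ≤ flatBump L z := sq_nonneg _

theorem flatBump_le_one {L z : ℝ} (hL : 0 < L) (hz : z ∈ Icc (-L) L) : flatBump L z ≤ 1 := by
  have h1 := div_sq_le_one hL hz
  have h2 : (z / L) ^ 4 ≤ 1 := by
    have : (z / L) ^ 4 = ((z / L) ^ 2) ^ 2 := by ring
    rw [this]; exact pow_le_one₀ (sq_nonneg _) h1
  have h3 : 0 ≤ (z / L) ^ 4 := by positivity
  exact pow_le_one₀ (by linarith) (by linarith)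

theorem continuous_flatBump (L : ℝ) : Continuous (flatBump L) := by unfold flatBump; fun_prop

/-- The heat kernel is an approximate identity. -/
theorem tendsto_integral_heatKer {ε L : ℝ} (hε : 0 < ε) (hL : 0 < L) {f : ℝ → ℝ → ℝ}
    (hf : ContStrip 0 1 f) {T : ℝ} (hT : T ∈ Ioo (0 : ℝ) 1) :
    Tendsto (fun t => ∫ z in (-L)..L, f z t * (heatKer ε z (T - t) * flatBump L z)) (𝓝[<] T)
      (𝓝 (f 0 T)) := by
  obtain ⟨a, b, ha, haT, hTb, hb⟩ := exists_Icc_mem_nhds hT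
  obtain ⟨C, hC0, hC⟩ := hf.exists_bound ha hb (-L) L
  rw [uIcc_of_le (by linarith)] at hC
  -- The parabolic length: the substitution `z = s(t) y` turns the kernel into a fixed Gaussian, and
  -- dominated convergence applies.
  set s : ℝ → ℝ := fun t => √(4 * ε * (T - t)) with hs
  have hnear : ∀ᶠ t in 𝓝[<] T, t ∈ Ico a T := Ico_mem_nhdsLT haT
  have hspos : ∀ t ∈ Ico a T, 0 < s t := fun t ht =>
    Real.sqrt_pos.2 (mul_pos (by positivity) (sub_pos.2 ht.2))
  have hs0 : Tendsto s (𝓝[<] T) (𝓝 0) := by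
    have : Continuous s := by fun_prop
    have h := this.tendsto T
    simp only [hs, sub_self, mul_zero, Real.sqrt_zero] at h
    exact h.mono_left nhdsWithin_le_nhds
  set F : ℝ → ℝ → ℝ := fun t => (Ioc (-(L / s t)) (L / s t)).indicator fun y =>
    f (s t * y) t * flatBump L (s t * y) * ((√Real.pi)⁻¹ * Real.exp (-1 * y ^ 2)) with hF
  have hmul : ∀ t ∈ Ico a T, ∀ y ∈ Ioc (-(L / s t)) (L / s t), s t * y ∈ Icc (-L) L := by
    intro t ht y hy
    have h := hspos t ht
    constructor
    · have := mul_le_mul_of_nonneg_left hy.1.le h.le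
      rwa [mul_neg, mul_div_cancel₀ _ h.ne'] at this
    · have := mul_le_mul_of_nonneg_left hy.2 h.le
      rwa [mul_div_cancel₀ _ h.ne'] at this
  have hrw : ∀ᶠ t in 𝓝[<] T, ∫ y, F t y =
      ∫ z in (-L)..L, f z t * (heatKer ε z (T - t) * flatBump L z) := by
    filter_upwards [hnear] with t ht
    have hst := hspos t ht
    have hτ : 0 < T - t := sub_pos.2 ht.2
    have hs2 : s t ^ 2 = 4 * ε * (T - t) := Real.sq_sqrt (by positivity)
    have h1 := intervalIntegral.mul_integral_comp_mul_left (a := -(L / s t)) (b := L / s t)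
      (f := fun z => f z t * (heatKer ε z (T - t) * flatBump L z)) (s t)
    rw [mul_neg, mul_div_cancel₀ _ hst.ne'] at h1
    rw [← h1, ← intervalIntegral.integral_const_mul, intervalIntegral.integral_of_le
      (by have := div_pos hL hst; linarith), ← integral_indicator measurableSet_Ioc]
    congr 1
    ext y
    simp only [hF, indicator]
    split_ifs
    · have hk : s t * heatKer ε (s t * y) (T - t) = (√Real.pi)⁻¹ * Real.exp (-1 * y ^ 2) := by
        rw [heatKer_eq hε hτ, mul_pow, hs2, mul_div_cancel_left₀ _ (by positivity),
          show 4 * Real.pi * ε * (T - t) = Real.pi * (4 * ε * (T - t)) by ring,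
          Real.sqrt_mul Real.pi_pos.le, ← hs2, Real.sqrt_sq hst.le]
        field_simp
      rw [← hk]; ring
    · rfl
  refine Tendsto.congr' hrw ?_
  have hlim : ∫ y, f 0 T * ((√Real.pi)⁻¹ * Real.exp (-1 * y ^ 2)) = f 0 T := by
    rw [integral_const_mul, integral_const_mul, integral_gaussian, div_one,
      inv_mul_cancel₀ (Real.sqrt_ne_zero'.2 Real.pi_pos), mul_one]
  rw [← hlim]
  refine tendsto_integral_filter_of_dominated_convergence
    (fun y => C * ((√Real.pi)⁻¹ * Real.exp (-1 * y ^ 2))) ?_ ?_ ?_ ?_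
  · filter_upwards [hnear] with t ht
    have hc : Continuous fun z => f z t :=
      hf.continuous_slice ⟨ha.trans_le ht.1, ht.2.trans hT.2⟩
    have hk := continuous_flatBump L
    refine Measurable.aestronglyMeasurable (Measurable.indicator ?_ measurableSet_Ioc)
    exact Continuous.measurable (by fun_prop)
  · filter_upwards [hnear] with t ht
    refine Eventually.of_forall fun y => ?_
    simp only [hF, indicator]
    split_ifs with hy
    · have hm := hmul t ht y hy
      rw [Real.norm_eq_abs, abs_mul, abs_mul, abs_of_nonneg (flatBump_nonneg _ _),
        abs_of_nonneg (show 0 ≤ (√Real.pi)⁻¹ * Real.exp (-1 * y ^ 2) by positivity)]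
      refine mul_le_mul_of_nonneg_right ?_ (by positivity)
      exact (mul_le_mul (hC _ hm t ⟨ht.1, ht.2.le.trans hTb.le⟩) (flatBump_le_one hL hm)
        (flatBump_nonneg _ _) hC0).trans_eq (mul_one C)
    · rw [norm_zero]; positivity
  · exact ((integrable_exp_neg_mul_sq one_pos).const_mul _).const_mul _
  · refine Eventually.of_forall fun y => ?_
    have hsy : Tendsto (fun t => s t * y) (𝓝[<] T) (𝓝 0) := by simpa using hs0.mul_const y
    have hin : ∀ᶠ t in 𝓝[<] T, y ∈ Ioc (-(L / s t)) (L / s t) := by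
      have h1 : ∀ᶠ t in 𝓝[<] T, s t * y ∈ Ioo (-L) L :=
        hsy.eventually (isOpen_Ioo.mem_nhds ⟨by linarith, hL⟩)
      filter_upwards [hnear, h1] with t ht h
      have hst := hspos t ht
      refine ⟨?_, ?_⟩
      · rw [neg_lt, lt_div_iff₀ hst]; linarith [h.1, mul_comm (s t) y]
      · rw [le_div_iff₀ hst]; linarith [h.2, mul_comm (s t) y]
    have hmain : Tendsto (fun t => f (s t * y) t * flatBump L (s t * y) *
        ((√Real.pi)⁻¹ * Real.exp (-1 * y ^ 2))) (𝓝[<] T)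
        (𝓝 (f 0 T * ((√Real.pi)⁻¹ * Real.exp (-1 * y ^ 2)))) := by
      refine Tendsto.mul_const _ ?_
      have h1 : Tendsto (fun t => f (s t * y) t) (𝓝[<] T) (𝓝 (f 0 T)) := by
        have hca : ContinuousAt (fun p : ℝ × ℝ => f p.1 p.2) (0, T) :=
          hf.continuousAt ((isOpen_univ.prod isOpen_Ioo).mem_nhds ⟨mem_univ _, hT⟩)
        exact hca.tendsto.comp (hsy.prodMk_nhds (tendsto_id.mono_left nhdsWithin_le_nhds))
      have h2 : Tendsto (fun t => flatBump L (s t * y)) (𝓝[<] T) (𝓝 1) := by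
        have := ((continuous_flatBump L).tendsto 0).comp hsy
        rwa [show flatBump L 0 = 1 by simp [flatBump]] at this
      simpa using h1.mul h2
    refine hmain.congr' ?_
    filter_upwards [hin] with t ht
    simp only [hF, indicator_of_mem ht]

/-- Local upper bound for subsolutions of the heat equation with a source of mass at most one. -/
theorem local_upper_bound {ε L : ℝ} (hε : 0 < ε) (hL : 0 < L) {f ft fx fxx S : ℝ → ℝ → ℝ}
    (hf : C21 f ft fx fxx) (hS : ContStrip 0 1 S)
    (hS0 : ∀ x, ∀ t ∈ Ioo (0 : ℝ) 1, 0 ≤ S x t)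
    (hS1 : ∀ t ∈ Ioo (0 : ℝ) 1, ∀ l r, l ≤ r → ∫ x in l..r, S x t ≤ 1)
    (hle : ∀ x, ∀ t ∈ Ioo (0 : ℝ) 1, ft x t - ε * fxx x t ≤ S x t)
    {a T : ℝ} (ha : 0 < a) (haT : a < T) (hT : T < 1) :
    f 0 T ≤ (√(4 * Real.pi * ε * (T - a)))⁻¹ * (∫ z in (-L)..L, |f z a|) +
      √((T - a) / (Real.pi * ε)) +
      ε * (120 * √(4 * ε) / L ^ 4) * ∫ t in a..T, ∫ z in (-L)..L, |f z t| := by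
  have hLL : -L ≤ L := by linarith
  have hT01 : T ∈ Ioo (0 : ℝ) 1 := ⟨ha.trans haT, hT⟩
  set M := ε * (120 * √(4 * ε) / L ^ 4) with hM
  have hM0 : 0 ≤ M := by positivity
  have habs : ContStrip 0 1 fun z t => |f z t| := ContinuousOn.abs hf.c
  have ck := continuous_flatBump L
  have hmono : ∀ {g : ℝ → ℝ → ℝ}, ContStrip 0 1 g → ContStrip 0 T g := fun hg =>
    hg.mono le_rfl hT.le
  have hK := contStrip_heatKer hε T
  have hχ : ContStrip 0 T fun z _ => flatBump L z := contStrip_of_continuous ck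
  set K2 : ℝ → ℝ → ℝ := fun z τ =>
    heatKer ε z τ * ((-(2 * z) / (4 * ε * τ)) ^ 2 - 2 / (4 * ε * τ)) with hK2
  have hK2c : ContStrip 0 T fun z t => K2 z (T - t) := by
    have h : ∀ p ∈ (univ : Set ℝ) ×ˢ Ioo (0 : ℝ) T, 4 * ε * (T - p.2) ≠ 0 := fun p hp =>
      (mul_pos (by positivity) (sub_pos.2 hp.2.2)).ne'
    exact hK.mul (((ContinuousOn.div (by fun_prop) (by fun_prop) h).pow 2).sub
      (ContinuousOn.div (by fun_prop) (by fun_prop) h))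
  set A : ℝ → ℝ := fun t => ∫ z in (-L)..L, f z t * (heatKer ε z (T - t) * flatBump L z) with hA
  have hbound : ∀ b, a ≤ b → b < T →
      A b + √((T - b) / (Real.pi * ε)) ≤ A a + √((T - a) / (Real.pi * ε)) +
        M * ∫ t in a..T, ∫ z in (-L)..L, |f z t| := by
    intro b hab hbT
    have hint : IntervalIntegrable (fun t => ∫ z in (-L)..L, |f z t|) volume a b :=
      intervalIntegrable_integral_strip habs _ _ ha hab (hbT.trans hT)
    -- The square root is added because its derivative is `-(4πε(T - t))^(-1/2)`, minus the sup of
    -- the kernel, and hence cancels the contribution of a source of mass at most one.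
    have key := sub_le_integral_of_hasDerivAt hab
      (Y := fun t => A t + √((T - t) / (Real.pi * ε)))
      (Y' := fun t => (∫ z in (-L)..L, (ft z t * (heatKer ε z (T - t) * flatBump L z) +
        f z t * (-(ε * K2 z (T - t)) * flatBump L z))) - (√(4 * Real.pi * ε * (T - t)))⁻¹)
      (e := fun t => M * ∫ z in (-L)..L, |f z t|) ?_ (hint.const_mul M) ?_
    · rw [intervalIntegral.integral_const_mul] at key
      have hsub : ∫ t in a..b, ∫ z in (-L)..L, |f z t| ≤ ∫ t in a..T, ∫ z in (-L)..L, |f z t| :=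
        intervalIntegral.integral_mono_interval le_rfl hab hbT.le
          (Eventually.of_forall fun t => intervalIntegral.integral_nonneg hLL
            fun z _ => abs_nonneg _)
          (intervalIntegrable_integral_strip habs _ _ ha haT.le hT)
      nlinarith [mul_le_mul_of_nonneg_left hsub hM0]
    · intro t ht
      have ht' : t ∈ Ioo 0 T := ⟨ha.trans_le ht.1, ht.2.trans_lt hbT⟩
      have hτ : 0 < T - t := sub_pos.2 ht'.2
      rw [sub_eq_add_neg]
      refine HasDerivAt.add ?_ ?_
      · have hc1 : ContStrip 0 T fun z t => f z t * (heatKer ε z (T - t) * flatBump L z) :=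
          (hmono hf.c).mul (hK.mul hχ)
        have hc2 : ContStrip 0 T fun z t => ft z t * (heatKer ε z (T - t) * flatBump L z) +
            f z t * (-(ε * K2 z (T - t)) * flatBump L z) :=
          ((hmono hf.ct).mul (hK.mul hχ)).add
            ((hmono hf.c).mul ((continuousOn_const.mul hK2c).neg.mul hχ))
        refine hasDerivAt_integral_strip hc1 hc2 (fun z s hs => ?_) _ _ ht'
        exact (hf.t z s ⟨hs.1, hs.2.trans hT⟩).mul
          ((hasDerivAt_heatKer_t hε hs.2 z).mul_const _)
      · have h0 : HasDerivAt (fun t => (T - t) / (Real.pi * ε)) (-1 / (Real.pi * ε)) t :=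
          ((hasDerivAt_id t).const_sub T).div_const _
        refine (h0.sqrt (by positivity)).congr_deriv ?_
        have e1 : 4 * Real.pi * ε * (T - t) =
            (2 * (Real.pi * ε)) ^ 2 * ((T - t) / (Real.pi * ε)) := by
          field_simp; ring
        rw [e1, Real.sqrt_mul (by positivity), Real.sqrt_sq (by positivity)]
        have : 0 < √((T - t) / (Real.pi * ε)) := Real.sqrt_pos.2 (by positivity)
        field_simp
    · intro t ht
      have ht' : t ∈ Ioo 0 T := ⟨ha.trans ht.1, ht.2.trans hbT⟩
      have ht1 : t ∈ Ioo (0 : ℝ) 1 := ⟨ht'.1, ht'.2.trans hT⟩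
      have hτ : 0 < T - t := sub_pos.2 ht'.2
      have cf := hf.c.continuous_slice ht1
      have cft := hf.ct.continuous_slice ht1
      have cfx := hf.cx.continuous_slice ht1
      have cfxx := hf.cxx.continuous_slice ht1
      have cS := hS.continuous_slice ht1
      have cK : Continuous fun z => heatKer ε z (T - t) := hK.continuous_slice ht'
      have cK2 : Continuous fun z => K2 z (T - t) := hK2c.continuous_slice ht'
      set K1 : ℝ → ℝ := fun z => heatKer ε z (T - t) * (-(2 * z) / (4 * ε * (T - t))) with hK1
      have cK1 : Continuous K1 := by fun_prop
      set χ1 : ℝ → ℝ := fun z => -(8 * (1 - (z / L) ^ 4) * (z / L) ^ 3 / L) with hχ1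
      set χ2 : ℝ → ℝ := fun z =>
        (32 * (z / L) ^ 6 - 24 * (1 - (z / L) ^ 4) * (z / L) ^ 2) / L ^ 2 with hχ2
      have cχ1 : Continuous χ1 := by fun_prop
      have cχ2 : Continuous χ2 := by fun_prop
      have hparts : ∫ z in (-L)..L, (fxx z t * (heatKer ε z (T - t) * flatBump L z) -
          f z t * (K2 z (T - t) * flatBump L z + 2 * (K1 z * χ1 z) +
            heatKer ε z (T - t) * χ2 z)) = 0 := by
        refine integral_eq_zero_of_hasDerivAt
          (Y := fun z => fx z t * (heatKer ε z (T - t) * flatBump L z) -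
            f z t * (K1 z * flatBump L z + heatKer ε z (T - t) * χ1 z)) (fun z => ?_)
          (by fun_prop) (by simp [flatBump, hχ1, neg_div, div_self hL.ne', Even.neg_pow (n := 4) ⟨2, rfl⟩])
          (by simp [flatBump, hχ1, div_self hL.ne'])
        have hk := hasDerivAt_heatKer_z ε (T - t) z
        have hk2 := hasDerivAt_heatKer_zz ε (T - t) z
        have hb := hasDerivAt_flatBump L z
        have hb2 := hasDerivAt_flatBump' L z
        refine (((hf.xx z t ht1).mul (hk.mul hb)).sub ((hf.x z t ht1).mul
          ((hk2.mul hb).add (hk.mul hb2)))).congr_deriv ?_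
        simp only [hK1, hK2, hχ1, hχ2, Pi.mul_apply, Pi.add_apply]
        ring
      have hcalc : ∫ z in (-L)..L, (ft z t * (heatKer ε z (T - t) * flatBump L z) +
          f z t * (-(ε * K2 z (T - t)) * flatBump L z)) ≤
          (√(4 * Real.pi * ε * (T - t)))⁻¹ + M * ∫ z in (-L)..L, |f z t| := by
        calc ∫ z in (-L)..L, (ft z t * (heatKer ε z (T - t) * flatBump L z) +
            f z t * (-(ε * K2 z (T - t)) * flatBump L z))
            = (∫ z in (-L)..L, (ft z t * (heatKer ε z (T - t) * flatBump L z) +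
            f z t * (-(ε * K2 z (T - t)) * flatBump L z))) -
            ε * ∫ z in (-L)..L, (fxx z t * (heatKer ε z (T - t) * flatBump L z) -
          f z t * (K2 z (T - t) * flatBump L z + 2 * (K1 z * χ1 z) +
            heatKer ε z (T - t) * χ2 z)) := by rw [hparts]; ring
          _ = ∫ z in (-L)..L, ((ft z t * (heatKer ε z (T - t) * flatBump L z) +
            f z t * (-(ε * K2 z (T - t)) * flatBump L z)) -
            ε * (fxx z t * (heatKer ε z (T - t) * flatBump L z) -
          f z t * (K2 z (T - t) * flatBump L z + 2 * (K1 z * χ1 z) +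
            heatKer ε z (T - t) * χ2 z))) := by
              rw [← intervalIntegral.integral_const_mul,
                ← integral_sub_of_continuous (by fun_prop) (by fun_prop)]
          _ ≤ ∫ z in (-L)..L, ((√(4 * Real.pi * ε * (T - t)))⁻¹ * S z t + M * |f z t|) := by
              refine integral_mono_of_continuous (by fun_prop) (by fun_prop) hLL fun z hz => ?_
              have h1 := hle z t ht1
              have h2 := flatBump_le_one hL hz
              have h3 := flatBump_nonneg L z
              have h4 := (heatKer_pos ε z (T - t)).le
              have h5 := heatKer_le hε hτ z
              have h6 := hS0 z t ht1
              have h7 := commutator_le hε hτ (by linarith [ht'.1]) hL hz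
              have h8 : heatKer ε z (T - t) * flatBump L z ≤
                  (√(4 * Real.pi * ε * (T - t)))⁻¹ := (mul_le_of_le_one_right h4 h2).trans h5
              have h9 : (ft z t - ε * fxx z t) * (heatKer ε z (T - t) * flatBump L z) ≤
                  S z t * (√(4 * Real.pi * ε * (T - t)))⁻¹ :=
                (mul_le_mul_of_nonneg_right h1 (mul_nonneg h4 h3)).trans
                  (mul_le_mul_of_nonneg_left h8 h6)
              have h10 : f z t * (2 * K1 z * χ1 z + heatKer ε z (T - t) * χ2 z) ≤
                  |f z t| * (120 * √(4 * ε) / L ^ 4) := by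
                refine (le_abs_self _).trans ?_
                rw [abs_mul]
                exact mul_le_mul_of_nonneg_left h7 (abs_nonneg _)
              rw [hM]
              linear_combination h9 + ε * h10
          _ = (√(4 * Real.pi * ε * (T - t)))⁻¹ * (∫ z in (-L)..L, S z t) +
              M * ∫ z in (-L)..L, |f z t| := by
              rw [integral_add_of_continuous (by fun_prop) (by fun_prop),
                intervalIntegral.integral_const_mul, intervalIntegral.integral_const_mul]
          _ ≤ _ := by
              have := hS1 t ht1 _ _ hLL
              have h0 : 0 ≤ (√(4 * Real.pi * ε * (T - t)))⁻¹ := by positivity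
              nlinarith
      linarith
  have hlim : Tendsto (fun t => A t + √((T - t) / (Real.pi * ε))) (𝓝[<] T) (𝓝 (f 0 T)) := by
    have h2 : Tendsto (fun t => √((T - t) / (Real.pi * ε))) (𝓝[<] T) (𝓝 0) := by
      have : Continuous fun t => √((T - t) / (Real.pi * ε)) := by fun_prop
      have h := this.tendsto T
      simp only [sub_self, zero_div, Real.sqrt_zero] at h
      exact h.mono_left nhdsWithin_le_nhds
    simpa using (tendsto_integral_heatKer hε hL hf.c hT01).add h2
  have hfin : f 0 T ≤ A a + √((T - a) / (Real.pi * ε)) +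
      M * ∫ t in a..T, ∫ z in (-L)..L, |f z t| := by
    refine le_of_tendsto hlim ?_
    filter_upwards [Ico_mem_nhdsLT haT] with t ht using hbound t ht.1 ht.2
  have hAa : A a ≤ (√(4 * Real.pi * ε * (T - a)))⁻¹ * ∫ z in (-L)..L, |f z a| := by
    have ha1 : a ∈ Ioo (0 : ℝ) 1 := ⟨ha, haT.trans hT⟩
    have cf := hf.c.continuous_slice ha1
    have cK : Continuous fun z => heatKer ε z (T - a) := hK.continuous_slice ⟨ha, haT⟩
    rw [hA, ← intervalIntegral.integral_const_mul]
    refine integral_mono_of_continuous (by fun_prop) (by fun_prop) hLL fun z hz => ?_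
    have h2 := flatBump_le_one hL hz
    have h3 := flatBump_nonneg L z
    have h4 := (heatKer_pos ε z (T - a)).le
    have h5 := heatKer_le hε (sub_pos.2 haT) z
    calc f z a * (heatKer ε z (T - a) * flatBump L z)
        ≤ |f z a| * (heatKer ε z (T - a) * flatBump L z) :=
          mul_le_mul_of_nonneg_right (le_abs_self _) (mul_nonneg h4 h3)
      _ ≤ |f z a| * (√(4 * Real.pi * ε * (T - a)))⁻¹ :=
          mul_le_mul_of_nonneg_left ((mul_le_of_le_one_right h4 h2).trans h5) (abs_nonneg _)
      _ = _ := mul_comm _ _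
  linarith

/-- Averaging `local_upper_bound` over initial times in an interval strictly before `a` replaces the
initial slice by a space-time integral. The order of quantifiers matters: the constant is the same
for all subsolutions, hence for all translates and all regularisations used later. -/
theorem local_upper_bound_of_integral {ε L a₁ a : ℝ} (hε : 0 < ε) (hL : 0 < L) (ha₁ : 0 < a₁)
    (ha : a₁ < a) :
    ∃ C, 0 ≤ C ∧ ∀ {f ft fx fxx S : ℝ → ℝ → ℝ}, C21 f ft fx fxx → ContStrip 0 1 S →
      (∀ x, ∀ t ∈ Ioo (0 : ℝ) 1, 0 ≤ S x t) →
      (∀ t ∈ Ioo (0 : ℝ) 1, ∀ l r, l ≤ r → ∫ x in l..r, S x t ≤ 1) →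
      (∀ x, ∀ t ∈ Ioo (0 : ℝ) 1, ft x t - ε * fxx x t ≤ S x t) →
      ∀ {T b : ℝ}, a ≤ T → T ≤ b → b < 1 →
        f 0 T ≤ C * (1 + ∫ t in a₁..b, ∫ z in (-L)..L, |f z t|) := by
  obtain ⟨a₂, h₁₂, h₂⟩ := exists_between ha
  set κ := (√(4 * Real.pi * ε * (a - a₂)))⁻¹ with hκ
  set c := √(1 / (Real.pi * ε)) with hc
  set M := ε * (120 * √(4 * ε) / L ^ 4) with hM
  have hκ0 : 0 ≤ κ := by positivity
  have hc0 : 0 ≤ c := Real.sqrt_nonneg _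
  have hM0 : 0 ≤ M := by positivity
  have hd : 0 < a₂ - a₁ := sub_pos.2 h₁₂
  refine ⟨κ / (a₂ - a₁) + c + M, by positivity, ?_⟩
  intro f ft fx fxx S hf hS hS0 hS1 hle T b haT hTb hb
  have hLL : -L ≤ L := by linarith
  have habs : ContStrip 0 1 fun z t => |f z t| := ContinuousOn.abs hf.c
  set N : ℝ → ℝ := fun t => ∫ z in (-L)..L, |f z t| with hN
  have hN0 : ∀ t, 0 ≤ N t := fun t => intervalIntegral.integral_nonneg hLL fun z _ => abs_nonneg _
  have hNi : ∀ {p q : ℝ}, 0 < p → p ≤ q → q < 1 → IntervalIntegrable N volume p q :=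
    fun hp hpq hq => intervalIntegrable_integral_strip habs _ _ hp hpq hq
  set I := ∫ t in a₁..b, N t with hI
  have hab : a₁ ≤ b := by linarith
  have hsub : ∀ {p q : ℝ}, a₁ ≤ p → p ≤ q → q ≤ b → ∫ t in p..q, N t ≤ I := fun hp hpq hq =>
    intervalIntegral.integral_mono_interval hp hpq hq (Eventually.of_forall hN0) (hNi ha₁ hab hb)
  have hI0 : 0 ≤ I := intervalIntegral.integral_nonneg hab fun t _ => hN0 t
  have hpt : ∀ s ∈ Icc a₁ a₂, f 0 T ≤ κ * N s + (c + M * I) := by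
    intro s hs
    have h := local_upper_bound hε hL hf hS hS0 hS1 hle (a := s) (T := T) (by linarith [hs.1])
      (by linarith [hs.2]) (by linarith)
    have e1 : (√(4 * Real.pi * ε * (T - s)))⁻¹ ≤ κ := by
      have : 0 < a - a₂ := sub_pos.2 h₂
      refine inv_anti₀ (Real.sqrt_pos.2 (by positivity)) (Real.sqrt_le_sqrt ?_)
      gcongr
      exact hs.2
    have e2 : √((T - s) / (Real.pi * ε)) ≤ c := by
      refine Real.sqrt_le_sqrt ?_
      gcongr
      linarith [hs.1]
    have e3 : ∫ t in s..T, N t ≤ I := hsub hs.1 (by linarith [hs.2]) hTb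
    calc f 0 T ≤ _ := h
      _ ≤ κ * N s + c + M * I := by
        have := mul_le_mul_of_nonneg_right e1 (hN0 s)
        have := mul_le_mul_of_nonneg_left e3 hM0
        linarith
      _ = _ := by ring
  have hint : ∫ _ in a₁..a₂, f 0 T ≤ ∫ s in a₁..a₂, (κ * N s + (c + M * I)) :=
    intervalIntegral.integral_mono_on h₁₂.le intervalIntegrable_const
      (((hNi ha₁ h₁₂.le (by linarith)).const_mul κ).add intervalIntegrable_const) hpt
  rw [intervalIntegral.integral_const, intervalIntegral.integral_add
    ((hNi ha₁ h₁₂.le (by linarith)).const_mul κ) intervalIntegrable_const,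
    intervalIntegral.integral_const_mul, intervalIntegral.integral_const, smul_eq_mul,
    smul_eq_mul] at hint
  have h3 : ∫ s in a₁..a₂, N s ≤ I := hsub le_rfl h₁₂.le (by linarith)
  have h4 : (a₂ - a₁) * f 0 T ≤ (a₂ - a₁) * (κ / (a₂ - a₁) * I + (c + M * I)) := by
    have e : (a₂ - a₁) * (κ / (a₂ - a₁) * I + (c + M * I)) =
      κ * I + (a₂ - a₁) * (c + M * I) := by field_simp
    rw [e]
    have := mul_le_mul_of_nonneg_left h3 hκ0
    linarith
  have h5 := le_of_mul_le_mul_left h4 hd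
  have h6 : 0 ≤ κ / (a₂ - a₁) := by positivity
  nlinarith [mul_nonneg hc0 hI0]

/-! ### Quadratic growth of subsolutions. -/

theorem integral_bump_one : ∫ z in (-1 : ℝ)..1, bump 1 z = 16 / 15 := by
  have h : ∀ z : ℝ, bump 1 z = 1 - 2 * z ^ 2 + z ^ 4 := fun z => by unfold bump; ring
  simp only [h]
  rw [integral_add_of_continuous (by fun_prop) (by fun_prop),
    integral_sub_of_continuous (by fun_prop) (by fun_prop)]
  simp only [intervalIntegral.integral_const, intervalIntegral.integral_const_mul, integral_pow]
  norm_num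

/-- Pointwise control by an average and the energy. -/
theorem abs_le_average_add_energy {g g' : ℝ → ℝ} (hg : ∀ x, HasDerivAt g (g' x) x)
    (hc : Continuous g') {x : ℝ} (hx : x ∈ Icc (-1 : ℝ) 1) :
    |g x| ≤ |∫ z in (-1 : ℝ)..1, g z * bump 1 z| + 2 +
      2 * ∫ z in (-2 : ℝ)..2, g' z ^ 2 * bump 2 z := by
  have cg : Continuous g := continuous_iff_continuousAt.2 fun x => (hg x).continuousAt
  have ck := continuous_bump 1
  have ck2 := continuous_bump 2
  set D := ∫ z in (-2 : ℝ)..2, g' z ^ 2 * bump 2 z with hD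
  -- `|g'| ≤ 1/2 + g'² / 2`, and the wider bump is at least `9/16` on `[-1, 1]`.
  have hE : ∫ z in (-1 : ℝ)..1, |g' z| ≤ 1 + D := by
    have h1 : ∫ z in (-1 : ℝ)..1, |g' z| ≤ ∫ z in (-1 : ℝ)..1, (1 / 2 + g' z ^ 2 * bump 2 z) := by
      refine integral_mono_of_continuous (by fun_prop) (by fun_prop) (by norm_num) fun z hz => ?_
      have hb := bump_lower (L := 2) (by norm_num) (z := z) (by simpa using hz)
      have := mul_le_mul_of_nonneg_left hb (sq_nonneg (g' z))
      nlinarith [sq_abs (g' z), sq_nonneg (|g' z| - 1), abs_nonneg (g' z)]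
    have h2 : ∫ z in (-1 : ℝ)..1, g' z ^ 2 * bump 2 z ≤ D :=
      intervalIntegral.integral_mono_interval (by norm_num) (by norm_num) (by norm_num)
        (Eventually.of_forall fun z => mul_nonneg (sq_nonneg _) (bump_nonneg _ _))
        (Continuous.intervalIntegrable (by fun_prop) _ _)
    rw [integral_add_of_continuous (by fun_prop) (by fun_prop)] at h1
    simp only [intervalIntegral.integral_const] at h1
    norm_num at h1
    linarith
  have hosc : ∀ z ∈ Icc (-1 : ℝ) 1, |g x - g z| ≤ 1 + D := by
    intro z hz
    rw [← intervalIntegral.integral_eq_sub_of_hasDerivAt (a := z) (b := x) (fun y _ => hg y)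
      (hc.intervalIntegrable z x)]
    have hn := intervalIntegral.norm_integral_le_abs_integral_norm (f := g') (a := z) (b := x)
      (μ := volume)
    rw [Real.norm_eq_abs] at hn
    refine hn.trans (le_trans ?_ hE)
    have hci : IntervalIntegrable (fun y => |g' y|) volume (-1) 1 :=
      Continuous.intervalIntegrable (by fun_prop) _ _
    rcases le_total z x with h | h
    · rw [abs_of_nonneg (intervalIntegral.integral_nonneg h fun y _ => norm_nonneg (g' y))]
      exact intervalIntegral.integral_mono_interval hz.1 h hx.2
        (Eventually.of_forall fun y => abs_nonneg _) hci
    · rw [intervalIntegral.integral_symm, abs_neg,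
        abs_of_nonneg (intervalIntegral.integral_nonneg h fun y _ => norm_nonneg (g' y))]
      exact intervalIntegral.integral_mono_interval hx.1 h hz.2
        (Eventually.of_forall fun y => abs_nonneg _) hci
  have hdiff : |∫ z in (-1 : ℝ)..1, (g x - g z) * bump 1 z| ≤ 2 * (1 + D) := by
    refine (intervalIntegral.norm_integral_le_of_norm_le_const (a := -1) (b := 1) (C := 1 + D)
      (f := fun z => (g x - g z) * bump 1 z) ?_).trans ?_
    · intro z hz
      rw [uIoc_of_le (by norm_num)] at hz
      have hz' := Ioc_subset_Icc_self hz
      rw [Real.norm_eq_abs, abs_mul, abs_of_nonneg (bump_nonneg _ _)]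
      exact (mul_le_of_le_one_right (abs_nonneg _) (bump_le_one one_pos hz')).trans (hosc z hz')
    · norm_num; linarith
  have hsplit : g x * (16 / 15) = (∫ z in (-1 : ℝ)..1, g z * bump 1 z) +
      ∫ z in (-1 : ℝ)..1, (g x - g z) * bump 1 z := by
    rw [← integral_bump_one, ← intervalIntegral.integral_const_mul,
      ← integral_add_of_continuous (by fun_prop) (by fun_prop)]
    congr 1; ext z; ring
  calc |g x| ≤ |g x * (16 / 15)| := by
        rw [abs_mul, abs_of_pos (show (0 : ℝ) < 16 / 15 by norm_num)]
        linarith [abs_nonneg (g x)]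
    _ ≤ _ := by
        rw [hsplit]
        refine (abs_add_le _ _).trans ?_
        linarith

namespace HJSub

variable {ε : ℝ} {f ft fx fxx S : ℝ → ℝ → ℝ}

/-- Comparison of averages of a subsolution around two points at two times. -/
theorem average_le (h : HJSub ε f ft fx fxx S) {L : ℝ} (hL : 0 < L) (y₁ y₂ : ℝ) {s t : ℝ}
    (hs : 0 < s) (hst : s < t) (ht : t < 1) :
    ∫ z in (-L)..L, f (z + y₂) t * bump L z ≤ (∫ z in (-L)..L, f (z + y₁) s * bump L z) +
      (64 * ε ^ 2 / L + 1) * (t - s) + 4 * L * (y₂ - y₁) ^ 2 / (t - s) := by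
  have hts : 0 < t - s := sub_pos.2 hst
  -- The speed that carries the bump from `y₁` at time `s` to `y₂` at time `t`.
  set v := (y₂ - y₁) / (t - s) with hv
  have key := h.moving_bump_le hL (y₁ - v * s) v hs hst.le ht
  have hpos : 0 ≤ ∫ τ in s..t, ∫ z in (-L)..L,
      fx (z + (y₁ - v * s) + v * τ) τ ^ 2 * bump L z :=
    intervalIntegral.integral_nonneg hst.le fun τ _ =>
      intervalIntegral.integral_nonneg (by linarith) fun z _ =>
        mul_nonneg (sq_nonneg _) (bump_nonneg _ _)
  have e1 : ∀ z, z + (y₁ - v * s) + v * t = z + y₂ := fun z => by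
    rw [hv]; field_simp; ring
  have e2 : ∀ z, z + (y₁ - v * s) + v * s = z + y₁ := fun z => by ring
  simp only [e1, e2] at key
  have e3 : (64 * ε ^ 2 / L + 4 * L * v ^ 2 + 1) * (t - s) =
      (64 * ε ^ 2 / L + 1) * (t - s) + 4 * L * (y₂ - y₁) ^ 2 / (t - s) := by
    rw [hv]; field_simp; ring
  linarith

/-- Averages of a subsolution grow at most quadratically. -/
theorem exists_average_bound (h : HJSub ε f ft fx fxx S) {L : ℝ} (hL : 0 < L) {a b : ℝ}
    (ha : 0 < a) (hb : b < 1) :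
    ∃ C, 0 ≤ C ∧ ∀ y, ∀ t ∈ Icc a b,
      |∫ z in (-L)..L, f (z + y) t * bump L z| ≤ C * (1 + y ^ 2) := by
  obtain ⟨a₀, ha₀, ha₀a⟩ := exists_between ha
  obtain ⟨b₀, hbb₀, hb₀⟩ := exists_between hb
  set A : ℝ → ℝ → ℝ := fun y t => ∫ z in (-L)..L, f (z + y) t * bump L z with hA
  have hp : 0 < a - a₀ := sub_pos.2 ha₀a
  have hq : 0 < b₀ - b := sub_pos.2 hbb₀
  have hmove : ∀ y₁ y₂ s t, 0 < s → s < t → t < 1 →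
      A y₂ t ≤ A y₁ s + (64 * ε ^ 2 / L + 1) * (t - s) + 4 * L * (y₂ - y₁) ^ 2 / (t - s) :=
    fun y₁ y₂ s t hs hst ht => h.average_le hL y₁ y₂ hs hst ht
  set K := 64 * ε ^ 2 / L + 1 with hK
  have hK0 : 0 < K := by positivity
  refine ⟨|A 0 a₀| + |A 0 b₀| + K + 4 * L / (a - a₀) + 4 * L / (b₀ - b), by positivity, ?_⟩
  intro y t ht
  have hy := sq_nonneg y
  -- The upper bound transports from the origin at the earlier time `a₀` to `y`; the lower bound
  -- transports from `y` to the origin at the later time `b₀`. The travel times stay bounded below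
  -- by `a - a₀` and `b₀ - b`.
  have h1 := hmove 0 y a₀ t ha₀ (by linarith [ht.1]) (by linarith [ht.2])
  have h2 := hmove y 0 t b₀ (by linarith [ht.1]) (by linarith [ht.2]) hb₀
  have h3 : 4 * L * (y - 0) ^ 2 / (t - a₀) ≤ 4 * L / (a - a₀) * y ^ 2 := by
    rw [sub_zero, div_mul_eq_mul_div]
    gcongr
    exact ht.1
  have h4 : 4 * L * (0 - y) ^ 2 / (b₀ - t) ≤ 4 * L / (b₀ - b) * y ^ 2 := by
    rw [zero_sub, neg_sq, div_mul_eq_mul_div]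
    gcongr
    exact ht.2
  have h5 : K * (t - a₀) ≤ K := mul_le_of_le_one_right hK0.le (by linarith [ht.2])
  have h6 : K * (b₀ - t) ≤ K := mul_le_of_le_one_right hK0.le (by linarith [ht.1])
  have q1 : 0 ≤ 4 * L / (a - a₀) := by positivity
  have q2 : 0 ≤ 4 * L / (b₀ - b) := by positivity
  have q3 := abs_nonneg (A 0 a₀)
  have q4 := abs_nonneg (A 0 b₀)
  have q5 := le_abs_self (A 0 a₀)
  have q6 := neg_abs_le (A 0 b₀)
  have m1 := mul_nonneg q1 hy
  have m2 := mul_nonneg q2 hy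
  have m3 := mul_nonneg q3 hy
  have m4 := mul_nonneg q4 hy
  have m5 := mul_nonneg hK0.le hy
  change |A y t| ≤ _
  rw [abs_le]
  constructor <;> linarith

/-- Two-sided control of the averages at the two end times bounds the energy in between, by the
motionless case `v = 0` of `moving_bump_le`. The oscillation of `f` around its average is then
controlled by that energy. -/
theorem exists_integral_abs_bound (h : HJSub ε f ft fx fxx S) {a b : ℝ} (ha : 0 < a)
    (hab : a ≤ b) (hb : b < 1) :
    ∃ C, 0 ≤ C ∧ ∀ y, ∫ t in a..b, ∫ z in (-1 : ℝ)..1, |f (z + y) t| ≤ C * (1 + y ^ 2) := by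
  obtain ⟨C₁, hC₁0, hC₁⟩ := h.exists_average_bound one_pos ha hb
  obtain ⟨C₂, hC₂0, hC₂⟩ := h.exists_average_bound two_pos ha hb
  refine ⟨2 * C₁ + 4 + 4 * (4 * (2 * C₂ + (64 * ε ^ 2 / 2 + 1))), by positivity, fun y => ?_⟩
  have hr := h.reg.shift y 0
  simp only [zero_mul, add_zero] at hr
  have hk : ContStrip 0 1 fun z _ => bump 2 z := contStrip_of_continuous (continuous_bump 2)
  set D : ℝ → ℝ := fun t => ∫ z in (-2 : ℝ)..2, fx (z + y) t ^ 2 * bump 2 z with hD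
  have hDi : IntervalIntegrable D volume a b :=
    intervalIntegrable_integral_strip ((hr.cx.pow 2).mul hk) _ _ ha hab hb
  have hmem : ∀ t ∈ Icc a b, t ∈ Ioo (0 : ℝ) 1 := fun t ht =>
    ⟨ha.trans_le ht.1, ht.2.trans_lt hb⟩
  have hDint : ∫ t in a..b, D t ≤ 4 * (2 * C₂ + (64 * ε ^ 2 / 2 + 1)) * (1 + y ^ 2) := by
    have key := h.moving_bump_le two_pos y 0 ha hab hb
    simp only [zero_mul, add_zero] at key
    have h1 := (abs_le.1 (hC₂ y a ⟨le_rfl, hab⟩)).2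
    have h2 := (abs_le.1 (hC₂ y b ⟨hab, le_rfl⟩)).1
    have h3 : (64 * ε ^ 2 / 2 + 4 * 2 * (0 : ℝ) ^ 2 + 1) * (b - a) ≤ 64 * ε ^ 2 / 2 + 1 := by
      have : 0 < 64 * ε ^ 2 / 2 + 1 := by positivity
      nlinarith
    nlinarith [sq_nonneg y, sq_nonneg ε, mul_nonneg (sq_nonneg ε) (sq_nonneg y)]
  have hpt : ∀ t ∈ Icc a b,
      ∫ z in (-1 : ℝ)..1, |f (z + y) t| ≤ (2 * C₁ * (1 + y ^ 2) + 4) + 4 * D t := by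
    intro t ht
    have ht' := hmem t ht
    have h1 : ∀ z ∈ Icc (-1 : ℝ) 1, |f (z + y) t| ≤ C₁ * (1 + y ^ 2) + 2 + 2 * D t := by
      intro z hz
      have := abs_le_average_add_energy (fun x => hr.x x t ht') (hr.cx.continuous_slice ht') hz
      linarith [hC₁ y t ht]
    have cf : Continuous fun z => f (z + y) t := hr.c.continuous_slice ht'
    have := integral_mono_of_continuous (f := fun z => |f (z + y) t|) cf.abs
      continuous_const (by norm_num : (-1 : ℝ) ≤ 1) h1
    rw [intervalIntegral.integral_const, smul_eq_mul] at this
    linarith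
  have habs : ContStrip 0 1 fun z t => |f (z + y) t| := ContinuousOn.abs hr.c
  have hfin := intervalIntegral.integral_mono_on hab
    (intervalIntegrable_integral_strip habs (-1) 1 ha hab hb)
    (intervalIntegrable_const.add (hDi.const_mul 4)) hpt
  rw [intervalIntegral.integral_add intervalIntegrable_const (hDi.const_mul 4),
    intervalIntegral.integral_const, intervalIntegral.integral_const_mul, smul_eq_mul] at hfin
  have hle : (b - a) * (2 * C₁ * (1 + y ^ 2) + 4) ≤ 2 * C₁ * (1 + y ^ 2) + 4 :=
    mul_le_of_le_one_left (by positivity) (by linarith)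
  nlinarith [sq_nonneg y]

/-- A subsolution grows at most quadratically from above. -/
theorem exists_upper_bound (hε : 0 < ε) (h : HJSub ε f ft fx fxx S) {a b : ℝ} (ha : 0 < a)
    (hb : b < 1) :
    ∃ N, 0 ≤ N ∧ ∀ y, ∀ t ∈ Icc a b, f y t ≤ N * (1 + y ^ 2) := by
  rcases lt_or_ge b a with hba | hab
  · exact ⟨0, le_rfl, fun y t ht => absurd (ht.1.trans ht.2) (not_le.2 hba)⟩
  obtain ⟨C₁, hC₁0, hC₁⟩ := h.exists_integral_abs_bound (half_pos ha) (by linarith) hb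
  obtain ⟨C, hC0, hC⟩ := local_upper_bound_of_integral hε one_pos (half_pos ha) (half_lt_self ha)
  refine ⟨C * (1 + C₁), by positivity, fun y t ht => ?_⟩
  have hr := h.reg.shift y 0
  have hS := h.source_cont.shift y 0
  have hS1 := integral_shift_mass h.source_mass y 0
  simp only [zero_mul, add_zero] at hr hS hS1
  have key := hC hr hS (fun x s hs => h.source_nonneg _ s hs) hS1 (fun x s hs => by
    have := h.le_source (x + y) s hs
    have := sq_nonneg (fx (x + y) s)
    linarith) ht.1 ht.2 hb
  rw [zero_add] at key
  refine key.trans ?_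
  rw [mul_assoc]
  refine mul_le_mul_of_nonneg_left ?_ hC0
  nlinarith [hC₁ y, sq_nonneg y]

end HJSub

/-! ### Hopf–Cole transform and positivity of the density. -/

/-- Classical solutions of the system with a nonnegative density of unit mass, with named
derivatives. -/
structure Classical (ε : ℝ) (u ut ux uxx ρ ρt ρx ρxx : ℝ → ℝ → ℝ) : Prop where
  pos : 0 < ε
  u_reg : C21 u ut ux uxx
  ρ_reg : C21 ρ ρt ρx ρxx
  nonneg : ∀ x, ∀ t ∈ Ioo (0 : ℝ) 1, 0 ≤ ρ x t
  hj : ∀ x, ∀ t ∈ Ioo (0 : ℝ) 1, ut x t - ε * uxx x t + 1 / 2 * ux x t ^ 2 = ρ x t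
  fp : ∀ x, ∀ t ∈ Ioo (0 : ℝ) 1,
    ρt x t + ε * ρxx x t + (uxx x t * ρ x t + ux x t * ρx x t) = 0
  mass_le : ∀ t ∈ Ioo (0 : ℝ) 1, ∀ l r, l ≤ r → ∫ x in l..r, ρ x t ≤ 1
  ne_zero : ∀ t ∈ Ioo (0 : ℝ) 1, ∃ x, ρ x t ≠ 0

namespace Classical

variable {ε : ℝ} {u ut ux uxx ρ ρt ρx ρxx : ℝ → ℝ → ℝ}

/-- The second factor `ρ e^{u / (2ε)}` of the Hopf–Cole transform solves a linear equation. -/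
theorem exists_hopfCole (h : Classical ε u ut ux uxx ρ ρt ρx ρxx) :
    ∃ φt φx φxx, C21 (fun x t => ρ x t * Real.exp (u x t / (2 * ε))) φt φx φxx ∧
      ∀ x, ∀ t ∈ Ioo (0 : ℝ) 1, φt x t + ε * φxx x t =
        ρ x t * Real.exp (u x t / (2 * ε)) * ρ x t / (2 * ε) := by
  have hε := h.pos
  have hE := h.u_reg.comp (Φ := fun y => Real.exp (y / (2 * ε)))
    (Φ' := fun y => Real.exp (y / (2 * ε)) / (2 * ε))
    (Φ'' := fun y => Real.exp (y / (2 * ε)) / (2 * ε) / (2 * ε)) (s := univ)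
    (fun _ _ _ => mem_univ _)
    (fun y _ => (((hasDerivAt_id y).div_const (2 * ε)).exp).congr_deriv (by simp; ring))
    (fun y _ => ((((hasDerivAt_id y).div_const (2 * ε)).exp).div_const (2 * ε)).congr_deriv
      (by simp; ring)) (by fun_prop)
  refine ⟨_, _, _, h.ρ_reg.mul hE, fun x t ht => ?_⟩
  have h1 := h.hj x t ht
  have h2 := h.fp x t ht
  have e1 : ut x t = ρ x t + ε * uxx x t - 1 / 2 * ux x t ^ 2 := by linarith
  have e2 : ρt x t = -(ε * ρxx x t + (uxx x t * ρ x t + ux x t * ρx x t)) := by linarith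
  simp only [e1, e2]
  field_simp
  ring

/-- The regularised backward potential `-2ε log (ρ e^{u / (2ε)} + δ)`, with time reversed, is a
subsolution of the Hamilton–Jacobi equation. -/
theorem exists_hjSub (h : Classical ε u ut ux uxx ρ ρt ρx ρxx) {δ : ℝ} (hδ : 0 ≤ δ)
    (hpos : ∀ x, ∀ t ∈ Ioo (0 : ℝ) 1, 0 < ρ x t * Real.exp (u x t / (2 * ε)) + δ) :
    ∃ gt gx gxx, C21 (fun x t => -2 * ε * Real.log (ρ x t * Real.exp (u x t / (2 * ε)) + δ))
      gt gx gxx ∧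
      (∀ x, ∀ t ∈ Ioo (0 : ℝ) 1, -gt x t - ε * gxx x t + 1 / 2 * gx x t ^ 2 =
        ρ x t * (ρ x t * Real.exp (u x t / (2 * ε)) /
          (ρ x t * Real.exp (u x t / (2 * ε)) + δ))) ∧
      HJSub ε (fun x t => -2 * ε *
        Real.log (ρ x (1 - t) * Real.exp (u x (1 - t) / (2 * ε)) + δ))
        (fun x t => -gt x (1 - t)) (fun x t => gx x (1 - t)) (fun x t => gxx x (1 - t))
        (fun x t => ρ x (1 - t)) := by
  have hε := h.pos
  obtain ⟨φt, φx, φxx, hφ, heq⟩ := h.exists_hopfCole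
  have hg := hφ.comp (Φ := fun y => -2 * ε * Real.log (y + δ)) (Φ' := fun y => -2 * ε / (y + δ))
    (Φ'' := fun y => 2 * ε / (y + δ) ^ 2) (s := {y | 0 < y + δ}) hpos
    (fun y hy => ((((hasDerivAt_id y).add_const δ).log (ne_of_gt hy)).const_mul
      (-2 * ε)).congr_deriv (by simp; ring))
    (fun y hy => ((hasDerivAt_const y (-2 * ε)).fun_div ((hasDerivAt_id y).add_const δ)
      (ne_of_gt hy)).congr_deriv (by simp))
    (ContinuousOn.div (by fun_prop) (by fun_prop) fun y hy => pow_ne_zero _ (ne_of_gt hy))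
  refine ⟨_, _, _, hg, ?_⟩
  -- The subsolution property follows from the identity, since `φ / (φ + δ) ≤ 1`; the identity is
  -- proved first, then the implication.
  rw [and_iff_left_of_imp]
  · intro x t ht
    have hy := (hpos x t ht).ne'
    have e1 : φt x t = ρ x t * Real.exp (u x t / (2 * ε)) * ρ x t / (2 * ε) - ε * φxx x t := by
      linarith [heq x t ht]
    rw [e1]
    field_simp
    ring
  · intro heq2
    have hm : ∀ {t : ℝ}, t ∈ Ioo (0 : ℝ) 1 → 1 - t ∈ Ioo (0 : ℝ) 1 := fun h =>
      ⟨by linarith [h.2], by linarith [h.1]⟩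
    refine ⟨hg.reverse, h.ρ_reg.reverse.c, fun x t ht => h.nonneg x _ (hm ht),
      fun t ht => h.mass_le _ (hm ht), fun x t ht => ?_⟩
    rw [heq2 x _ (hm ht)]
    refine mul_le_of_le_one_right (h.nonneg x _ (hm ht)) ((div_le_one (hpos x _ (hm ht))).2 ?_)
    linarith

/-- Strong maximum principle: the density is positive. -/
theorem density_pos (h : Classical ε u ut ux uxx ρ ρt ρx ρxx) (x₀ : ℝ) {t₀ : ℝ}
    (ht₀ : t₀ ∈ Ioo (0 : ℝ) 1) : 0 < ρ x₀ t₀ := by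
  have hε := h.pos
  set φ : ℝ → ℝ → ℝ := fun x t => ρ x t * Real.exp (u x t / (2 * ε)) with hφ
  have hm : ∀ {t : ℝ}, t ∈ Ioo (0 : ℝ) 1 → 1 - t ∈ Ioo (0 : ℝ) 1 := fun h =>
    ⟨by linarith [h.2], by linarith [h.1]⟩
  have hφ0 : ∀ x, ∀ t ∈ Ioo (0 : ℝ) 1, 0 ≤ φ x t := fun x t ht =>
    mul_nonneg (h.nonneg x t ht) (Real.exp_pos _).le
  have hφc : ContStrip 0 1 φ := by
    obtain ⟨_, _, _, hr, -⟩ := h.exists_hopfCole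
    exact hr.c
  -- Positivity propagates backward in time, so the starting point is a point of positivity at a
  -- later time `t₁`. In reversed time it becomes the earlier time `s₁`.
  obtain ⟨t₁, h01, h1⟩ := exists_between ht₀.2
  have ht₁ : t₁ ∈ Ioo (0 : ℝ) 1 := ⟨ht₀.1.trans h01, h1⟩
  obtain ⟨x₁, hx₁⟩ := h.ne_zero t₁ ht₁
  have hφ1 : 0 < φ x₁ t₁ :=
    mul_pos ((h.nonneg x₁ t₁ ht₁).lt_of_ne' hx₁) (Real.exp_pos _)
  have hcont : Continuous fun x => φ x t₁ := hφc.continuous_slice ht₁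
  obtain ⟨L, hL, hLm⟩ : ∃ L, 0 < L ∧ ∀ z ∈ Icc (-L) L, φ x₁ t₁ / 2 ≤ φ (z + x₁) t₁ := by
    have hev : ∀ᶠ x in 𝓝 x₁, φ x₁ t₁ / 2 < φ x t₁ :=
      hcont.continuousAt.eventually (lt_mem_nhds (half_lt_self hφ1))
    obtain ⟨r, hr, hball⟩ := Metric.eventually_nhds_iff.1 hev
    refine ⟨r / 2, half_pos hr, fun z hz => (hball ?_).le⟩
    rw [Real.dist_eq, add_sub_cancel_right]
    exact (abs_le.2 hz).trans_lt (half_lt_self hr)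
  set m := φ x₁ t₁ / 2 with hmdef
  have hm0 : 0 < m := half_pos hφ1
  set s₁ := 1 - t₁ with hs₁
  set s₀ := 1 - t₀ with hs₀
  have hs₁0 : s₁ ∈ Ioo (0 : ℝ) 1 := hm ht₁
  have hs₀0 : s₀ ∈ Ioo (0 : ℝ) 1 := hm ht₀
  have hs10 : s₁ < s₀ := by rw [hs₁, hs₀]; linarith
  obtain ⟨a₁, ha₁, ha₁'⟩ := exists_between hs10
  have ha₁0 : 0 < a₁ := hs₁0.1.trans ha₁
  obtain ⟨Cφ, hCφ0, hCφ⟩ := hφc.exists_bound (a := t₀) (b := 1 - a₁) ht₀.1 (by linarith)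
    (-L + x₀) (L + x₀)
  rw [uIcc_of_le (by linarith)] at hCφ
  -- An upper bound of `φ` is a lower bound `-B` of `-2ε log (φ + δ)`. It turns the one-sided bound
  -- `K` on averages into the bound in `L¹` that the local upper bound needs.
  set B := 2 * ε * Real.log (Cφ + 1) with hB
  have hB0 : 0 ≤ B := mul_nonneg (by positivity) (Real.log_nonneg (by linarith))
  set K := 2 * L * |2 * ε * Real.log m| + (64 * ε ^ 2 / L + 1) +
    4 * L * (x₀ - x₁) ^ 2 / (a₁ - s₁) with hK
  have ha₁s : 0 < a₁ - s₁ := sub_pos.2 ha₁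
  have hK0 : 0 ≤ K := by positivity
  obtain ⟨C, hC0, hC⟩ := local_upper_bound_of_integral hε (half_pos hL) ha₁0 ha₁'
  have hLL : -L ≤ L := by linarith
  -- The left side does not depend on `δ`, so the lower bound survives the limit `δ → 0`.
  have hmain : ∀ δ, 0 < δ → δ ≤ 1 →
      Real.exp (-(C * (1 + 16 / 9 * (K + 4 * L * B))) / (2 * ε)) ≤ φ x₀ t₀ + δ := by
    intro δ hδ hδ1
    have hpos : ∀ x, ∀ t ∈ Ioo (0 : ℝ) 1, 0 < φ x t + δ := fun x t ht =>
      add_pos_of_nonneg_of_pos (hφ0 x t ht) hδ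
    obtain ⟨gt, gx, gxx, -, -, hsub⟩ := h.exists_hjSub hδ.le hpos
    set F : ℝ → ℝ → ℝ := fun x t => -2 * ε * Real.log (φ x (1 - t) + δ) with hF
    have hav : ∀ s ∈ Icc a₁ s₀, ∫ z in (-L)..L, F (z + x₀) s * bump L z ≤ K := by
      intro s hs
      have hmv := hsub.average_le hL x₁ x₀ hs₁0.1 (ha₁.trans_le hs.1) (hs.2.trans_lt hs₀0.2)
      have hstart : ∫ z in (-L)..L, F (z + x₁) s₁ * bump L z ≤ 2 * L * |2 * ε * Real.log m| := by
        have cF : Continuous fun z => F z s₁ := hsub.reg.c.continuous_slice hs₁0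
        have cb := continuous_bump L
        have hle := integral_mono_of_continuous (f := fun z => F (z + x₁) s₁ * bump L z)
          (g := fun _ => |2 * ε * Real.log m|)
          ((cF.comp (continuous_add_const x₁)).fun_mul cb) continuous_const hLL fun z hz => ?_
        · rw [intervalIntegral.integral_const, smul_eq_mul] at hle
          linarith
        · have e1 : F (z + x₁) s₁ ≤ |2 * ε * Real.log m| := by
            have e2 : m ≤ φ (z + x₁) (1 - s₁) + δ := by
              rw [hs₁, sub_sub_cancel]; linarith [hLm z hz]
            have e3 := Real.log_le_log hm0 e2
            have e4 := neg_abs_le (2 * ε * Real.log m)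
            simp only [hF]
            nlinarith
          calc F (z + x₁) s₁ * bump L z ≤ |2 * ε * Real.log m| * bump L z :=
                mul_le_mul_of_nonneg_right e1 (bump_nonneg _ _)
            _ ≤ _ := mul_le_of_le_one_right (abs_nonneg _) (bump_le_one hL hz)
      have e5 : (64 * ε ^ 2 / L + 1) * (s - s₁) ≤ 64 * ε ^ 2 / L + 1 :=
        mul_le_of_le_one_right (by positivity) (by linarith [hs.2, hs₀0.2, hs₁0.1])
      have e6 : 4 * L * (x₀ - x₁) ^ 2 / (s - s₁) ≤ 4 * L * (x₀ - x₁) ^ 2 / (a₁ - s₁) := by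
        gcongr
        exact hs.1
      change ∫ z in (-L)..L, F (z + x₀) s * bump L z ≤ _ at hmv
      linarith
    have hr := hsub.reg.shift x₀ 0
    have hS := hsub.source_cont.shift x₀ 0
    have hS1 := integral_shift_mass hsub.source_mass x₀ 0
    simp only [zero_mul, add_zero] at hr hS hS1
    have key := hC hr hS (fun x s hs => hsub.source_nonneg _ s hs) hS1 (fun x s hs => by
      have := hsub.le_source (x + x₀) s hs
      have := sq_nonneg (gx (x + x₀) (1 - s))
      linarith) le_rfl le_rfl hs₀0.2
    change F (0 + x₀) s₀ ≤ C * (1 + ∫ t in a₁..s₀, ∫ z in (-(L / 2))..(L / 2), |F (z + x₀) t|)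
      at key
    have habs : ContStrip 0 1 fun z t => |F (z + x₀) t| := ContinuousOn.abs hr.c
    have hslice : ∀ s ∈ Icc a₁ s₀, ∫ z in (-(L / 2))..(L / 2), |F (z + x₀) s| ≤
        16 / 9 * (K + 4 * L * B) := by
      intro s hs
      have hs' : s ∈ Ioo (0 : ℝ) 1 := ⟨ha₁0.trans_le hs.1, hs.2.trans_lt hs₀0.2⟩
      have cF : Continuous fun z => F (z + x₀) s := hr.c.continuous_slice hs'
      have cA : Continuous fun z => |F (z + x₀) s| := cF.abs
      have cb := continuous_bump L
      have hlow : ∀ z ∈ Icc (-L) L, -B ≤ F (z + x₀) s := by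
        intro z hz
        have e1 := hCφ (z + x₀) ⟨by linarith [hz.1], by linarith [hz.2]⟩ (1 - s)
          ⟨by linarith [hs.2], by linarith [hs.1]⟩
        have e2 : φ (z + x₀) (1 - s) + δ ≤ Cφ + 1 :=
          add_le_add ((le_abs_self _).trans e1) hδ1
        have e3 := Real.log_le_log (hpos _ _ (hm hs')) e2
        simp only [hF, hB]
        nlinarith
      have i1 : ∫ z in (-(L / 2))..(L / 2), |F (z + x₀) s| ≤
          ∫ z in (-(L / 2))..(L / 2), 16 / 9 * (|F (z + x₀) s| * bump L z) := by
        refine integral_mono_of_continuous cA (continuous_const.fun_mul (cA.fun_mul cb))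
          (by linarith) fun z hz => ?_
        have := mul_le_mul_of_nonneg_left (bump_lower hL hz) (abs_nonneg (F (z + x₀) s))
        linarith
      have i2 : ∫ z in (-(L / 2))..(L / 2), |F (z + x₀) s| * bump L z ≤
          ∫ z in (-L)..L, |F (z + x₀) s| * bump L z :=
        intervalIntegral.integral_mono_interval (by linarith) (by linarith) (by linarith)
          (Eventually.of_forall fun z => mul_nonneg (abs_nonneg _) (bump_nonneg _ _))
          ((cA.fun_mul cb).intervalIntegrable _ _)
      have i3 : ∫ z in (-L)..L, |F (z + x₀) s| * bump L z ≤
          ∫ z in (-L)..L, (F (z + x₀) s * bump L z + 2 * B) := by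
        refine integral_mono_of_continuous (cA.fun_mul cb)
          ((cF.fun_mul cb).fun_add continuous_const) hLL fun z hz => ?_
        have e1 := hlow z hz
        have e2 := bump_le_one hL hz
        have e3 := bump_nonneg L z
        have e4 : |F (z + x₀) s| ≤ F (z + x₀) s + 2 * B := by
          rw [abs_le]; constructor <;> linarith
        nlinarith
      rw [integral_add_of_continuous (cF.fun_mul cb) continuous_const,
        intervalIntegral.integral_const, smul_eq_mul] at i3
      rw [intervalIntegral.integral_const_mul] at i1
      linarith [hav s hs]
    have hint : ∫ t in a₁..s₀, ∫ z in (-(L / 2))..(L / 2), |F (z + x₀) t| ≤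
        16 / 9 * (K + 4 * L * B) := by
      have := intervalIntegral.integral_mono_on ha₁'.le
        (intervalIntegrable_integral_strip habs _ _ ha₁0 ha₁'.le hs₀0.2)
        intervalIntegrable_const hslice
      rw [intervalIntegral.integral_const, smul_eq_mul] at this
      refine this.trans (mul_le_of_le_one_left (by positivity) (by linarith [hs₀0.2]))
    have hfin : F x₀ s₀ ≤ C * (1 + 16 / 9 * (K + 4 * L * B)) := by
      rw [zero_add] at key
      exact key.trans (mul_le_mul_of_nonneg_left (by linarith) hC0)
    have e7 : 1 - s₀ = t₀ := by rw [hs₀, sub_sub_cancel]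
    simp only [hF, e7] at hfin
    rw [← Real.le_log_iff_exp_le (hpos x₀ t₀ ht₀), div_le_iff₀ (by positivity)]
    linarith
  have hge : Real.exp (-(C * (1 + 16 / 9 * (K + 4 * L * B))) / (2 * ε)) ≤ φ x₀ t₀ := by
    refine le_of_forall_pos_le_add fun δ hδ => ?_
    refine (hmain (min δ 1) (lt_min hδ one_pos) (min_le_right _ _)).trans ?_
    gcongr
    exact min_le_left _ _
  exact pos_of_mul_pos_left ((Real.exp_pos _).trans_le hge) (Real.exp_pos _).le

end Classical

/-! ### The symmetric pair of potentials and its growth. -/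

/-- The system in the symmetric variables `f = u` and `g = -2ε log ρ - u`: two Hamilton–Jacobi
equations, forward and backward in time, with the common source `exp (-(f + g) / (2ε))`. -/
structure MFGPair (ε : ℝ) where
  (f ft fx fxx g gt gx gxx : ℝ → ℝ → ℝ)
  pos : 0 < ε
  f_reg : C21 f ft fx fxx
  g_reg : C21 g gt gx gxx
  hj_f : ∀ x, ∀ t ∈ Ioo (0 : ℝ) 1,
    ft x t - ε * fxx x t + 1 / 2 * fx x t ^ 2 = Real.exp (-(f x t + g x t) / (2 * ε))
  hj_g : ∀ x, ∀ t ∈ Ioo (0 : ℝ) 1,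
    -gt x t - ε * gxx x t + 1 / 2 * gx x t ^ 2 = Real.exp (-(f x t + g x t) / (2 * ε))
  mass_le : ∀ t ∈ Ioo (0 : ℝ) 1, ∀ l r, l ≤ r →
    ∫ x in l..r, Real.exp (-(f x t + g x t) / (2 * ε)) ≤ 1

theorem one_sub_mem_Ioo {t : ℝ} (h : t ∈ Ioo (0 : ℝ) 1) : 1 - t ∈ Ioo (0 : ℝ) 1 :=
  ⟨by linarith [h.2], by linarith [h.1]⟩

namespace MFGPair

variable {ε : ℝ} (P : MFGPair ε)

/-- Time reversal exchanges the two potentials. -/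
def reverse : MFGPair ε where
  f x t := P.g x (1 - t)
  ft x t := -P.gt x (1 - t)
  fx x t := P.gx x (1 - t)
  fxx x t := P.gxx x (1 - t)
  g x t := P.f x (1 - t)
  gt x t := -P.ft x (1 - t)
  gx x t := P.fx x (1 - t)
  gxx x t := P.fxx x (1 - t)
  pos := P.pos
  f_reg := P.g_reg.reverse
  g_reg := P.f_reg.reverse
  hj_f x t ht := by
    have := P.hj_g x _ (one_sub_mem_Ioo ht)
    rw [add_comm (P.g _ _)]
    exact this
  hj_g x t ht := by
    have := P.hj_f x _ (one_sub_mem_Ioo ht)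
    rw [add_comm (P.g _ _), neg_neg]
    exact this
  mass_le t ht l r hlr := by
    simp only [add_comm (P.g _ _)]
    exact P.mass_le _ (one_sub_mem_Ioo ht) l r hlr

/-- The density. -/
noncomputable def ρ (x t : ℝ) : ℝ := Real.exp (-(P.f x t + P.g x t) / (2 * ε))

theorem ρ_pos (x t : ℝ) : 0 < P.ρ x t := Real.exp_pos _

theorem ρ_reg : C21 P.ρ (fun x t => -(P.ft x t + P.gt x t) / (2 * ε) * P.ρ x t)
    (fun x t => -(P.fx x t + P.gx x t) / (2 * ε) * P.ρ x t)
    (fun x t => (((P.fx x t + P.gx x t) / (2 * ε)) ^ 2 -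
      (P.fxx x t + P.gxx x t) / (2 * ε)) * P.ρ x t) := by
  have h := (P.f_reg.add P.g_reg).comp (Φ := fun y => Real.exp (-y / (2 * ε)))
    (Φ' := fun y => Real.exp (-y / (2 * ε)) * (-1 / (2 * ε)))
    (Φ'' := fun y => Real.exp (-y / (2 * ε)) * (-1 / (2 * ε)) * (-1 / (2 * ε))) (s := univ)
    (fun _ _ _ => mem_univ _)
    (fun y _ => ((hasDerivAt_id y).neg.div_const (2 * ε)).exp.congr_deriv (by simp))
    (fun y _ => (((hasDerivAt_id y).neg.div_const (2 * ε)).exp.mul_const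
      (-1 / (2 * ε))).congr_deriv (by simp)) (by fun_prop)
  convert h using 1 <;> (ext x t; simp only [ρ]; try ring)

theorem hjSub : HJSub ε P.f P.ft P.fx P.fxx P.ρ where
  reg := P.f_reg
  source_cont := P.ρ_reg.c
  source_nonneg x t _ := (P.ρ_pos x t).le
  source_mass := P.mass_le
  le_source x t ht := (P.hj_f x t ht).le

theorem exists_upper_bound {a b : ℝ} (ha : 0 < a) (hb : b < 1) :
    ∃ N, 0 ≤ N ∧ (∀ y, ∀ t ∈ Icc a b, P.f y t ≤ N * (1 + y ^ 2)) ∧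
      ∀ y, ∀ t ∈ Icc a b, P.g y t ≤ N * (1 + y ^ 2) := by
  obtain ⟨N₁, hN₁0, hN₁⟩ := P.hjSub.exists_upper_bound P.pos ha hb
  obtain ⟨N₂, hN₂0, hN₂⟩ := P.reverse.hjSub.exists_upper_bound (a := 1 - b) (b := 1 - a) P.pos
    (by linarith) (by linarith)
  refine ⟨max N₁ N₂, hN₁0.trans (le_max_left _ _), fun y t ht => ?_, fun y t ht => ?_⟩
  · exact (hN₁ y t ht).trans (mul_le_mul_of_nonneg_right (le_max_left _ _) (by positivity))
  · have := hN₂ y (1 - t) ⟨by linarith [ht.2], by linarith [ht.1]⟩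
    simp only [reverse, sub_sub_cancel] at this
    exact this.trans (mul_le_mul_of_nonneg_right (le_max_right _ _) (by positivity))

/-- The exponential `e^{-f / (2ε)}` is a subsolution of the heat equation, as the source of the
Hamilton–Jacobi equation enters with a negative sign. It also equals `ρ e^{g / (2ε)}`, so the mass
bound and the quadratic upper bound of `g` control it in `L¹` on unit-scale intervals. The local
upper bound for the exponential is a lower bound for `f`. -/
theorem exists_lower_bound {a b : ℝ} (ha : 0 < a) (hab : a ≤ b) (hb : b < 1) :
    ∃ N, 0 ≤ N ∧ ∀ y, ∀ t ∈ Icc a b, -(N * (1 + y ^ 2)) ≤ P.f y t := by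
  have hε := P.pos
  obtain ⟨N, hN0, -, hN⟩ := P.exists_upper_bound (half_pos ha) hb
  obtain ⟨C, hC0, hC⟩ := local_upper_bound_of_integral hε one_pos (half_pos ha) (half_lt_self ha)
  have hw := P.f_reg.comp (Φ := fun y => Real.exp (-y / (2 * ε)))
    (Φ' := fun y => Real.exp (-y / (2 * ε)) * (-1 / (2 * ε)))
    (Φ'' := fun y => Real.exp (-y / (2 * ε)) * (-1 / (2 * ε)) * (-1 / (2 * ε))) (s := univ)
    (fun _ _ _ => mem_univ _)
    (fun y _ => ((hasDerivAt_id y).neg.div_const (2 * ε)).exp.congr_deriv (by simp))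
    (fun y _ => (((hasDerivAt_id y).neg.div_const (2 * ε)).exp.mul_const
      (-1 / (2 * ε))).congr_deriv (by simp)) (by fun_prop)
  refine ⟨2 * ε * (Real.log (2 * C + 1) + 3 * N / (2 * ε)), ?_, fun y t ht => ?_⟩
  · have := Real.log_nonneg (show (1 : ℝ) ≤ 2 * C + 1 by linarith)
    positivity
  have hr := hw.shift y 0
  simp only [zero_mul, add_zero] at hr
  have key := hC (S := fun _ _ => 0) hr (contStrip_of_continuous continuous_const)
    (fun _ _ _ => le_rfl) (fun _ _ _ _ _ => by simp) (fun x s hs => by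
      have h1 := P.hj_f (x + y) s hs
      have h2 : Real.exp (-P.f (x + y) s / (2 * ε)) * (-1 / (2 * ε)) * P.ft (x + y) s -
          ε * (Real.exp (-P.f (x + y) s / (2 * ε)) * (-1 / (2 * ε)) * (-1 / (2 * ε)) *
            P.fx (x + y) s ^ 2 + Real.exp (-P.f (x + y) s / (2 * ε)) * (-1 / (2 * ε)) *
            P.fxx (x + y) s) = -(Real.exp (-P.f (x + y) s / (2 * ε)) / (2 * ε) *
            (P.ft (x + y) s - ε * P.fxx (x + y) s + 1 / 2 * P.fx (x + y) s ^ 2)) := by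
        field_simp; ring
      rw [h2, h1, neg_nonpos]
      positivity) ht.1 ht.2 hb
  -- The factor `3` comes from `1 + (z + y)² ≤ 3 (1 + y²)` for `|z| ≤ 1`.
  set X := 3 * N / (2 * ε) * (1 + y ^ 2) with hX
  have hX0 : 0 ≤ X := by positivity
  have hslice : ∀ s ∈ Icc (a / 2) b,
      ∫ z in (-1 : ℝ)..1, |Real.exp (-P.f (z + y) s / (2 * ε))| ≤ Real.exp X := by
    intro s hs
    have hs' : s ∈ Ioo (0 : ℝ) 1 := ⟨by linarith [hs.1], hs.2.trans_lt hb⟩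
    have cf : Continuous fun z => P.f z s := P.f_reg.c.continuous_slice hs'
    have cf' : Continuous fun z => P.f (z + y) s := cf.comp (continuous_add_const y)
    have cρ : Continuous fun z => P.ρ z s := P.ρ_reg.c.continuous_slice hs'
    have cρ' : Continuous fun z => P.ρ (z + y) s := cρ.comp (continuous_add_const y)
    have h1 : ∫ z in (-1 : ℝ)..1, |Real.exp (-P.f (z + y) s / (2 * ε))| ≤
        ∫ z in (-1 : ℝ)..1, Real.exp X * P.ρ (z + y) s := by
      refine integral_mono_of_continuous (by fun_prop) (by fun_prop) (by norm_num) fun z hz => ?_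
      rw [abs_of_pos (Real.exp_pos _), ρ, ← Real.exp_add]
      refine Real.exp_le_exp.2 ?_
      have h2 := hN (z + y) s hs
      have h3 : 1 + (z + y) ^ 2 ≤ 3 * (1 + y ^ 2) := by nlinarith [hz.1, hz.2, sq_nonneg (z - y)]
      have h4 : P.g (z + y) s ≤ N * (3 * (1 + y ^ 2)) :=
        h2.trans (mul_le_mul_of_nonneg_left h3 hN0)
      have h5 : X = N * (3 * (1 + y ^ 2)) / (2 * ε) := by rw [hX]; ring
      rw [h5, ← add_div]
      gcongr
      linarith
    have h6 : ∫ z in (-1 : ℝ)..1, P.ρ (z + y) s ≤ 1 := by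
      rw [intervalIntegral.integral_comp_add_right (fun z => P.ρ z s)]
      exact P.mass_le s hs' _ _ (by linarith)
    rw [intervalIntegral.integral_const_mul] at h1
    exact h1.trans (mul_le_of_le_one_right (Real.exp_pos _).le h6)
  have hwc : ContStrip 0 1 fun z s => |Real.exp (-P.f (z + y) s / (2 * ε))| :=
    ContinuousOn.abs hr.c
  have hint := intervalIntegral.integral_mono_on (by linarith)
    (intervalIntegrable_integral_strip hwc (-1) 1 (half_pos ha) (by linarith) hb)
    intervalIntegrable_const hslice
  rw [intervalIntegral.integral_const, smul_eq_mul] at hint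
  have hint' := hint.trans (mul_le_of_le_one_left (Real.exp_pos X).le (by linarith))
  rw [zero_add] at key
  have h7 : Real.exp (-P.f y t / (2 * ε)) ≤ (2 * C + 1) * Real.exp X := by
    have h8 := Real.one_le_exp hX0
    nlinarith [mul_le_mul_of_nonneg_left hint' hC0]
  have h9 := Real.log_le_log (Real.exp_pos _) h7
  rw [Real.log_exp, Real.log_mul (by positivity) (Real.exp_pos _).ne', Real.log_exp,
    div_le_iff₀ (by positivity)] at h9
  have h10 := Real.log_nonneg (show (1 : ℝ) ≤ 2 * C + 1 by linarith)
  have h11 : Real.log (2 * C + 1) ≤ Real.log (2 * C + 1) * (1 + y ^ 2) :=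
    le_mul_of_one_le_right h10 (by nlinarith [sq_nonneg y])
  have h12 : 2 * ε * (Real.log (2 * C + 1) + 3 * N / (2 * ε)) * (1 + y ^ 2) =
      (Real.log (2 * C + 1) * (1 + y ^ 2) + X) * (2 * ε) := by rw [hX]; ring
  nlinarith

theorem exists_abs_bound {a b : ℝ} (ha : 0 < a) (hab : a ≤ b) (hb : b < 1) :
    ∃ N, 0 ≤ N ∧ ∀ y, ∀ t ∈ Icc a b, |P.f y t| ≤ N * (1 + y ^ 2) := by
  obtain ⟨N₁, hN₁0, hN₁, -⟩ := P.exists_upper_bound ha hb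
  obtain ⟨N₂, hN₂0, hN₂⟩ := P.exists_lower_bound ha hab hb
  refine ⟨N₁ + N₂, by positivity, fun y t ht => abs_le.2 ⟨?_, ?_⟩⟩
  · nlinarith [hN₂ y t ht, sq_nonneg y]
  · nlinarith [hN₁ y t ht, sq_nonneg y]

end MFGPair

/-! ### Weighted energy estimate. -/

/-- The weight `(1 - c (1 + x²))² / (1 + x²)`. -/
noncomputable def wt (c x : ℝ) : ℝ := (1 - c * (1 + x ^ 2)) ^ 2 / (1 + x ^ 2)

/-- The derivative of `wt`. -/
noncomputable def wt' (c x : ℝ) : ℝ :=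
  (1 - c * (1 + x ^ 2)) * (-(2 * x) * (1 + c * (1 + x ^ 2)) / (1 + x ^ 2) ^ 2)

/-- The second derivative of `wt`. -/
noncomputable def wt'' (c x : ℝ) : ℝ :=
  2 * (c ^ 2 - 1 / (1 + x ^ 2) ^ 2) + 8 * x ^ 2 / (1 + x ^ 2) ^ 3

theorem one_add_sq_pos (x : ℝ) : 0 < 1 + x ^ 2 := by positivity

theorem hasDerivAt_wt (c x : ℝ) : HasDerivAt (wt c) (wt' c x) x := by
  have h0 : HasDerivAt (fun x : ℝ => 1 + x ^ 2) (2 * x) x :=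
    ((hasDerivAt_pow 2 x).const_add 1).congr_deriv (by simp)
  have hs := (one_add_sq_pos x).ne'
  refine ((((h0.const_mul c).const_sub 1).fun_pow 2).fun_div h0 hs).congr_deriv ?_
  unfold wt'
  field_simp
  simp only [Nat.add_one_sub_one, pow_one, Nat.cast_ofNat]
  ring

theorem hasDerivAt_wt' (c x : ℝ) : HasDerivAt (wt' c) (wt'' c x) x := by
  have h0 : HasDerivAt (fun x : ℝ => 1 + x ^ 2) (2 * x) x :=
    ((hasDerivAt_pow 2 x).const_add 1).congr_deriv (by simp)
  have hs := (one_add_sq_pos x).ne'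
  refine (((h0.const_mul c).const_sub 1).mul (((((hasDerivAt_id x).const_mul 2).fun_neg).mul
    ((h0.const_mul c).const_add 1)).fun_div (h0.fun_pow 2) (pow_ne_zero 2 hs))).congr_deriv ?_
  simp only [wt'', Pi.mul_apply, id, Nat.add_one_sub_one, pow_one, Nat.cast_ofNat]
  field_simp
  ring

theorem continuous_wt (c : ℝ) : Continuous (wt c) :=
  continuous_iff_continuousAt.2 fun x => (hasDerivAt_wt c x).continuousAt

theorem continuous_wt' (c : ℝ) : Continuous (wt' c) :=
  continuous_iff_continuousAt.2 fun x => (hasDerivAt_wt' c x).continuousAt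

theorem continuous_wt'' (c : ℝ) : Continuous (wt'' c) := by
  unfold wt''
  have h : ∀ x : ℝ, 1 + x ^ 2 ≠ 0 := fun x => (one_add_sq_pos x).ne'
  exact (continuous_const.mul (continuous_const.sub (continuous_const.div (by fun_prop)
    fun x => pow_ne_zero 2 (h x)))).add ((by fun_prop : Continuous fun x : ℝ => 8 * x ^ 2).div
    (by fun_prop) fun x => pow_ne_zero 3 (h x))

theorem wt_nonneg (c x : ℝ) : 0 ≤ wt c x := by unfold wt; positivity

/-- Pointwise estimate of the cross terms in the weighted energy identity. -/
theorem weighted_cross_le {c x y p ε N : ℝ} (hε : 0 < ε) (hN : 0 ≤ N) (hc : 0 ≤ c)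
    (hcx : c * (1 + x ^ 2) ≤ 1) (hy : |y| ≤ N * (1 + x ^ 2)) :
    -(p * (y - 2 * ε) * wt' c x) + ε * y * wt'' c x ≤
      1 / 4 * (wt c x * p ^ 2) + (16 * (N + 2 * ε) ^ 2 + 12 * ε * N) := by
  set s := 1 + x ^ 2 with hs
  have hs1 : 1 ≤ s := by nlinarith [sq_nonneg x]
  have hs0 : 0 < s := by linarith
  have hx2 : x ^ 2 ≤ s := by linarith
  have hcs0 : 0 ≤ c * s := by positivity
  set q := (y - 2 * ε) * (-(2 * x) * (1 + c * s) / s ^ 2) with hq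
  have h1 : |y - 2 * ε| ≤ (N + 2 * ε) * s := by
    refine (abs_sub _ _).trans ?_
    rw [abs_of_pos (show 0 < 2 * ε by positivity)]
    nlinarith
  have h2 : s * q ^ 2 ≤ 16 * (N + 2 * ε) ^ 2 := by
    have e1 : (y - 2 * ε) ^ 2 ≤ ((N + 2 * ε) * s) ^ 2 := by
      rw [← sq_abs]; exact pow_le_pow_left₀ (abs_nonneg _) h1 2
    have e2 : (1 + c * s) ^ 2 ≤ 4 := by nlinarith
    have e3 : s * q ^ 2 = (y - 2 * ε) ^ 2 * (4 * x ^ 2 * (1 + c * s) ^ 2) / s ^ 3 := by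
      rw [hq]; field_simp; ring
    rw [e3, div_le_iff₀ (by positivity)]
    calc (y - 2 * ε) ^ 2 * (4 * x ^ 2 * (1 + c * s) ^ 2)
        ≤ ((N + 2 * ε) * s) ^ 2 * (4 * s * 4) := by gcongr
      _ = _ := by ring
  -- The first derivative of the weight keeps one factor `1 - c s`, which Young's inequality pairs
  -- with the square in `wt`. What remains, `s q²`, is bounded because `|y| ≤ N s`.
  have h3 : -(p * (y - 2 * ε) * wt' c x) ≤
      1 / 4 * (wt c x * p ^ 2) + 16 * (N + 2 * ε) ^ 2 := by
    have e1 : p * (y - 2 * ε) * wt' c x = (p * (1 - c * s)) * q := by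
      rw [hq, wt', ← hs]; ring
    have e2 : wt c x * p ^ 2 = (p * (1 - c * s)) ^ 2 / s := by
      rw [wt, ← hs]; ring
    rw [e1, e2]
    have e3 : -((p * (1 - c * s)) * q) ≤ 1 / 4 * ((p * (1 - c * s)) ^ 2 / s) + s * q ^ 2 := by
      have e4 : 1 / 4 * ((p * (1 - c * s)) ^ 2 / s) + s * q ^ 2 + (p * (1 - c * s)) * q =
          (p * (1 - c * s) / 2 + s * q) ^ 2 / s := by field_simp; ring
      have : 0 ≤ (p * (1 - c * s) / 2 + s * q) ^ 2 / s := by positivity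
      linarith
    linarith
  have h4 : ε * y * wt'' c x ≤ 12 * ε * N := by
    have e1 : |wt'' c x| ≤ 12 / s := by
      have e2 : wt'' c x = (2 * ((c * s) ^ 2 - 1) + 8 * (x ^ 2 / s)) / s ^ 2 := by
        rw [wt'', ← hs]; field_simp
      have e3 : x ^ 2 / s ≤ 1 := (div_le_one hs0).2 hx2
      have e4 : 0 ≤ x ^ 2 / s := by positivity
      have e5 : |2 * ((c * s) ^ 2 - 1) + 8 * (x ^ 2 / s)| ≤ 12 := by
        rw [abs_le]; constructor <;> nlinarith
      rw [e2, abs_div, abs_of_pos (show 0 < s ^ 2 by positivity)]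
      calc |2 * ((c * s) ^ 2 - 1) + 8 * (x ^ 2 / s)| / s ^ 2 ≤ 12 / s ^ 2 := by gcongr
        _ ≤ 12 / s := by
          gcongr
          nlinarith
    calc ε * y * wt'' c x ≤ |ε * y * wt'' c x| := le_abs_self _
      _ = ε * (|y| * |wt'' c x|) := by rw [mul_assoc, abs_mul, abs_mul, abs_of_pos hε]
      _ ≤ ε * (N * s * (12 / s)) := by gcongr
      _ = _ := by field_simp
  linarith

namespace MFGPair

variable {ε : ℝ} (P : MFGPair ε)

theorem fokker_planck (x : ℝ) {t : ℝ} (ht : t ∈ Ioo (0 : ℝ) 1) :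
    -(P.ft x t + P.gt x t) / (2 * ε) * P.ρ x t =
      -(ε * ((((P.fx x t + P.gx x t) / (2 * ε)) ^ 2 -
        (P.fxx x t + P.gxx x t) / (2 * ε)) * P.ρ x t)) -
      (P.fxx x t * P.ρ x t + P.fx x t * (-(P.fx x t + P.gx x t) / (2 * ε) * P.ρ x t)) := by
  have hε := P.pos
  have h1 := P.hj_f x t ht
  have h2 := P.hj_g x t ht
  have e : P.ft x t + P.gt x t = ε * (P.fxx x t - P.gxx x t) -
      1 / 2 * (P.fx x t ^ 2 - P.gx x t ^ 2) := by linarith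
  rw [e]
  field_simp
  ring

/-- Weighted energy estimate. -/
theorem weighted_energy_le {a b N : ℝ} (ha : 0 < a) (hab : a ≤ b) (hb : b < 1) (hN : 0 ≤ N)
    (hbd : ∀ y, ∀ t ∈ Icc a b, |P.f y t| ≤ N * (1 + y ^ 2)) {c R : ℝ} (hc : 0 ≤ c) (hR : 0 ≤ R)
    (hcR : c * (1 + R ^ 2) = 1) :
    ∫ t in a..b, ∫ x in (-R)..R,
        P.ρ x t * (wt c x * (P.ρ x t + 1 / 4 * P.fx x t ^ 2)) ≤
      2 * N + (16 * (N + 2 * ε) ^ 2 + 12 * ε * N) := by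
  have hε := P.pos
  set C := 16 * (N + 2 * ε) ^ 2 + 12 * ε * N with hC
  have hC0 : 0 ≤ C := by positivity
  have hRR : -R ≤ R := by linarith
  have hcx : ∀ x ∈ Icc (-R) R, c * (1 + x ^ 2) ≤ 1 := by
    intro x hx
    have : x ^ 2 ≤ R ^ 2 := sq_le_sq' hx.1 hx.2
    calc c * (1 + x ^ 2) ≤ c * (1 + R ^ 2) := by gcongr
      _ = 1 := hcR
  have hw : ContStrip 0 1 fun x _ => wt c x := contStrip_of_continuous (continuous_wt c)
  have hρ := P.ρ_reg
  have hf := P.f_reg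
  have hmem : ∀ t ∈ Icc a b, t ∈ Ioo (0 : ℝ) 1 := fun t ht =>
    ⟨ha.trans_le ht.1, ht.2.trans_lt hb⟩
  have hEc : ContStrip 0 1 fun x t => P.ρ x t * (wt c x * (P.ρ x t + 1 / 4 * P.fx x t ^ 2)) :=
    hρ.c.mul (hw.mul (hρ.c.add (continuousOn_const.mul (hf.cx.pow 2))))
  have hEi := intervalIntegrable_integral_strip hEc (-R) R ha hab hb
  set ρt : ℝ → ℝ → ℝ := fun x t => -(P.ft x t + P.gt x t) / (2 * ε) * P.ρ x t with hρt
  set ρx : ℝ → ℝ → ℝ := fun x t => -(P.fx x t + P.gx x t) / (2 * ε) * P.ρ x t with hρx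
  set ρxx : ℝ → ℝ → ℝ := fun x t => (((P.fx x t + P.gx x t) / (2 * ε)) ^ 2 -
      (P.fxx x t + P.gxx x t) / (2 * ε)) * P.ρ x t with hρxx
  -- Without the weight, the derivative of `∫ ρ f` is formally `∫ ρ (ρ + f_x² / 2)`. The weight
  -- decays like `1 / (1 + x²)`, so it offsets the quadratic growth of `f` and `|A|` is bounded by
  -- `N` times the mass. The cross terms it creates use up half of the kinetic part.
  set A : ℝ → ℝ := fun t => ∫ x in (-R)..R, P.ρ x t * P.f x t * wt c x with hA
  have hAb : ∀ t ∈ Icc a b, |A t| ≤ N := by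
    intro t ht
    have cρ := hρ.c.continuous_slice (hmem t ht)
    have cf := hf.c.continuous_slice (hmem t ht)
    have cw := continuous_wt c
    have h1 : |A t| ≤ ∫ x in (-R)..R, N * P.ρ x t := by
      refine (intervalIntegral.abs_integral_le_integral_abs hRR).trans ?_
      refine integral_mono_of_continuous ((cρ.fun_mul cf).fun_mul cw).abs
        (continuous_const.fun_mul cρ) hRR fun x hx => ?_
      have hs := one_add_sq_pos x
      have e1 := hcx x hx
      have e2 : 0 ≤ c * (1 + x ^ 2) := by positivity
      have e3 : (1 - c * (1 + x ^ 2)) ^ 2 ≤ 1 := by nlinarith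
      rw [abs_mul, abs_mul, abs_of_pos (P.ρ_pos x t), abs_of_nonneg (wt_nonneg c x), wt]
      calc P.ρ x t * |P.f x t| * ((1 - c * (1 + x ^ 2)) ^ 2 / (1 + x ^ 2))
          ≤ P.ρ x t * (N * (1 + x ^ 2)) * (1 / (1 + x ^ 2)) := by
            have := (P.ρ_pos x t).le
            have := hbd x t ht
            gcongr
        _ = N * P.ρ x t := by field_simp
    rw [intervalIntegral.integral_const_mul] at h1
    exact h1.trans (mul_le_of_le_one_right hN (P.mass_le t (hmem t ht) _ _ hRR))
  have key := sub_le_integral_of_hasDerivAt hab (Y := fun t => -A t)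
    (Y' := fun t => -∫ x in (-R)..R, (ρt x t * P.f x t + P.ρ x t * P.ft x t) * wt c x)
    (e := fun t => C - ∫ x in (-R)..R, P.ρ x t * (wt c x * (P.ρ x t + 1 / 4 * P.fx x t ^ 2)))
    (fun t ht => ?_) (intervalIntegrable_const.sub hEi) ?_
  · rw [intervalIntegral.integral_sub intervalIntegrable_const hEi,
      intervalIntegral.integral_const, smul_eq_mul] at key
    have h1 := (abs_le.1 (hAb a ⟨le_rfl, hab⟩)).1
    have h2 := (abs_le.1 (hAb b ⟨hab, le_rfl⟩)).2
    have h3 : (b - a) * C ≤ C := mul_le_of_le_one_left hC0 (by linarith)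
    linarith
  · have hc1 : ContStrip 0 1 fun x t => P.ρ x t * P.f x t * wt c x := (hρ.c.mul hf.c).mul hw
    have hc2 : ContStrip 0 1 fun x t =>
        (ρt x t * P.f x t + P.ρ x t * P.ft x t) * wt c x :=
      ((hρ.ct.mul hf.c).add (hρ.c.mul hf.ct)).mul hw
    exact (hasDerivAt_integral_strip hc1 hc2 (fun x s hs =>
      ((hρ.t x s hs).mul (hf.t x s hs)).mul_const _) _ _ (hmem t ht)).neg
  · intro t ht
    have ht' := hmem t (Ioo_subset_Icc_self ht)
    have cρ : Continuous fun x => P.ρ x t := hρ.c.continuous_slice ht'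
    have cρt : Continuous fun x => ρt x t := hρ.ct.continuous_slice ht'
    have cρx : Continuous fun x => ρx x t := hρ.cx.continuous_slice ht'
    have cρxx : Continuous fun x => ρxx x t := hρ.cxx.continuous_slice ht'
    have cf : Continuous fun x => P.f x t := hf.c.continuous_slice ht'
    have cft : Continuous fun x => P.ft x t := hf.ct.continuous_slice ht'
    have cfx : Continuous fun x => P.fx x t := hf.cx.continuous_slice ht'
    have cfxx : Continuous fun x => P.fxx x t := hf.cxx.continuous_slice ht'
    have cw := continuous_wt c
    have cw1 := continuous_wt' c
    have cw2 := continuous_wt'' c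
    have hcR' : 1 - c * (1 + (-R) ^ 2) = 0 := by rw [neg_sq]; linarith
    have hcR'' : 1 - c * (1 + R ^ 2) = 0 := by linarith
    -- `Z` is a total derivative that collects all the integrations by parts; its primitive vanishes
    -- at `±R` since the weight and its derivative vanish there.
    set Z : ℝ → ℝ := fun x =>
      -ε * (ρxx x t * P.f x t * wt c x + ρx x t * P.fx x t * wt c x +
          ρx x t * P.f x t * wt' c x) -
        ((P.fxx x t * P.ρ x t + P.fx x t * ρx x t) * P.f x t * wt c x +
          P.fx x t * P.ρ x t * (P.fx x t * wt c x + P.f x t * wt' c x)) +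
        ε * (ρx x t * (P.fx x t * wt c x + P.f x t * wt' c x) +
          P.ρ x t * (P.fxx x t * wt c x + 2 * P.fx x t * wt' c x + P.f x t * wt'' c x)) with hZ
    have cZ : Continuous Z := by fun_prop
    have hparts : ∫ x in (-R)..R, Z x = 0 := by
      refine integral_eq_zero_of_hasDerivAt (Y := fun x =>
        -ε * (ρx x t * P.f x t * wt c x) - P.fx x t * P.ρ x t * (P.f x t * wt c x) +
          ε * (P.ρ x t * (P.fx x t * wt c x + P.f x t * wt' c x))) (fun x => ?_) cZ
        (by simp [wt, wt', hcR'']) (by simp [wt, wt', hcR''])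
      have d0 := hρ.x x t ht'
      have d1 := hρ.xx x t ht'
      have d2 := hf.x x t ht'
      have d3 := hf.xx x t ht'
      have d4 := hasDerivAt_wt c x
      have d5 := hasDerivAt_wt' c x
      refine ((((d1.mul d2).mul d4).const_mul (-ε)).sub ((d3.mul d0).mul (d2.mul d4)) |>.add
        ((d0.mul ((d3.mul d4).add (d2.mul d5))).const_mul ε)).congr_deriv ?_
      simp only [hZ, hρx, hρxx, Pi.mul_apply, Pi.add_apply]
      ring
    calc -∫ x in (-R)..R, (ρt x t * P.f x t + P.ρ x t * P.ft x t) * wt c x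
        = (∫ x in (-R)..R, Z x) -
          ∫ x in (-R)..R, (ρt x t * P.f x t + P.ρ x t * P.ft x t) * wt c x := by
          rw [hparts]; ring
      _ = ∫ x in (-R)..R, (Z x - (ρt x t * P.f x t + P.ρ x t * P.ft x t) * wt c x) := by
          rw [← integral_sub_of_continuous cZ (by fun_prop)]
      _ ≤ ∫ x in (-R)..R, (C * P.ρ x t -
          P.ρ x t * (wt c x * (P.ρ x t + 1 / 4 * P.fx x t ^ 2))) := by
          refine integral_mono_of_continuous (by fun_prop) (by fun_prop) hRR fun x hx => ?_
          have h1 : ρt x t = -(ε * ρxx x t) - (P.fxx x t * P.ρ x t + P.fx x t * ρx x t) :=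
            P.fokker_planck x ht'
          have h2 : P.ft x t = P.ρ x t + ε * P.fxx x t - 1 / 2 * P.fx x t ^ 2 := by
            have := P.hj_f x t ht'
            simp only [ρ]; linarith
          have h3 := mul_le_mul_of_nonneg_left (weighted_cross_le (p := P.fx x t) hε hN hc
            (hcx x hx) (hbd x t (Ioo_subset_Icc_self ht))) (P.ρ_pos x t).le
          rw [h1, h2]
          simp only [hZ]
          linear_combination h3
      _ = C * (∫ x in (-R)..R, P.ρ x t) -
          ∫ x in (-R)..R, P.ρ x t * (wt c x * (P.ρ x t + 1 / 4 * P.fx x t ^ 2)) := by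
          rw [integral_sub_of_continuous (by fun_prop) (by fun_prop),
            intervalIntegral.integral_const_mul]
      _ ≤ _ := by
          have := mul_le_of_le_one_right hC0 (P.mass_le t ht' _ _ hRR)
          change C * (∫ x in (-R)..R, P.ρ x t) ≤ C at this
          linarith

/-- The bound in `weighted_energy_le` does not involve the radius, so it passes to arbitrarily large
intervals. -/
theorem exists_energy_bound_f {a b : ℝ} (ha : 0 < a) (hab : a ≤ b) (hb : b < 1) :
    ∃ K, 0 ≤ K ∧ ∀ R, 0 ≤ R → ∫ t in a..b, ∫ x in (-R)..R,
      P.ρ x t * (P.fx x t ^ 2 + P.ρ x t) / (1 + x ^ 2) ≤ K := by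
  have hε := P.pos
  obtain ⟨N, hN, hbd⟩ := P.exists_abs_bound ha hab hb
  refine ⟨16 * (2 * N + (16 * (N + 2 * ε) ^ 2 + 12 * ε * N)), by positivity, fun R hR => ?_⟩
  -- With this `c` the weight is at least `1 / (4 (1 + x²))` on `[-R, R]`, and it vanishes only at
  -- the larger radius `R'`.
  set c := 1 / (2 * (1 + R ^ 2)) with hc
  set R' := √(1 + 2 * R ^ 2) with hR'
  have hRR' : R ≤ R' := Real.le_sqrt_of_sq_le (by nlinarith [sq_nonneg R])
  have hcR' : c * (1 + R' ^ 2) = 1 := by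
    rw [hc, hR', Real.sq_sqrt (by positivity)]; field_simp; ring
  have key := P.weighted_energy_le ha hab hb hN hbd (c := c) (R := R') (by positivity)
    (Real.sqrt_nonneg _) hcR'
  have hρ := P.ρ_reg
  have hf := P.f_reg
  have hw : ContStrip 0 1 fun x _ => wt c x := contStrip_of_continuous (continuous_wt c)
  have hmem : ∀ t ∈ Icc a b, t ∈ Ioo (0 : ℝ) 1 := fun t ht =>
    ⟨ha.trans_le ht.1, ht.2.trans_lt hb⟩
  have hs : ∀ x : ℝ, 1 + x ^ 2 ≠ 0 := fun x => (one_add_sq_pos x).ne'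
  have hEc : ContStrip 0 1 fun x t => P.ρ x t * (wt c x * (P.ρ x t + 1 / 4 * P.fx x t ^ 2)) :=
    hρ.c.mul (hw.mul (hρ.c.add (continuousOn_const.mul (hf.cx.pow 2))))
  have hGc : ContStrip 0 1 fun x t => P.ρ x t * (P.fx x t ^ 2 + P.ρ x t) / (1 + x ^ 2) :=
    (hρ.c.mul ((hf.cx.pow 2).add hρ.c)).div (by fun_prop) fun p _ => hs p.1
  have hle : ∫ t in a..b, ∫ x in (-R)..R, P.ρ x t * (P.fx x t ^ 2 + P.ρ x t) / (1 + x ^ 2) ≤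
      ∫ t in a..b, 16 * ∫ x in (-R')..R',
        P.ρ x t * (wt c x * (P.ρ x t + 1 / 4 * P.fx x t ^ 2)) := by
    refine intervalIntegral.integral_mono_on hab
      (intervalIntegrable_integral_strip hGc _ _ ha hab hb)
      ((intervalIntegrable_integral_strip hEc _ _ ha hab hb).const_mul 16) fun t ht => ?_
    have ht' := hmem t ht
    have cE := hEc.continuous_slice ht'
    have cG := hGc.continuous_slice ht'
    have h1 : ∫ x in (-R)..R, P.ρ x t * (P.fx x t ^ 2 + P.ρ x t) / (1 + x ^ 2) ≤
        ∫ x in (-R)..R, 16 * (P.ρ x t * (wt c x * (P.ρ x t + 1 / 4 * P.fx x t ^ 2))) := by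
      refine integral_mono_of_continuous cG (continuous_const.fun_mul cE) (by linarith)
        fun x hx => ?_
      have hx2 : x ^ 2 ≤ R ^ 2 := sq_le_sq' hx.1 hx.2
      have e1 : c * (1 + x ^ 2) ≤ 1 / 2 := by
        rw [hc, div_mul_eq_mul_div, div_le_iff₀ (by positivity)]
        linarith
      have e2 : 1 / 4 ≤ (1 - c * (1 + x ^ 2)) ^ 2 := by nlinarith
      have e3 : 1 / 4 / (1 + x ^ 2) ≤ wt c x := by
        unfold wt
        gcongr
      have hp := P.ρ_pos x t
      have e4 : 0 ≤ P.ρ x t * (P.ρ x t + 1 / 4 * P.fx x t ^ 2) := by positivity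
      have e5 := mul_le_mul_of_nonneg_right e3 e4
      have e6 : P.ρ x t * (P.fx x t ^ 2 + P.ρ x t) / (1 + x ^ 2) ≤
          16 * (1 / 4 / (1 + x ^ 2) * (P.ρ x t * (P.ρ x t + 1 / 4 * P.fx x t ^ 2))) := by
        have e7 : 16 * (1 / 4 / (1 + x ^ 2) * (P.ρ x t * (P.ρ x t + 1 / 4 * P.fx x t ^ 2))) =
            P.ρ x t * (P.fx x t ^ 2 + 4 * P.ρ x t) / (1 + x ^ 2) := by
          field_simp; ring
        rw [e7]
        gcongr
        linarith
      linarith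
    rw [intervalIntegral.integral_const_mul] at h1
    refine h1.trans (mul_le_mul_of_nonneg_left ?_ (by norm_num))
    refine intervalIntegral.integral_mono_interval (by linarith) (by linarith) hRR'
      (Eventually.of_forall fun x => ?_) (cE.intervalIntegrable _ _)
    have hp := P.ρ_pos x t
    have := wt_nonneg c x
    change 0 ≤ P.ρ x t * (wt c x * (P.ρ x t + 1 / 4 * P.fx x t ^ 2))
    positivity
  rw [intervalIntegral.integral_const_mul] at hle
  linarith

/-- Local integrability of the kinetic energy and of the square of the density, with quadratic
weight at infinity. -/
theorem exists_energy_bound {a b : ℝ} (ha : 0 < a) (hab : a ≤ b) (hb : b < 1) :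
    ∃ K, 0 ≤ K ∧ ∀ R, 0 ≤ R → ∫ t in a..b, ∫ x in (-R)..R,
      P.ρ x t * ((1 / 2 * (P.fx x t - P.gx x t)) ^ 2 + P.ρ x t) / (1 + x ^ 2) ≤ K := by
  obtain ⟨K₁, hK₁0, hK₁⟩ := P.exists_energy_bound_f ha hab hb
  obtain ⟨K₂, hK₂0, hK₂⟩ := P.reverse.exists_energy_bound_f (a := 1 - b) (b := 1 - a)
    (by linarith) (by linarith) (by linarith)
  refine ⟨K₁ + K₂, by positivity, fun R hR => ?_⟩
  have h1 := hK₁ R hR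
  have h2 := hK₂ R hR
  have hrev : ∀ x t, P.reverse.ρ x t = P.ρ x (1 - t) := fun x t => by
    simp only [ρ, reverse, add_comm]
  simp only [hrev] at h2
  simp only [reverse] at h2
  have h3 := intervalIntegral.integral_comp_sub_left (a := 1 - b) (b := 1 - a) (fun t =>
    ∫ x in (-R)..R, P.ρ x t * (P.gx x t ^ 2 + P.ρ x t) / (1 + x ^ 2)) 1
  rw [h3, sub_sub_cancel, sub_sub_cancel] at h2
  have hρ := P.ρ_reg
  have hf := P.f_reg
  have hg := P.g_reg
  have hs : ∀ x : ℝ, 1 + x ^ 2 ≠ 0 := fun x => (one_add_sq_pos x).ne'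
  have hc1 : ContStrip 0 1 fun x t => P.ρ x t * (P.fx x t ^ 2 + P.ρ x t) / (1 + x ^ 2) :=
    (hρ.c.mul ((hf.cx.pow 2).add hρ.c)).div (by fun_prop) fun p _ => hs p.1
  have hc2 : ContStrip 0 1 fun x t => P.ρ x t * (P.gx x t ^ 2 + P.ρ x t) / (1 + x ^ 2) :=
    (hρ.c.mul ((hg.cx.pow 2).add hρ.c)).div (by fun_prop) fun p _ => hs p.1
  have hc3 : ContStrip 0 1 fun x t =>
      P.ρ x t * ((1 / 2 * (P.fx x t - P.gx x t)) ^ 2 + P.ρ x t) / (1 + x ^ 2) :=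
    (hρ.c.mul (((continuousOn_const.mul (hf.cx.sub hg.cx)).pow 2).add hρ.c)).div (by fun_prop)
      fun p _ => hs p.1
  have hi1 := intervalIntegrable_integral_strip hc1 (-R) R ha hab hb
  have hi2 := intervalIntegrable_integral_strip hc2 (-R) R ha hab hb
  refine le_trans ?_ (add_le_add h1 h2)
  rw [← intervalIntegral.integral_add hi1 hi2]
  refine intervalIntegral.integral_mono_on hab
    (intervalIntegrable_integral_strip hc3 _ _ ha hab hb) (hi1.add hi2) fun t ht => ?_
  have ht' : t ∈ Ioo (0 : ℝ) 1 := ⟨ha.trans_le ht.1, ht.2.trans_lt hb⟩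
  have cc1 := hc1.continuous_slice ht'
  have cc2 := hc2.continuous_slice ht'
  rw [← integral_add_of_continuous cc1 cc2]
  refine integral_mono_of_continuous (hc3.continuous_slice ht') (cc1.fun_add cc2) (by linarith)
    fun x _ => ?_
  rw [← add_div]
  have hp := P.ρ_pos x t
  have hs' := one_add_sq_pos x
  rw [← mul_add]
  refine div_le_div_of_nonneg_right (mul_le_mul_of_nonneg_left ?_ hp.le) hs'.le
  nlinarith [sq_nonneg (P.fx x t + P.gx x t), sq_nonneg (P.fx x t), sq_nonneg (P.gx x t)]

end MFGPair

/-! ### The entropy and its pressure in logarithmic variables. -/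

/-- The logistic function `e^{ky} / (1 + e^{ky})`. -/
noncomputable def lgst (k y : ℝ) : ℝ := Real.exp (k * y) / (1 + Real.exp (k * y))

theorem lgst_pos (k y : ℝ) : 0 < lgst k y := by unfold lgst; positivity

theorem lgst_lt_one (k y : ℝ) : lgst k y < 1 := by
  unfold lgst
  rw [div_lt_one (by positivity)]
  linarith

theorem hasDerivAt_lgst (k y : ℝ) :
    HasDerivAt (lgst k) (k * (lgst k y * (1 - lgst k y))) y := by
  have h : HasDerivAt (fun y => Real.exp (k * y)) (Real.exp (k * y) * k) y :=
    ((hasDerivAt_id y).const_mul k).exp.congr_deriv (by simp)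
  have h0 : 1 + Real.exp (k * y) ≠ 0 := by positivity
  refine (h.fun_div (h.const_add 1) h0).congr_deriv ?_
  unfold lgst
  field_simp

/-- The weight `T (1 - T)`, `T` the logistic function. -/
noncomputable def lgw (k y : ℝ) : ℝ := lgst k y * (1 - lgst k y)

theorem lgw_pos (k y : ℝ) : 0 < lgw k y :=
  mul_pos (lgst_pos k y) (sub_pos.2 (lgst_lt_one k y))

theorem lgw_le (k y : ℝ) : lgw k y ≤ 1 / 4 := by
  unfold lgw; nlinarith [sq_nonneg (lgst k y - 1 / 2)]

/-- The pressure-like function `p = k e^y T (1 - T)`. -/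
noncomputable def pf (k y : ℝ) : ℝ := k * (Real.exp y * lgw k y)

/-- The derivative of `pf`. -/
noncomputable def pf' (k y : ℝ) : ℝ :=
  k * (Real.exp y * lgw k y) * (1 + k * (1 - 2 * lgst k y))

/-- The second derivative of `pf`. -/
noncomputable def pf'' (k y : ℝ) : ℝ :=
  k * (Real.exp y * lgw k y) * ((1 + k * (1 - 2 * lgst k y)) ^ 2 - 2 * k ^ 2 * lgw k y)

/-- `pf'' - pf' / 2`. -/
noncomputable def qf (k y : ℝ) : ℝ :=
  k / 2 * (Real.exp y * lgw k y) * (1 - k ^ 2 + 3 * (k * (1 - 2 * lgst k y)) +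
    3 * (k * (1 - 2 * lgst k y)) ^ 2)

/-- The derivative of `qf`. -/
noncomputable def qf' (k y : ℝ) : ℝ :=
  k / 2 * (Real.exp y * lgw k y) * ((1 + k * (1 - 2 * lgst k y)) *
    (1 - k ^ 2 + 3 * (k * (1 - 2 * lgst k y)) + 3 * (k * (1 - 2 * lgst k y)) ^ 2) -
    6 * k ^ 2 * lgw k y * (1 + 2 * (k * (1 - 2 * lgst k y))))

/-- In the variable `y = log ρ` this is `ρ U' = U + p` for the entropy `U = ρ T`, which identifies
`pf` as its pressure. -/
theorem hasDerivAt_exp_mul_lgst (k y : ℝ) :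
    HasDerivAt (fun y => Real.exp y * lgst k y) (Real.exp y * lgst k y + pf k y) y :=
  ((Real.hasDerivAt_exp y).mul (hasDerivAt_lgst k y)).congr_deriv (by unfold pf lgw; ring)

theorem hasDerivAt_exp_mul_lgw (k y : ℝ) : HasDerivAt (fun y => Real.exp y * lgw k y)
    (Real.exp y * lgw k y * (1 + k * (1 - 2 * lgst k y))) y :=
  ((Real.hasDerivAt_exp y).fun_mul ((hasDerivAt_lgst k y).fun_mul
    ((hasDerivAt_lgst k y).const_sub 1))).congr_deriv (by unfold lgw; ring)

theorem hasDerivAt_pf (k y : ℝ) : HasDerivAt (pf k) (pf' k y) y :=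
  ((hasDerivAt_exp_mul_lgw k y).const_mul k).congr_deriv (by unfold pf'; ring)

theorem hasDerivAt_pf' (k y : ℝ) : HasDerivAt (pf' k) (pf'' k y) y :=
  (((hasDerivAt_exp_mul_lgw k y).const_mul k).fun_mul
    ((((hasDerivAt_lgst k y).const_mul 2).const_sub 1 |>.const_mul k).const_add 1)).congr_deriv
    (by unfold pf'' lgw; ring)

theorem hasDerivAt_qf (k y : ℝ) : HasDerivAt (qf k) (qf' k y) y := by
  have h : HasDerivAt (fun y => k * (1 - 2 * lgst k y)) (-(2 * k ^ 2 * lgw k y)) y :=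
    (((hasDerivAt_lgst k y).const_mul 2).const_sub 1 |>.const_mul k).congr_deriv
      (by unfold lgw; ring)
  refine (((hasDerivAt_exp_mul_lgw k y).const_mul (k / 2)).fun_mul
    (((h.const_mul 3).const_add (1 - k ^ 2)).fun_add ((h.fun_pow 2).const_mul 3))).congr_deriv ?_
  simp only [Nat.add_one_sub_one, pow_one, Nat.cast_ofNat]
  unfold qf'
  ring

/-- This is the coefficient of `ℓ_x²` in `p_xx` once `ℓ_xx` is eliminated in favour of the quantum
potential by `ℓ_xx = 2Q - ℓ_x² / 2`; the factorised form displays its sign. -/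
theorem qf_eq (k y : ℝ) : qf k y = pf'' k y - 1 / 2 * pf' k y := by
  unfold qf pf'' pf' lgw; ring

theorem continuous_lgst (k : ℝ) : Continuous (lgst k) :=
  continuous_iff_continuousAt.2 fun y => (hasDerivAt_lgst k y).continuousAt

theorem continuous_lgw (k : ℝ) : Continuous (lgw k) :=
  (continuous_lgst k).fun_mul (continuous_const.sub (continuous_lgst k))

theorem continuous_pf (k : ℝ) : Continuous (pf k) :=
  continuous_iff_continuousAt.2 fun y => (hasDerivAt_pf k y).continuousAt

theorem continuous_pf' (k : ℝ) : Continuous (pf' k) :=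
  continuous_iff_continuousAt.2 fun y => (hasDerivAt_pf' k y).continuousAt

theorem continuous_pf'' (k : ℝ) : Continuous (pf'' k) := by
  have := continuous_lgst k
  have := continuous_lgw k
  unfold pf''; fun_prop

theorem continuous_qf (k : ℝ) : Continuous (qf k) :=
  continuous_iff_continuousAt.2 fun y => (hasDerivAt_qf k y).continuousAt

theorem continuous_qf' (k : ℝ) : Continuous (qf' k) := by
  have := continuous_lgst k
  have := continuous_lgw k
  unfold qf'; fun_prop

/-! ### Pointwise inequalities for the dissipation. -/

/-- Absorption of the lower order terms in the quartic form produced by the quantum pressure. -/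
theorem quartic_form_lower_bound {A B a₁ a₂ b₁ b₂ b₃ d c X Y : ℝ} (hA : 0 < A)
    (h₁ : A ≤ a₁) (h₂ : A ≤ a₂) (hb₁ : |b₁| ≤ B) (hb₂ : |b₂| ≤ B) (hb₃ : |b₃| ≤ B * c)
    (hd : d ^ 2 ≤ 4 * c) :
    -((B ^ 2 / A + 64 * B ^ 4 / A ^ 3) * c ^ 2) ≤
      a₁ * Y ^ 2 + a₂ * X ^ 4 - b₁ * d * X ^ 3 + b₂ * d * X * Y + b₃ * Y := by
  have sq : ∀ {u v : ℝ}, |u| ≤ v → u ^ 2 ≤ v ^ 2 := fun {u v} h => by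
    rw [← sq_abs]; exact pow_le_pow_left₀ (abs_nonneg _) h 2
  have e1 := sq hb₁
  have e2 := sq hb₂
  have e3 := sq hb₃
  have hc : 0 ≤ c := by nlinarith [sq_nonneg d]
  have y1 : b₁ * d * X ^ 3 ≤ A / 4 * X ^ 4 + B ^ 2 / A * (d ^ 2 * X ^ 2) := by
    have : A / 4 * X ^ 4 + b₁ ^ 2 / A * (d ^ 2 * X ^ 2) - b₁ * d * X ^ 3 =
      (A / 2 * X ^ 2 - b₁ * d * X) ^ 2 / A := by field_simp; ring
    have h0 : 0 ≤ (A / 2 * X ^ 2 - b₁ * d * X) ^ 2 / A := by positivity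
    have : b₁ ^ 2 / A * (d ^ 2 * X ^ 2) ≤ B ^ 2 / A * (d ^ 2 * X ^ 2) := by gcongr
    linarith
  have y2 : -(b₂ * d * X * Y) ≤ A / 4 * Y ^ 2 + B ^ 2 / A * (d ^ 2 * X ^ 2) := by
    have : A / 4 * Y ^ 2 + b₂ ^ 2 / A * (d ^ 2 * X ^ 2) + b₂ * d * X * Y =
      (A / 2 * Y + b₂ * d * X) ^ 2 / A := by field_simp; ring
    have h0 : 0 ≤ (A / 2 * Y + b₂ * d * X) ^ 2 / A := by positivity
    have : b₂ ^ 2 / A * (d ^ 2 * X ^ 2) ≤ B ^ 2 / A * (d ^ 2 * X ^ 2) := by gcongr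
    linarith
  have y3 : -(b₃ * Y) ≤ A / 4 * Y ^ 2 + B ^ 2 / A * c ^ 2 := by
    have : A / 4 * Y ^ 2 + b₃ ^ 2 / A + b₃ * Y = (A / 2 * Y + b₃) ^ 2 / A := by field_simp; ring
    have h0 : 0 ≤ (A / 2 * Y + b₃) ^ 2 / A := by positivity
    have : b₃ ^ 2 / A ≤ B ^ 2 / A * c ^ 2 := by
      rw [div_mul_eq_mul_div, ← mul_pow]; gcongr
    linarith
  have y4 : 2 * (B ^ 2 / A * (d ^ 2 * X ^ 2)) ≤
      A / 4 * X ^ 4 + 64 * B ^ 4 / A ^ 3 * c ^ 2 := by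
    have h1 : 2 * (B ^ 2 / A * (d ^ 2 * X ^ 2)) ≤ 2 * (B ^ 2 / A * (4 * c * X ^ 2)) := by gcongr
    have h2 : A / 4 * X ^ 4 + 64 * B ^ 4 / A ^ 3 * c ^ 2 - 2 * (B ^ 2 / A * (4 * c * X ^ 2)) =
      (A ^ 2 / 2 * X ^ 2 - 8 * B ^ 2 * c) ^ 2 / A ^ 3 := by field_simp; ring
    have h0 : 0 ≤ (A ^ 2 / 2 * X ^ 2 - 8 * B ^ 2 * c) ^ 2 / A ^ 3 := by positivity
    linarith
  have y5 : A * Y ^ 2 ≤ a₁ * Y ^ 2 := by gcongr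
  have y6 : A * X ^ 4 ≤ a₂ * X ^ 4 := by gcongr
  have y7 : 0 ≤ A * Y ^ 2 := by positivity
  have y8 : 0 ≤ A * X ^ 4 := by positivity
  linarith

section Cutoff

/-- The cutoff `(1 - c (1 + x²))⁴`. -/
noncomputable def cut (c x : ℝ) : ℝ := (1 - c * (1 + x ^ 2)) ^ 4

/-- The derivative of `cut`. -/
noncomputable def cut' (c x : ℝ) : ℝ := 4 * (1 - c * (1 + x ^ 2)) ^ 3 * (-(2 * c * x))

/-- The second derivative of `cut`. -/
noncomputable def cut'' (c x : ℝ) : ℝ :=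
  12 * (1 - c * (1 + x ^ 2)) ^ 2 * (-(2 * c * x)) ^ 2 - 8 * c * (1 - c * (1 + x ^ 2)) ^ 3

theorem hasDerivAt_one_sub_sq (c x : ℝ) :
    HasDerivAt (fun x : ℝ => 1 - c * (1 + x ^ 2)) (-(2 * c * x)) x :=
  ((((hasDerivAt_pow 2 x).const_add 1).const_mul c).const_sub 1).congr_deriv (by simp; ring)

theorem hasDerivAt_cut (c x : ℝ) : HasDerivAt (cut c) (cut' c x) x :=
  ((hasDerivAt_one_sub_sq c x).fun_pow 4).congr_deriv (by simp [cut'])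

theorem hasDerivAt_cut' (c x : ℝ) : HasDerivAt (cut' c) (cut'' c x) x :=
  ((((hasDerivAt_one_sub_sq c x).fun_pow 3).const_mul 4).fun_mul
    (((hasDerivAt_id x).const_mul (2 * c)).fun_neg)).congr_deriv (by
      simp only [cut'', id, Nat.add_one_sub_one, Nat.cast_ofNat]; ring)

theorem continuous_cut (c : ℝ) : Continuous (cut c) := by unfold cut; fun_prop

theorem continuous_cut' (c : ℝ) : Continuous (cut' c) := by unfold cut'; fun_prop

theorem continuous_cut'' (c : ℝ) : Continuous (cut'' c) := by unfold cut''; fun_prop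

theorem c21_cut (c : ℝ) : C21 (fun x _ => cut c x) (fun _ _ => 0) (fun x _ => cut' c x)
    (fun x _ => cut'' c x) where
  t _ t _ := hasDerivAt_const t _
  x x _ _ := hasDerivAt_cut c x
  xx x _ _ := hasDerivAt_cut' c x
  c := contStrip_of_continuous (continuous_cut c)
  ct := contStrip_of_continuous continuous_const
  cx := contStrip_of_continuous (continuous_cut' c)
  cxx := contStrip_of_continuous (continuous_cut'' c)

end Cutoff

/-- Displacement convexity in quantitative form: `T < 1` gives `1 + k (1 - 2T) ≥ 1 - k`. It converts
the dissipation `p' ρ ℓ_x²` into the weighted gradient energy. -/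
theorem pf'_lower {k y : ℝ} (hk0 : 0 < k) :
    k * (1 - k) * (Real.exp y * lgw k y) ≤ pf' k y := by
  have h1 := lgst_lt_one k y
  have h2 := mul_pos (Real.exp_pos y) (lgw_pos k y)
  unfold pf'
  have : 1 - k ≤ 1 + k * (1 - 2 * lgst k y) := by nlinarith
  calc k * (1 - k) * (Real.exp y * lgw k y) = k * (Real.exp y * lgw k y) * (1 - k) := by ring
    _ ≤ _ := by gcongr

theorem pf'_pos {k y : ℝ} (hk0 : 0 < k) (hk : k < 1 / 2) : 0 < pf' k y := by
  have h2 := mul_pos (Real.exp_pos y) (lgw_pos k y)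
  have h3 : 0 < 1 - k := by linarith
  exact lt_of_lt_of_le (by positivity) (pf'_lower hk0)

/-- The cutoff errors are linear in `p` while the dissipation carries `p'`; this inequality makes
Young's inequality close with a remainder proportional to `ρ`. -/
theorem pf_sq_le {k y : ℝ} (hk0 : 0 < k) (hk : k < 1 / 2) :
    pf k y ^ 2 ≤ pf' k y * Real.exp y := by
  have h1 := lgst_lt_one k y
  have h2 := lgw_pos k y
  have h3 := lgw_le k y
  have h4 := Real.exp_pos y
  have h5 : k * lgw k y ≤ 1 + k * (1 - 2 * lgst k y) := by nlinarith
  have : pf k y ^ 2 = k * (Real.exp y * lgw k y) * Real.exp y * (k * lgw k y) := by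
    unfold pf; ring
  rw [this, pf']
  calc k * (Real.exp y * lgw k y) * Real.exp y * (k * lgw k y)
      ≤ k * (Real.exp y * lgw k y) * Real.exp y * (1 + k * (1 - 2 * lgst k y)) := by gcongr
    _ = _ := by ring

/-- Pointwise estimate of the classical part of the dissipation: `v = ψ_xx`, `w = ψ_x`,
`z = (log ρ)_x`. -/
theorem classical_dissipation_le {k y c x v w z : ℝ} (hk0 : 0 < k) (hk : k < 1 / 2)
    (hc : 0 ≤ c) (hcx : c * (1 + x ^ 2) ≤ 1) :
    -(cut c x * pf' k y * v ^ 2) + cut' c x * pf k y * w * v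
        - cut' c x * pf k y * Real.exp y * z - cut c x * pf' k y * (Real.exp y * z ^ 2) ≤
      -(1 / 2 * (cut c x * pf' k y * (Real.exp y * z ^ 2))) +
        32 * (c ^ 2 * (1 + x ^ 2) * (Real.exp y * (w ^ 2 + Real.exp y))) := by
  set θ := 1 - c * (1 + x ^ 2) with hθ
  set d := -(2 * c * x) with hd
  have e0 : 0 ≤ c * (1 + x ^ 2) := by positivity
  have hθ0 : 0 ≤ θ := by linarith
  have hθ1 : θ ≤ 1 := by linarith
  have h1 : 0 < pf' k y := pf'_pos hk0 hk
  have hρ := Real.exp_pos y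
  set ρ := Real.exp y
  -- Writing `p = m p'` makes both cross terms part of complete squares, `s1` and `s2` below. The
  -- fourth power in the cutoff leaves a bounded factor `θ²` in the remainders.
  set m := pf k y / pf' k y with hm
  have hpm : pf k y = m * pf' k y := by rw [hm]; field_simp
  have hm2 : pf' k y * m ^ 2 ≤ ρ := by
    have : pf' k y * m ^ 2 = pf k y ^ 2 / pf' k y := by rw [hm]; field_simp
    rw [this, div_le_iff₀ h1, mul_comm]
    exact pf_sq_le hk0 hk
  have hχ : cut c x = θ ^ 4 := rfl
  have hχ' : cut' c x = 4 * θ ^ 3 * d := rfl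
  have hd2 : d ^ 2 ≤ 4 * (c ^ 2 * (1 + x ^ 2)) := by rw [hd]; nlinarith [sq_nonneg c]
  have s1 : 0 ≤ 1 / 2 * pf' k y * θ ^ 2 * (θ * v - 4 * d * m * w) ^ 2 := by positivity
  have s2 : 0 ≤ 1 / 2 * pf' k y * ρ * θ ^ 2 * (θ * z + 4 * d * m) ^ 2 := by positivity
  have s3 : 8 * θ ^ 2 * d ^ 2 * (pf' k y * m ^ 2) * (w ^ 2 + ρ) ≤
      32 * (c ^ 2 * (1 + x ^ 2) * (ρ * (w ^ 2 + ρ))) := by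
    calc 8 * θ ^ 2 * d ^ 2 * (pf' k y * m ^ 2) * (w ^ 2 + ρ)
        ≤ 8 * 1 ^ 2 * (4 * (c ^ 2 * (1 + x ^ 2))) * ρ * (w ^ 2 + ρ) := by gcongr
      _ = _ := by ring
  have s4 : 0 ≤ θ ^ 4 * pf' k y * v ^ 2 := by positivity
  rw [hχ, hχ', hpm]
  linear_combination s1 + s2 + s3 + 1 / 2 * s4

/-- Coercivity rests on `1 + 3τ + 3τ² ≥ 1/4`, with minimum at `τ = -1/2`, so that `1 - k² + 3τ + 3τ²
≥ 1/4 - k²`, which is positive for `k < 1/2`. The other factor satisfies `1 - 2τ ≥ 1 - 2k > 0`. All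
terms containing `d` or `c` come from the cutoff and are absorbed at the price of `c²`. -/
theorem quantum_form_lower_bound {k τ w c θ d X Y : ℝ} (hk0 : 0 < k) (hk : k < 1 / 2)
    (hτ1 : τ ≤ k) (hτ2 : -k ≤ τ) (hw : 0 < w) (hc : 0 ≤ c) (hθ0 : 0 ≤ θ) (hθ1 : θ ≤ 1)
    (hd : d ^ 2 ≤ 4 * c) :
    -((28 ^ 2 / (k / 24 * ((1 / 4 - k ^ 2) * (1 - 2 * k))) +
        64 * 28 ^ 4 / (k / 24 * ((1 / 4 - k ^ 2) * (1 - 2 * k))) ^ 3) * c ^ 2) ≤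
      2 * (k * (1 + τ)) * Y ^ 2 + k / 24 * ((1 - k ^ 2 + 3 * τ + 3 * τ ^ 2) * (1 - 2 * τ) +
        12 * k ^ 2 * w * (1 + 2 * τ)) * X ^ 4 -
        2 / 3 * (k / 2 * (1 - k ^ 2 + 3 * τ + 3 * τ ^ 2)) * d * X ^ 3 +
        8 * (k * (1 + τ)) * d * X * Y + (12 * d ^ 2 - 8 * c * θ) * k * Y := by
  have hk2 : 0 < 1 / 4 - k ^ 2 := by nlinarith
  have hk3 : 0 < 1 - 2 * k := by linarith
  have hΞ0 : 1 / 4 - k ^ 2 ≤ 1 - k ^ 2 + 3 * τ + 3 * τ ^ 2 := by nlinarith [sq_nonneg (τ + 1 / 2)]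
  have hτsq : τ ^ 2 ≤ 1 / 4 := by nlinarith
  have hΞ1 : 1 - k ^ 2 + 3 * τ + 3 * τ ^ 2 ≤ 4 := by nlinarith
  generalize 1 - k ^ 2 + 3 * τ + 3 * τ ^ 2 = Ξ at hΞ0 hΞ1 ⊢
  have hk4 : 1 / 4 - k ^ 2 ≤ 1 := by nlinarith
  have hk5 : 1 - 2 * k ≤ 1 := by linarith
  have hτ3 : 0 ≤ 1 + 2 * τ := by linarith
  have hτ4 : 1 / 2 ≤ 1 + τ := by linarith
  have hτ5 : 1 + τ ≤ 2 := by linarith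
  have hΞ2 : 0 ≤ Ξ := hk2.le.trans hΞ0
  have hkτ : k * (1 + τ) ≤ 1 / 2 * 2 := mul_le_mul hk.le hτ5 (by linarith) (by norm_num)
  have hkτ0 : 0 ≤ k * (1 + τ) := mul_nonneg hk0.le (by linarith)
  have hkτ1 : k * (1 / 2) ≤ k * (1 + τ) := mul_le_mul_of_nonneg_left hτ4 hk0.le
  have hkΞ : k / 2 * Ξ ≤ 1 / 4 * 4 := mul_le_mul (by linarith) hΞ1 hΞ2 (by norm_num)
  -- The value `28` is `56 · 1/2`, from `|12 d² - 8 c θ| ≤ 56 c` and `k < 1/2`; the other two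
  -- coefficients are smaller.
  refine quartic_form_lower_bound (by positivity) ?_ ?_ ?_ ?_ ?_ hd
  · have h1 : (1 / 4 - k ^ 2) * (1 - 2 * k) ≤ 1 * 1 := mul_le_mul hk4 hk5 hk3.le (by norm_num)
    have h2 := mul_le_mul_of_nonneg_left h1 (show 0 ≤ k / 24 by positivity)
    linarith
  · have h1 : 0 ≤ 12 * k ^ 2 * w * (1 + 2 * τ) := by positivity
    have h2 : (1 / 4 - k ^ 2) * (1 - 2 * k) ≤ Ξ * (1 - 2 * τ) :=
      mul_le_mul hΞ0 (by linarith) hk3.le hΞ2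
    exact mul_le_mul_of_nonneg_left (by linarith) (by positivity)
  · rw [abs_of_nonneg (by positivity)]
    linarith
  · rw [abs_of_nonneg (by positivity)]
    linarith
  · have h1 : c * θ ≤ c := mul_le_of_le_one_right hc hθ1
    have h2 : 0 ≤ c * θ := by positivity
    have h3 : |12 * d ^ 2 - 8 * c * θ| ≤ 56 * c := by
      rw [abs_le]; constructor <;> linarith [sq_nonneg d]
    rw [abs_mul, abs_of_pos hk0]
    calc |12 * d ^ 2 - 8 * c * θ| * k ≤ 56 * c * (1 / 2) := by gcongr
      _ = _ := by ring

/-- Pointwise lower bound of the quantum part of the dissipation: `z = (log ρ)_x`. -/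
theorem exists_quantum_lower_bound {k : ℝ} (hk0 : 0 < k) (hk : k < 1 / 2) :
    ∃ C, 0 ≤ C ∧ ∀ y c x z Q : ℝ, 0 ≤ c → c * (1 + x ^ 2) ≤ 1 →
      -(C * c ^ 2 * Real.exp y) ≤ 2 * cut c x * pf' k y * Q ^ 2 +
        cut c x * (1 / 4 * qf k y - 1 / 6 * qf' k y) * z ^ 4 - 1 / 6 * cut' c x * qf k y * z ^ 3 +
        2 * cut' c x * pf' k y * z * Q + cut'' c x * pf k y * Q := by
  have hk2 : 0 < 1 / 4 - k ^ 2 := by nlinarith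
  have hk3 : 0 < 1 - 2 * k := by linarith
  obtain ⟨C, hC⟩ : ∃ C, C = 28 ^ 2 / (k / 24 * ((1 / 4 - k ^ 2) * (1 - 2 * k))) +
    64 * 28 ^ 4 / (k / 24 * ((1 / 4 - k ^ 2) * (1 - 2 * k))) ^ 3 := ⟨_, rfl⟩
  have hC0 : 0 ≤ C := by rw [hC]; positivity
  refine ⟨C, hC0, fun y c x z Q hc hcx => ?_⟩
  have e0 : 0 ≤ c * (1 + x ^ 2) := by positivity
  have ht0 := lgst_pos k y
  have ht1 := lgst_lt_one k y
  have hcx2 : c * x ^ 2 ≤ 1 := by linarith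
  have hd2 : (-(2 * c * x)) ^ 2 ≤ 4 * c := by
    have : (-(2 * c * x)) ^ 2 = 4 * c * (c * x ^ 2) := by ring
    rw [this]
    exact mul_le_of_le_one_right (by positivity) hcx2
  -- The scaling `X = θ z`, `Y = θ² Q` absorbs the powers of `θ` exactly because the cutoff is a
  -- fourth power. The common factor `e^y T (1 - T)` is divided out and restored afterwards.
  have key := quantum_form_lower_bound (k := k) (τ := k * (1 - 2 * lgst k y)) (w := lgw k y)
    (X := (1 - c * (1 + x ^ 2)) * z) (Y := (1 - c * (1 + x ^ 2)) ^ 2 * Q) hk0 hk (by nlinarith)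
    (by nlinarith) (lgw_pos k y) hc (θ := 1 - c * (1 + x ^ 2)) (by linarith) (by linarith) hd2
  rw [← hC] at key
  have hG : 0 < Real.exp y * lgw k y := mul_pos (Real.exp_pos y) (lgw_pos k y)
  have h1 := mul_le_mul_of_nonneg_left key hG.le
  have h2 : Real.exp y * lgw k y * (C * c ^ 2) ≤ C * c ^ 2 * Real.exp y := by
    calc Real.exp y * lgw k y * (C * c ^ 2) ≤ Real.exp y * 1 * (C * c ^ 2) := by
          have := (Real.exp_pos y).le
          have := lgw_le k y
          gcongr; linarith
      _ = _ := by ring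
  unfold cut cut' cut'' pf pf' qf qf'
  linear_combination h1 + h2

/-! ### Quantum Euler variables and the dissipation of the entropy. -/

namespace MFGPair

variable {ε : ℝ} (P : MFGPair ε)

/-- The logarithm of the density. -/
noncomputable def logρ (x t : ℝ) : ℝ := -(1 / (2 * ε)) * (P.f x t + P.g x t)
/-- The time derivative of `logρ`. -/
noncomputable def logρt (x t : ℝ) : ℝ := -(1 / (2 * ε)) * (P.ft x t + P.gt x t)
/-- The space derivative of `logρ`. -/
noncomputable def logρx (x t : ℝ) : ℝ := -(1 / (2 * ε)) * (P.fx x t + P.gx x t)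
/-- The second space derivative of `logρ`. -/
noncomputable def logρxx (x t : ℝ) : ℝ := -(1 / (2 * ε)) * (P.fxx x t + P.gxx x t)
/-- The velocity potential of the current. -/
noncomputable def ψ (x t : ℝ) : ℝ := 1 / 2 * (P.f x t + -1 * P.g x t)
/-- The time derivative of `ψ`. -/
noncomputable def ψt (x t : ℝ) : ℝ := 1 / 2 * (P.ft x t + -1 * P.gt x t)
/-- The space derivative of `ψ`. -/
noncomputable def ψx (x t : ℝ) : ℝ := 1 / 2 * (P.fx x t + -1 * P.gx x t)
/-- The second space derivative of `ψ`. -/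
noncomputable def ψxx (x t : ℝ) : ℝ := 1 / 2 * (P.fxx x t + -1 * P.gxx x t)

theorem logρ_reg : C21 P.logρ P.logρt P.logρx P.logρxx :=
  (P.f_reg.add P.g_reg).const_mul (-(1 / (2 * ε)))

theorem ψ_reg : C21 P.ψ P.ψt P.ψx P.ψxx :=
  (P.f_reg.add (P.g_reg.const_mul (-1))).const_mul (1 / 2)

theorem ρ_eq_exp (x t : ℝ) : P.ρ x t = Real.exp (P.logρ x t) := by
  unfold ρ logρ; congr 1; ring

theorem logρt_eq (x : ℝ) {t : ℝ} (ht : t ∈ Ioo (0 : ℝ) 1) :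
    P.logρt x t = -P.ψxx x t - P.ψx x t * P.logρx x t := by
  have hε := P.pos
  have h1 := P.hj_f x t ht
  have h2 := P.hj_g x t ht
  have e : P.ft x t + P.gt x t = ε * (P.fxx x t - P.gxx x t) -
      1 / 2 * (P.fx x t ^ 2 - P.gx x t ^ 2) := by linarith
  unfold logρt ψxx ψx logρx
  rw [e]
  field_simp
  ring

/-- Half the sum of the two Hamilton–Jacobi equations: the viscous terms combine with the squares
into the quantum potential `(√ρ)_xx / √ρ`, written here in terms of `log ρ`. -/
theorem ψt_eq (x : ℝ) {t : ℝ} (ht : t ∈ Ioo (0 : ℝ) 1) :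
    P.ψt x t = P.ρ x t - 1 / 2 * P.ψx x t ^ 2 -
      2 * ε ^ 2 * (1 / 2 * P.logρxx x t + 1 / 4 * P.logρx x t ^ 2) := by
  have hε := P.pos
  have h1 := P.hj_f x t ht
  have h2 := P.hj_g x t ht
  have e : P.ft x t + -1 * P.gt x t = 2 * P.ρ x t + ε * (P.fxx x t + P.gxx x t) -
      1 / 2 * (P.fx x t ^ 2 + P.gx x t ^ 2) := by unfold ρ; linarith
  unfold ψt
  rw [e]
  unfold logρxx logρx ψx
  field_simp
  ring

theorem c21_cut_mul_pf (k c : ℝ) :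
    C21 (fun x t => cut c x * pf k (P.logρ x t))
      (fun x t => cut c x * (pf' k (P.logρ x t) * P.logρt x t))
      (fun x t => cut' c x * pf k (P.logρ x t) + cut c x * (pf' k (P.logρ x t) * P.logρx x t))
      (fun x t => cut'' c x * pf k (P.logρ x t) +
        2 * (cut' c x * (pf' k (P.logρ x t) * P.logρx x t)) +
        cut c x * (pf'' k (P.logρ x t) * P.logρx x t ^ 2 + pf' k (P.logρ x t) * P.logρxx x t)) := by
  have h := (c21_cut c).mul (P.logρ_reg.comp (s := univ) (fun _ _ _ => mem_univ _)
    (fun y _ => hasDerivAt_pf k y) (fun y _ => hasDerivAt_pf' k y)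
    (continuous_pf'' k).continuousOn)
  convert h using 4
  ring

/-- Dissipation of `∫ χ p(ρ) ψ_xx`. -/
theorem dissipation_le {k C : ℝ} (hk0 : 0 < k) (hk : k < 1 / 2)
    (hC : ∀ y c x z Q : ℝ, 0 ≤ c → c * (1 + x ^ 2) ≤ 1 →
      -(C * c ^ 2 * Real.exp y) ≤ 2 * cut c x * pf' k y * Q ^ 2 +
        cut c x * (1 / 4 * qf k y - 1 / 6 * qf' k y) * z ^ 4 - 1 / 6 * cut' c x * qf k y * z ^ 3 +
        2 * cut' c x * pf' k y * z * Q + cut'' c x * pf k y * Q)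
    {c R : ℝ} (hc : 0 ≤ c) (hR : 0 ≤ R) (hcR : c * (1 + R ^ 2) = 1) {t : ℝ}
    (ht : t ∈ Ioo (0 : ℝ) 1) :
    ∫ x in (-R)..R, (cut c x * (pf' k (P.logρ x t) * P.logρt x t) * P.ψxx x t +
        (cut'' c x * pf k (P.logρ x t) + 2 * (cut' c x * (pf' k (P.logρ x t) * P.logρx x t)) +
        cut c x * (pf'' k (P.logρ x t) * P.logρx x t ^ 2 +
          pf' k (P.logρ x t) * P.logρxx x t)) * P.ψt x t) ≤
      ∫ x in (-R)..R,
        (-(1 / 2 * (cut c x * pf' k (P.logρ x t) * (P.ρ x t * P.logρx x t ^ 2))) +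
        32 * (c ^ 2 * (1 + x ^ 2) * (P.ρ x t * (P.ψx x t ^ 2 + P.ρ x t))) +
        2 * ε ^ 2 * C * c ^ 2 * P.ρ x t) := by
  have hRR : -R ≤ R := by linarith
  have hcx : ∀ x ∈ Icc (-R) R, c * (1 + x ^ 2) ≤ 1 := by
    intro x hx
    have : x ^ 2 ≤ R ^ 2 := sq_le_sq' hx.1 hx.2
    calc c * (1 + x ^ 2) ≤ c * (1 + R ^ 2) := by gcongr
      _ = 1 := hcR
  have hℓ := P.logρ_reg
  have hψ := P.ψ_reg
  have hρ := P.ρ_reg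
  have cρ : Continuous fun x => P.ρ x t := hρ.c.continuous_slice ht
  have cℓ : Continuous fun x => P.logρ x t := hℓ.c.continuous_slice ht
  have cℓt : Continuous fun x => P.logρt x t := hℓ.ct.continuous_slice ht
  have cℓx : Continuous fun x => P.logρx x t := hℓ.cx.continuous_slice ht
  have cℓxx : Continuous fun x => P.logρxx x t := hℓ.cxx.continuous_slice ht
  have cψt : Continuous fun x => P.ψt x t := hψ.ct.continuous_slice ht
  have cψx : Continuous fun x => P.ψx x t := hψ.cx.continuous_slice ht
  have cψxx : Continuous fun x => P.ψxx x t := hψ.cxx.continuous_slice ht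
  have c0 : Continuous fun x => pf k (P.logρ x t) := (continuous_pf k).comp cℓ
  have c1 : Continuous fun x => pf' k (P.logρ x t) := (continuous_pf' k).comp cℓ
  have c2 : Continuous fun x => pf'' k (P.logρ x t) := (continuous_pf'' k).comp cℓ
  have c3 : Continuous fun x => qf k (P.logρ x t) := (continuous_qf k).comp cℓ
  have c4 : Continuous fun x => qf' k (P.logρ x t) := (continuous_qf' k).comp cℓ
  have k0 := continuous_cut c
  have k1 := continuous_cut' c
  have k2 := continuous_cut'' c
  -- A total derivative that performs two integrations by parts: one moves a derivative of `χ p`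
  -- onto `ρ - ψ_x² / 2`, the other replaces `χ q ℓ_x² ℓ_xx` by terms in `ℓ_x⁴` and `ℓ_x³`. No third
  -- derivative of `ψ` or `ℓ` appears.
  set W' : ℝ → ℝ := fun x =>
    (cut'' c x * pf k (P.logρ x t) + 2 * (cut' c x * (pf' k (P.logρ x t) * P.logρx x t)) +
        cut c x * (pf'' k (P.logρ x t) * P.logρx x t ^ 2 +
          pf' k (P.logρ x t) * P.logρxx x t)) * (P.ρ x t - 1 / 2 * P.ψx x t ^ 2) +
      (cut' c x * pf k (P.logρ x t) + cut c x * (pf' k (P.logρ x t) * P.logρx x t)) *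
        (P.ρ x t * P.logρx x t - P.ψx x t * P.ψxx x t) -
      ε ^ 2 / 3 * ((cut' c x * qf k (P.logρ x t) + cut c x * (qf' k (P.logρ x t) * P.logρx x t)) *
        P.logρx x t ^ 3 + cut c x * qf k (P.logρ x t) * (3 * P.logρx x t ^ 2 * P.logρxx x t))
    with hW'
  have cW : Continuous W' := by fun_prop
  have hW : ∫ x in (-R)..R, W' x = 0 := by
    have hcR2 : 1 - c * (1 + R ^ 2) = 0 := by linarith
    refine integral_eq_zero_of_hasDerivAt (Y := fun x =>
      (cut' c x * pf k (P.logρ x t) + cut c x * (pf' k (P.logρ x t) * P.logρx x t)) *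
        (P.ρ x t - 1 / 2 * P.ψx x t ^ 2) -
      ε ^ 2 / 3 * (cut c x * qf k (P.logρ x t) * P.logρx x t ^ 3)) (fun x => ?_) cW
      (by simp [cut, cut', hcR2]) (by simp [cut, cut', hcR2])
    have d1 := (P.c21_cut_mul_pf k c).xx x t ht
    have d2 : HasDerivAt (fun x => P.ρ x t) (P.ρ x t * P.logρx x t) x :=
      (hρ.x x t ht).congr_deriv (by unfold logρx; ring)
    have d3 := (hψ.xx x t ht).fun_pow 2
    have d4 := (hasDerivAt_qf k (P.logρ x t)).comp x (hℓ.x x t ht)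
    have d5 := (hℓ.xx x t ht).fun_pow 3
    refine ((d1.fun_mul (d2.fun_sub (d3.const_mul (1 / 2)))).fun_sub
      ((((hasDerivAt_cut c x).fun_mul d4).fun_mul d5).const_mul (ε ^ 2 / 3))).congr_deriv ?_
    simp only [hW', Function.comp_apply, Nat.add_one_sub_one, pow_one, Nat.cast_ofNat]
    ring
  rw [← sub_zero (∫ x in (-R)..R, _), ← hW, ← integral_sub_of_continuous (by fun_prop) cW]
  refine integral_mono_of_continuous (by fun_prop) (by fun_prop) hRR fun x hx => ?_
  have h1 := classical_dissipation_le (y := P.logρ x t) (v := P.ψxx x t) (w := P.ψx x t)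
    (z := P.logρx x t) hk0 hk hc (hcx x hx)
  have h2 := mul_le_mul_of_nonneg_left (hC (P.logρ x t) c x (P.logρx x t)
    (1 / 2 * P.logρxx x t + 1 / 4 * P.logρx x t ^ 2) hc (hcx x hx)) (sq_nonneg ε)
  rw [← P.ρ_eq_exp] at h1 h2
  simp only [hW']
  rw [P.logρt_eq x ht, P.ψt_eq x ht]
  have h3 := qf_eq k (P.logρ x t)
  rw [h3] at h2 ⊢
  linear_combination h1 + 2 * h2

end MFGPair

theorem cut_nonneg (c x : ℝ) : 0 ≤ cut c x := by unfold cut; positivity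

theorem cut_le_one {c x : ℝ} (hc : 0 ≤ c) (hcx : c * (1 + x ^ 2) ≤ 1) : cut c x ≤ 1 := by
  have e0 : 0 ≤ c * (1 + x ^ 2) := by positivity
  exact pow_le_one₀ (by linarith) (by linarith)

namespace MFGPair

variable {ε : ℝ} (P : MFGPair ε)

/-- Since the entropy lies between zero and the density, its integral is controlled by the mass
alone; hence the end terms in time need no information on the data. -/
theorem exp_mul_lgst_mem (k x t : ℝ) :
    Real.exp (P.logρ x t) * lgst k (P.logρ x t) ∈ Icc 0 (P.ρ x t) := by
  rw [P.ρ_eq_exp]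
  have h1 := lgst_pos k (P.logρ x t)
  have h2 := lgst_lt_one k (P.logρ x t)
  have h3 := Real.exp_pos (P.logρ x t)
  exact ⟨by positivity, mul_le_of_le_one_right h3.le h2.le⟩

/-- Flux part of the entropy balance. -/
theorem integral_entropy_deriv {k c R : ℝ} (hcR : c * (1 + R ^ 2) = 1) {t : ℝ}
    (ht : t ∈ Ioo (0 : ℝ) 1) :
    ∫ x in (-R)..R, cut c x *
        ((Real.exp (P.logρ x t) * lgst k (P.logρ x t) + pf k (P.logρ x t)) * P.logρt x t) =
      -(∫ x in (-R)..R, cut c x * pf k (P.logρ x t) * P.ψxx x t) +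
        ∫ x in (-R)..R, cut' c x * (Real.exp (P.logρ x t) * lgst k (P.logρ x t)) * P.ψx x t := by
  have hℓ := P.logρ_reg
  have hψ := P.ψ_reg
  have cℓ : Continuous fun x => P.logρ x t := hℓ.c.continuous_slice ht
  have cℓt : Continuous fun x => P.logρt x t := hℓ.ct.continuous_slice ht
  have cℓx : Continuous fun x => P.logρx x t := hℓ.cx.continuous_slice ht
  have cψx : Continuous fun x => P.ψx x t := hψ.cx.continuous_slice ht
  have cψxx : Continuous fun x => P.ψxx x t := hψ.cxx.continuous_slice ht
  have c0 : Continuous fun x => pf k (P.logρ x t) := (continuous_pf k).comp cℓ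
  have c1 : Continuous fun x => lgst k (P.logρ x t) := (continuous_lgst k).comp cℓ
  have k0 := continuous_cut c
  have k1 := continuous_cut' c
  set W' : ℝ → ℝ := fun x =>
    cut' c x * (Real.exp (P.logρ x t) * lgst k (P.logρ x t)) * P.ψx x t +
      cut c x * ((Real.exp (P.logρ x t) * lgst k (P.logρ x t) + pf k (P.logρ x t)) *
        P.logρx x t) * P.ψx x t +
      cut c x * (Real.exp (P.logρ x t) * lgst k (P.logρ x t)) * P.ψxx x t with hW'
  have cW : Continuous W' := by fun_prop
  have hW : ∫ x in (-R)..R, W' x = 0 := by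
    have hcR2 : 1 - c * (1 + R ^ 2) = 0 := by linarith
    refine integral_eq_zero_of_hasDerivAt (Y := fun x =>
      cut c x * (Real.exp (P.logρ x t) * lgst k (P.logρ x t)) * P.ψx x t) (fun x => ?_) cW
      (by simp [cut, hcR2]) (by simp [cut, hcR2])
    have d4 := (hasDerivAt_exp_mul_lgst k (P.logρ x t)).comp x (hℓ.x x t ht)
    refine (((hasDerivAt_cut c x).fun_mul d4).fun_mul (hψ.xx x t ht)).congr_deriv ?_
    simp only [hW', Function.comp_apply]
    ring
  rw [eq_neg_add_iff_add_eq, ← integral_add_of_continuous (by fun_prop) (by fun_prop),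
    ← sub_eq_zero, ← integral_sub_of_continuous (by fun_prop) (by fun_prop),
    ← neg_eq_zero, ← hW, ← intervalIntegral.integral_neg]
  congr 1
  ext x
  simp only [hW']
  rw [P.logρt_eq x ht]
  ring

/-- Integrated dissipation estimate with a cutoff. -/
theorem cutoff_estimate {k C : ℝ} (hk0 : 0 < k) (hk : k < 1 / 2) (hC0 : 0 ≤ C)
    (hC : ∀ y c x z Q : ℝ, 0 ≤ c → c * (1 + x ^ 2) ≤ 1 →
      -(C * c ^ 2 * Real.exp y) ≤ 2 * cut c x * pf' k y * Q ^ 2 +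
        cut c x * (1 / 4 * qf k y - 1 / 6 * qf' k y) * z ^ 4 - 1 / 6 * cut' c x * qf k y * z ^ 3 +
        2 * cut' c x * pf' k y * z * Q + cut'' c x * pf k y * Q)
    {c R a b : ℝ} (hc : 0 ≤ c) (hR : 0 ≤ R) (hcR : c * (1 + R ^ 2) = 1)
    (ha : 0 < a) (hab : a ≤ b) (hb : b < 1) :
    ∫ t in a..b, (t - a) * (b - t) * (1 / 2 * ∫ x in (-R)..R,
        cut c x * pf' k (P.logρ x t) * (P.ρ x t * P.logρx x t ^ 2)) ≤
      3 + 2 * ε ^ 2 * C * c ^ 2 + 48 * ∫ t in a..b, ∫ x in (-R)..R,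
        c ^ 2 * (1 + x ^ 2) * (P.ρ x t * (P.ψx x t ^ 2 + P.ρ x t)) := by
  have hRR : -R ≤ R := by linarith
  have hcx : ∀ x ∈ Icc (-R) R, c * (1 + x ^ 2) ≤ 1 := by
    intro x hx
    have : x ^ 2 ≤ R ^ 2 := sq_le_sq' hx.1 hx.2
    calc c * (1 + x ^ 2) ≤ c * (1 + R ^ 2) := by gcongr
      _ = 1 := hcR
  have hmem : ∀ t ∈ Icc a b, t ∈ Ioo (0 : ℝ) 1 := fun t ht =>
    ⟨ha.trans_le ht.1, ht.2.trans_lt hb⟩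
  have hℓ := P.logρ_reg
  have hψ := P.ψ_reg
  have hρ := P.ρ_reg
  have hχ : ContStrip 0 1 fun x _ => cut c x := contStrip_of_continuous (continuous_cut c)
  have hIc : ContStrip 0 1 fun x t =>
      cut c x * pf' k (P.logρ x t) * (P.ρ x t * P.logρx x t ^ 2) :=
    (hχ.mul ((continuous_pf' k).comp_continuousOn hℓ.c)).mul (hρ.c.mul (hℓ.cx.pow 2))
  have hJc : ContStrip 0 1 fun x t =>
      c ^ 2 * (1 + x ^ 2) * (P.ρ x t * (P.ψx x t ^ 2 + P.ρ x t)) :=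
    (contStrip_of_continuous (by fun_prop : Continuous fun x : ℝ => c ^ 2 * (1 + x ^ 2))).mul
      (hρ.c.mul ((hψ.cx.pow 2).add hρ.c))
  have hIi := intervalIntegrable_integral_strip hIc (-R) R ha hab hb
  have hJi := intervalIntegrable_integral_strip hJc (-R) R ha hab hb
  have hIi' : IntervalIntegrable (fun t => (t - a) * (b - t) * (1 / 2 * ∫ x in (-R)..R,
      cut c x * pf' k (P.logρ x t) * (P.ρ x t * P.logρx x t ^ 2))) volume a b :=
    (hIi.const_mul (1 / 2)).continuousOn_mul (by fun_prop)
  set F : ℝ → ℝ := fun t => ∫ x in (-R)..R,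
    cut c x * (Real.exp (P.logρ x t) * lgst k (P.logρ x t)) with hF
  have hF01 : ∀ t ∈ Icc a b, 0 ≤ F t ∧ F t ≤ 1 := by
    intro t ht
    refine ⟨intervalIntegral.integral_nonneg hRR fun x _ =>
      mul_nonneg (cut_nonneg c x) (P.exp_mul_lgst_mem k x t).1, ?_⟩
    refine (integral_mono_of_continuous ?_ (hρ.c.continuous_slice (hmem t ht)) hRR
      fun x hx => ?_).trans (P.mass_le t (hmem t ht) _ _ hRR)
    · have cℓ := hℓ.c.continuous_slice (hmem t ht)
      exact (continuous_cut c).mul ((Real.continuous_exp.comp cℓ).mul ((continuous_lgst k).comp cℓ))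
    · have h1 := P.exp_mul_lgst_mem k x t
      exact (mul_le_of_le_one_left h1.1 (cut_le_one hc (hcx x hx))).trans h1.2
  set D := 2 * ε ^ 2 * C * c ^ 2 + 1 with hD
  have hD0 : 0 ≤ 2 * ε ^ 2 * C * c ^ 2 := by positivity
  -- With `ζ = (t - a)(b - t)`, `F` the entropy and `S = ∫ χ p ψ_xx`, the quantity is `ζ S + ζ' F`.
  -- As `F' = -S` up to the cutoff flux, the terms `ζ' S` cancel, and as `ζ` vanishes at both ends
  -- only `F(a)` and `F(b)` survive. The final `3` is these two values plus the `1` in `D`.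
  have key := sub_le_integral_of_hasDerivAt hab
    (Y := fun t => (t - a) * (b - t) * (∫ x in (-R)..R, cut c x * pf k (P.logρ x t) * P.ψxx x t) +
      (b - t - (t - a)) * F t)
    (Y' := fun t => ((b - t - (t - a)) * (∫ x in (-R)..R, cut c x * pf k (P.logρ x t) * P.ψxx x t) +
      (t - a) * (b - t) * (∫ x in (-R)..R,
        (cut c x * (pf' k (P.logρ x t) * P.logρt x t) * P.ψxx x t +
        (cut'' c x * pf k (P.logρ x t) + 2 * (cut' c x * (pf' k (P.logρ x t) * P.logρx x t)) +
        cut c x * (pf'' k (P.logρ x t) * P.logρx x t ^ 2 +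
          pf' k (P.logρ x t) * P.logρxx x t)) * P.ψt x t))) +
      (-2 * F t + (b - t - (t - a)) * ∫ x in (-R)..R, cut c x *
        ((Real.exp (P.logρ x t) * lgst k (P.logρ x t) + pf k (P.logρ x t)) * P.logρt x t)))
    (e := fun t => D + 48 * (∫ x in (-R)..R,
        c ^ 2 * (1 + x ^ 2) * (P.ρ x t * (P.ψx x t ^ 2 + P.ρ x t))) -
      (t - a) * (b - t) * (1 / 2 * ∫ x in (-R)..R,
        cut c x * pf' k (P.logρ x t) * (P.ρ x t * P.logρx x t ^ 2)))
    (fun t ht => ?_) ((intervalIntegrable_const.add (hJi.const_mul 48)).sub hIi') ?_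
  · rw [intervalIntegral.integral_sub (intervalIntegrable_const.add (hJi.const_mul 48)) hIi',
      intervalIntegral.integral_add intervalIntegrable_const (hJi.const_mul 48),
      intervalIntegral.integral_const, intervalIntegral.integral_const_mul, smul_eq_mul] at key
    have h1 := hF01 a ⟨le_rfl, hab⟩
    have h2 := hF01 b ⟨hab, le_rfl⟩
    have h3 : (b - a) * D ≤ D := mul_le_of_le_one_left (by linarith) (by linarith)
    have h4 : (b - a) * F a ≤ 1 := by nlinarith
    have h5 : (b - a) * F b ≤ 1 := by nlinarith
    simp only [sub_self, zero_mul, mul_zero, zero_add, sub_zero, zero_sub] at key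
    linarith
  · have ht' := hmem t ht
    have dζ : HasDerivAt (fun t => (t - a) * (b - t)) (b - t - (t - a)) t :=
      (((hasDerivAt_id t).sub_const a).fun_mul ((hasDerivAt_id t).const_sub b)).congr_deriv
        (by simp; ring)
    have dζ' : HasDerivAt (fun t => b - t - (t - a)) (-2) t :=
      (((hasDerivAt_id t).const_sub b).fun_sub ((hasDerivAt_id t).sub_const a)).congr_deriv
        (by norm_num)
    have hcR2 : 1 - c * (1 + R ^ 2) = 0 := by linarith
    have dS := (P.c21_cut_mul_pf k c).hasDerivAt_integral_mul_xx hψ (l := -R) (r := R)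
      (fun t _ => by simp [cut, hcR2]) (fun t _ => by simp [cut, hcR2])
      (fun t _ => by simp [cut, cut', hcR2]) (fun t _ => by simp [cut, cut', hcR2]) ht'
    have hc1 : ContStrip 0 1 fun x t =>
        cut c x * (Real.exp (P.logρ x t) * lgst k (P.logρ x t)) :=
      hχ.mul ((Real.continuous_exp.comp_continuousOn hℓ.c).mul
        ((continuous_lgst k).comp_continuousOn hℓ.c))
    have hc2 : ContStrip 0 1 fun x t => cut c x *
        ((Real.exp (P.logρ x t) * lgst k (P.logρ x t) + pf k (P.logρ x t)) * P.logρt x t) :=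
      hχ.mul ((((Real.continuous_exp.comp_continuousOn hℓ.c).mul
        ((continuous_lgst k).comp_continuousOn hℓ.c)).add
        ((continuous_pf k).comp_continuousOn hℓ.c)).mul hℓ.ct)
    have dF : HasDerivAt F _ t := hasDerivAt_integral_strip hc1 hc2 (fun x s hs =>
      ((hasDerivAt_exp_mul_lgst k (P.logρ x s)).comp s (hℓ.t x s hs)).const_mul _) (-R) R ht'
    exact (dζ.fun_mul dS).fun_add (dζ'.fun_mul dF)
  · intro t ht
    have ht' := hmem t (Ioo_subset_Icc_self ht)
    have h1 := P.dissipation_le hk0 hk hC hc hR hcR ht'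
    have cρ : Continuous fun x => P.ρ x t := hρ.c.continuous_slice ht'
    have cℓ : Continuous fun x => P.logρ x t := hℓ.c.continuous_slice ht'
    have cℓx : Continuous fun x => P.logρx x t := hℓ.cx.continuous_slice ht'
    have cψx : Continuous fun x => P.ψx x t := hψ.cx.continuous_slice ht'
    have c1 : Continuous fun x => lgst k (P.logρ x t) := (continuous_lgst k).comp cℓ
    have c2 : Continuous fun x => pf' k (P.logρ x t) := (continuous_pf' k).comp cℓ
    have k0 := continuous_cut c
    have k1 := continuous_cut' c
    conv_rhs at h1 =>
      rw [integral_add_of_continuous (by fun_prop) (by fun_prop),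
        integral_add_of_continuous (by fun_prop) (by fun_prop), intervalIntegral.integral_neg,
        intervalIntegral.integral_const_mul, intervalIntegral.integral_const_mul,
        intervalIntegral.integral_const_mul]
    have h2 := P.integral_entropy_deriv (k := k) hcR ht'
    have hM := P.mass_le t ht' _ _ hRR
    change ∫ x in (-R)..R, P.ρ x t ≤ 1 at hM
    -- From `|χ'| ≤ 8 c |x|` and `8r ≤ 1 + 16 r²`. The `16` here and the `32` of the dissipation add
    -- up to the `48` in the conclusion.
    have h3 : |∫ x in (-R)..R, cut' c x * (Real.exp (P.logρ x t) * lgst k (P.logρ x t)) *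
        P.ψx x t| ≤ (∫ x in (-R)..R, P.ρ x t) + 16 * ∫ x in (-R)..R,
          c ^ 2 * (1 + x ^ 2) * (P.ρ x t * (P.ψx x t ^ 2 + P.ρ x t)) := by
      refine (intervalIntegral.abs_integral_le_integral_abs hRR).trans ?_
      rw [← intervalIntegral.integral_const_mul, ← integral_add_of_continuous cρ (by fun_prop)]
      refine integral_mono_of_continuous (by fun_prop) (by fun_prop) hRR fun x hx => ?_
      have e1 := P.exp_mul_lgst_mem k x t
      have e2 : |cut' c x| ≤ 8 * c * |x| := by
        have e3 := hcx x hx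
        have e4 : 0 ≤ c * (1 + x ^ 2) := by positivity
        have e5 : (1 - c * (1 + x ^ 2)) ^ 3 ≤ 1 := pow_le_one₀ (by linarith) (by linarith)
        have e6 : 0 ≤ (1 - c * (1 + x ^ 2)) ^ 3 := pow_nonneg (by linarith) 3
        rw [cut', abs_mul, abs_mul, abs_of_nonneg e6, abs_neg, abs_mul, abs_mul, abs_two,
          abs_of_nonneg hc, abs_of_pos (by norm_num : (0 : ℝ) < 4)]
        calc 4 * (1 - c * (1 + x ^ 2)) ^ 3 * (2 * c * |x|) ≤ 4 * 1 * (2 * c * |x|) := by gcongr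
          _ = _ := by ring
      have hρ0 := (P.ρ_pos x t).le
      rw [abs_mul, abs_mul, abs_of_nonneg e1.1]
      calc |cut' c x| * (Real.exp (P.logρ x t) * lgst k (P.logρ x t)) * |P.ψx x t|
          ≤ 8 * c * |x| * P.ρ x t * |P.ψx x t| := by
            gcongr
            exacts [e1.1, e1.2]
        _ = P.ρ x t * (8 * (c * |x| * |P.ψx x t|)) := by ring
        _ ≤ P.ρ x t * (1 + 16 * (c * |x| * |P.ψx x t|) ^ 2) := by
            gcongr
            nlinarith [sq_nonneg (4 * (c * |x| * |P.ψx x t|) - 1)]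
        _ = P.ρ x t + 16 * (c ^ 2 * x ^ 2 * (P.ρ x t * P.ψx x t ^ 2)) := by
            rw [mul_pow, mul_pow, sq_abs, sq_abs]; ring
        _ ≤ _ := by
            gcongr
            · linarith
            · nlinarith
    have hJ0 : 0 ≤ ∫ x in (-R)..R, c ^ 2 * (1 + x ^ 2) *
        (P.ρ x t * (P.ψx x t ^ 2 + P.ρ x t)) :=
      intervalIntegral.integral_nonneg hRR fun x _ => by
        have := P.ρ_pos x t
        positivity
    have hF0 := (hF01 t (Ioo_subset_Icc_self ht)).1
    rw [h2]
    set J := ∫ x in (-R)..R, c ^ 2 * (1 + x ^ 2) * (P.ρ x t * (P.ψx x t ^ 2 + P.ρ x t))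
    set M := ∫ x in (-R)..R, P.ρ x t
    set I := ∫ x in (-R)..R, cut c x * pf' k (P.logρ x t) * (P.ρ x t * P.logρx x t ^ 2)
    set E := ∫ x in (-R)..R, cut' c x * (Real.exp (P.logρ x t) * lgst k (P.logρ x t)) * P.ψx x t
    have ta := ht.1
    have tb := ht.2
    have hζ0 : 0 ≤ (t - a) * (b - t) := mul_nonneg (by linarith) (by linarith)
    have hζ1 : (t - a) * (b - t) ≤ 1 := mul_le_one₀ (by linarith) (by linarith) (by linarith)
    have hζ' : |b - t - (t - a)| ≤ 1 := by rw [abs_le]; constructor <;> linarith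
    have h4 : (b - t - (t - a)) * E ≤ M + 16 * J := by
      refine (le_abs_self _).trans ?_
      rw [abs_mul]
      exact (mul_le_of_le_one_left (abs_nonneg _) hζ').trans h3
    have h5 := mul_le_mul_of_nonneg_left h1 hζ0
    have h6 : (t - a) * (b - t) * (32 * J + 2 * ε ^ 2 * C * c ^ 2 * M) ≤
        32 * J + 2 * ε ^ 2 * C * c ^ 2 := by
      have e1 : 2 * ε ^ 2 * C * c ^ 2 * M ≤ 2 * ε ^ 2 * C * c ^ 2 := mul_le_of_le_one_right hD0 hM
      calc (t - a) * (b - t) * (32 * J + 2 * ε ^ 2 * C * c ^ 2 * M)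
          ≤ (t - a) * (b - t) * (32 * J + 2 * ε ^ 2 * C * c ^ 2) := by gcongr
        _ ≤ _ := mul_le_of_le_one_left (by positivity) hζ1
    rw [hD]
    linear_combination h4 + h5 + h6 + hM + 2 * hF0

end MFGPair

/-! ### Removal of the cutoff and the uniform gradient estimate. -/

theorem integral_symm_split {f : ℝ → ℝ} (hf : Continuous f) (S R : ℝ) :
    ∫ x in (-R)..R, f x =
      (∫ x in (-R)..(-S), f x) + (∫ x in (-S)..S, f x) + ∫ x in S..R, f x := by
  rw [intervalIntegral.integral_add_adjacent_intervals (hf.intervalIntegrable _ _)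
    (hf.intervalIntegrable _ _), intervalIntegral.integral_add_adjacent_intervals
    (hf.intervalIntegrable _ _) (hf.intervalIntegrable _ _)]

/-- If `Θ ≥ 0` is integrable on `[a, b] × ℝ`, then `c² (1 + x²)² Θ` is small on
`[a, b] × [-R, R]` for large `R`, where `c = 1 / (1 + R²)`. -/
theorem eventually_integral_sq_mul_le {Θ : ℝ → ℝ → ℝ} (hΘ : ContStrip 0 1 Θ)
    (hΘ0 : ∀ x t, 0 ≤ Θ x t) {a b K : ℝ} (ha : 0 < a) (hab : a ≤ b) (hb : b < 1)
    (hK : ∀ R, 0 ≤ R → ∫ t in a..b, ∫ x in (-R)..R, Θ x t ≤ K) {δ : ℝ} (hδ : 0 < δ) :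
    ∀ᶠ R in atTop, ∫ t in a..b, ∫ x in (-R)..R,
      ((1 + R ^ 2)⁻¹) ^ 2 * (1 + x ^ 2) ^ 2 * Θ x t ≤ δ := by
  set n : ℝ → ℝ := fun R => ∫ t in a..b, ∫ x in (-R)..R, Θ x t with hn
  have hmem : ∀ t ∈ Icc a b, t ∈ Ioo (0 : ℝ) 1 := fun t ht =>
    ⟨ha.trans_le ht.1, ht.2.trans_lt hb⟩
  have hbdd : BddAbove (n '' Ici 0) := ⟨K, by rintro _ ⟨R, hR, rfl⟩; exact hK R hR⟩
  -- `S` almost attains the supremum, so the part outside `[-S, S]` contributes at most `δ / 2`;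
  -- inside, the factor `c² (1 + S²)²` tends to zero.
  obtain ⟨_, ⟨S, hS, rfl⟩, hSδ⟩ := exists_lt_of_lt_csSup (s := n '' Ici 0)
    ⟨n 0, 0, self_mem_Ici, rfl⟩ (show sSup (n '' Ici 0) - δ / 2 < sSup (n '' Ici 0) by linarith)
  have hS : 0 ≤ S := hS
  have hK0 : 0 ≤ K := by
    have := hK 0 le_rfl
    simpa using this
  have hlim : Tendsto (fun R : ℝ => ((1 + R ^ 2)⁻¹) ^ 2 * ((1 + S ^ 2) ^ 2 * K)) atTop
      (𝓝 (0 ^ 2 * ((1 + S ^ 2) ^ 2 * K))) :=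
    ((tendsto_inv_atTop_zero.comp (tendsto_atTop_add_const_left _ 1
      (tendsto_pow_atTop two_ne_zero))).pow 2).mul_const _
  have hev := hlim.eventually (gt_mem_nhds (show 0 ^ 2 * ((1 + S ^ 2) ^ 2 * K) < δ / 2 by
    simpa using hδ))
  filter_upwards [hev, eventually_ge_atTop S] with R hR hSR
  have hRmax : n R ≤ sSup (n '' Ici 0) := le_csSup hbdd ⟨R, hS.trans hSR, rfl⟩
  set c := (1 + R ^ 2)⁻¹ with hc
  have hc0 : 0 ≤ c := by positivity
  have hcR : c * (1 + R ^ 2) = 1 := by rw [hc]; field_simp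
  have hw : ContStrip 0 1 fun x _ => c ^ 2 * (1 + x ^ 2) ^ 2 :=
    contStrip_of_continuous (by fun_prop)
  have hG : ContStrip 0 1 fun x t => c ^ 2 * (1 + x ^ 2) ^ 2 * Θ x t := hw.mul hΘ
  have i1 := intervalIntegrable_integral_strip hG (-R) R ha hab hb
  have i2 := intervalIntegrable_integral_strip hΘ (-R) R ha hab hb
  have i3 := intervalIntegrable_integral_strip hΘ (-S) S ha hab hb
  have key : ∫ t in a..b, ∫ x in (-R)..R, c ^ 2 * (1 + x ^ 2) ^ 2 * Θ x t ≤
      ∫ t in a..b, (c ^ 2 * (1 + S ^ 2) ^ 2 * (∫ x in (-S)..S, Θ x t) +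
        ((∫ x in (-R)..R, Θ x t) - ∫ x in (-S)..S, Θ x t)) := by
    refine intervalIntegral.integral_mono_on hab i1 ((i3.const_mul _).add (i2.sub i3))
      fun t ht => ?_
    have cG := hG.continuous_slice (hmem t ht)
    have cΘ := hΘ.continuous_slice (hmem t ht)
    rw [integral_symm_split cG S R, integral_symm_split cΘ S R]
    have hle : ∀ x ∈ Icc (-R) R, c ^ 2 * (1 + x ^ 2) ^ 2 * Θ x t ≤ Θ x t := by
      intro x hx
      have h1 : x ^ 2 ≤ R ^ 2 := sq_le_sq' hx.1 hx.2
      have h2 : c * (1 + x ^ 2) ≤ 1 := 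
        (mul_le_mul_of_nonneg_left (by linarith) hc0).trans_eq hcR
      have h3 : 0 ≤ c * (1 + x ^ 2) := by positivity
      rw [← mul_pow]
      exact mul_le_of_le_one_left (hΘ0 x t) (pow_le_one₀ h3 h2)
    have e1 := integral_mono_of_continuous cG cΘ (show -R ≤ -S by linarith) fun x hx =>
      hle x ⟨hx.1, by linarith [hx.2]⟩
    have e2 := integral_mono_of_continuous cG cΘ hSR fun x hx => hle x ⟨by linarith [hx.1], hx.2⟩
    have e3 := integral_mono_of_continuous cG
      (continuous_const.fun_mul cΘ : Continuous fun x => c ^ 2 * (1 + S ^ 2) ^ 2 * Θ x t)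
      (show -S ≤ S by linarith) fun x hx => by
        have h1 : x ^ 2 ≤ S ^ 2 := sq_le_sq' hx.1 hx.2
        have := hΘ0 x t
        gcongr
    rw [intervalIntegral.integral_const_mul] at e3
    linarith
  rw [intervalIntegral.integral_add (i3.const_mul _) (i2.sub i3),
    intervalIntegral.integral_sub i2 i3, intervalIntegral.integral_const_mul] at key
  have h1 : c ^ 2 * (1 + S ^ 2) ^ 2 * n S ≤ c ^ 2 * ((1 + S ^ 2) ^ 2 * K) := by
    rw [mul_assoc]
    have := hK S hS
    gcongr
  linarith

namespace MFGPair

variable {ε : ℝ} (P : MFGPair ε)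

/-- The a priori estimate, with a constant which depends on `k` only. -/
theorem weighted_gradient_estimate {k : ℝ} (hk0 : 0 < k) (hk : k < 1 / 2) {a b : ℝ} (ha : 0 < a)
    (hab : a ≤ b) (hb : b < 1) {r : ℝ} (hr : 0 ≤ r) :
    ∫ t in a..b, (t - a) * (b - t) * ∫ x in (-r)..r,
      lgw k (P.logρ x t) * (P.ρ x t * P.logρx x t) ^ 2 ≤ 16 / (k * (1 - k)) := by
  obtain ⟨C, hC0, hC⟩ := exists_quantum_lower_bound hk0 hk
  obtain ⟨K, -, hK⟩ := P.exists_energy_bound ha hab hb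
  have hℓ := P.logρ_reg
  have hψ := P.ψ_reg
  have hρ := P.ρ_reg
  have hψx : ∀ x t, 1 / 2 * (P.fx x t - P.gx x t) = P.ψx x t := fun x t => by unfold ψx; ring
  simp only [hψx] at hK
  have hΘ : ContStrip 0 1 fun x t => P.ρ x t * (P.ψx x t ^ 2 + P.ρ x t) / (1 + x ^ 2) :=
    (hρ.c.mul ((hψ.cx.pow 2).add hρ.c)).div (by fun_prop) fun p _ => (one_add_sq_pos p.1).ne'
  have hev1 := eventually_integral_sq_mul_le hΘ (fun x t => by
    have := P.ρ_pos x t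
    positivity) ha hab hb hK (show (0 : ℝ) < 1 / 100 by norm_num)
  have hlim : Tendsto (fun R : ℝ => (1 + R ^ 2)⁻¹) atTop (𝓝 0) :=
    tendsto_inv_atTop_zero.comp (tendsto_atTop_add_const_left _ 1
      (tendsto_pow_atTop two_ne_zero))
  have hev2 : ∀ᶠ R : ℝ in atTop, 2 * ε ^ 2 * C * ((1 + R ^ 2)⁻¹) ^ 2 < 1 / 2 :=
    ((hlim.pow 2).const_mul (2 * ε ^ 2 * C)).eventually (gt_mem_nhds (by norm_num))
  have hev3 : ∀ᶠ R : ℝ in atTop, 1 / 2 < (1 - (1 + R ^ 2)⁻¹ * (1 + r ^ 2)) ^ 4 :=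
    (((hlim.mul_const (1 + r ^ 2)).const_sub 1).pow 4).eventually (lt_mem_nhds (by norm_num))
  -- `R` may depend on `ε` and on the solution. For this `R` the right side is at most `3 + 1/2 +
  -- 48/100 < 4`, and the cutoff is at least `1/2` on `[-r, r]`, which gives `4 · 4 / (k (1 - k))`.
  obtain ⟨R, h1, h2, h3, hrR⟩ :=
    (hev1.and (hev2.and (hev3.and (eventually_ge_atTop r)))).exists
  have hR : 0 ≤ R := hr.trans hrR
  set c := (1 + R ^ 2)⁻¹ with hc
  have hc0 : 0 ≤ c := by positivity
  have hcR : c * (1 + R ^ 2) = 1 := by rw [hc]; field_simp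
  have key := P.cutoff_estimate hk0 hk hC0 hC hc0 hR hcR ha hab hb
  have hΘeq : ∀ x t, c ^ 2 * (1 + x ^ 2) ^ 2 * (P.ρ x t * (P.ψx x t ^ 2 + P.ρ x t) / (1 + x ^ 2)) =
      c ^ 2 * (1 + x ^ 2) * (P.ρ x t * (P.ψx x t ^ 2 + P.ρ x t)) := fun x t => by
    have := (one_add_sq_pos x).ne'
    field_simp
  simp only [hΘeq] at h1
  have hmem : ∀ t ∈ Icc a b, t ∈ Ioo (0 : ℝ) 1 := fun t ht =>
    ⟨ha.trans_le ht.1, ht.2.trans_lt hb⟩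
  have hIc : ContStrip 0 1 fun x t =>
      cut c x * pf' k (P.logρ x t) * (P.ρ x t * P.logρx x t ^ 2) :=
    ((contStrip_of_continuous (continuous_cut c)).mul
      ((continuous_pf' k).comp_continuousOn hℓ.c)).mul (hρ.c.mul (hℓ.cx.pow 2))
  have hBc : ContStrip 0 1 fun x t =>
      lgw k (P.logρ x t) * (P.ρ x t * P.logρx x t) ^ 2 :=
    ((continuous_lgw k).comp_continuousOn hℓ.c).mul ((hρ.c.mul hℓ.cx).pow 2)
  have hIi := intervalIntegrable_integral_strip hIc (-R) R ha hab hb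
  have hBi := intervalIntegrable_integral_strip hBc (-r) r ha hab hb
  have hk1 : 0 < 1 - k := by linarith
  have hle : k * (1 - k) / 4 * (∫ t in a..b, (t - a) * (b - t) * ∫ x in (-r)..r,
      lgw k (P.logρ x t) * (P.ρ x t * P.logρx x t) ^ 2) ≤
      ∫ t in a..b, (t - a) * (b - t) * (1 / 2 * ∫ x in (-R)..R,
        cut c x * pf' k (P.logρ x t) * (P.ρ x t * P.logρx x t ^ 2)) := by
    rw [← intervalIntegral.integral_const_mul]
    refine intervalIntegral.integral_mono_on hab
      ((hBi.continuousOn_mul (by fun_prop)).const_mul _)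
      ((hIi.const_mul (1 / 2)).continuousOn_mul (by fun_prop)) fun t ht => ?_
    have cI := hIc.continuous_slice (hmem t ht)
    have cB := hBc.continuous_slice (hmem t ht)
    have hI0 : ∀ x, 0 ≤ cut c x * pf' k (P.logρ x t) * (P.ρ x t * P.logρx x t ^ 2) := fun x => by
      have e1 := cut_nonneg c x
      have e2 := pf'_pos (y := P.logρ x t) hk0 hk
      have e3 := P.ρ_pos x t
      positivity
    have e1 : ∫ x in (-r)..r, cut c x * pf' k (P.logρ x t) * (P.ρ x t * P.logρx x t ^ 2) ≤
        ∫ x in (-R)..R, cut c x * pf' k (P.logρ x t) * (P.ρ x t * P.logρx x t ^ 2) :=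
      intervalIntegral.integral_mono_interval (by linarith) (by linarith) hrR
        (Eventually.of_forall hI0) (cI.intervalIntegrable _ _)
    have e2 := integral_mono_of_continuous (continuous_const.fun_mul cB :
      Continuous fun x => k * (1 - k) / 2 * (lgw k (P.logρ x t) * (P.ρ x t * P.logρx x t) ^ 2))
      cI (show -r ≤ r by linarith) fun x hx => by
        have hx2 : x ^ 2 ≤ r ^ 2 := sq_le_sq' hx.1 hx.2
        have f1 : 1 / 2 ≤ cut c x := by
          have hrR2 := pow_le_pow_left₀ hr hrR 2
          refine h3.le.trans ?_
          have f2 : c * (1 + r ^ 2) ≤ 1 := 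
        (mul_le_mul_of_nonneg_left (by linarith) hc0).trans_eq hcR
          unfold cut
          gcongr
        have f3 := pf'_lower (y := P.logρ x t) hk0
        rw [← P.ρ_eq_exp] at f3
        have f4 := P.ρ_pos x t
        have f5 := lgw_pos k (P.logρ x t)
        calc k * (1 - k) / 2 * (lgw k (P.logρ x t) * (P.ρ x t * P.logρx x t) ^ 2)
            = 1 / 2 * (k * (1 - k) * (P.ρ x t * lgw k (P.logρ x t))) *
              (P.ρ x t * P.logρx x t ^ 2) := by ring
          _ ≤ _ := by gcongr
    rw [intervalIntegral.integral_const_mul] at e2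
    have hζ0 : 0 ≤ (t - a) * (b - t) := mul_nonneg (by linarith [ht.1]) (by linarith [ht.2])
    have := mul_le_mul_of_nonneg_left (e2.trans e1) hζ0
    linarith
  rw [le_div_iff₀ (by positivity)]
  linarith

end MFGPair

/-! ### Hölder bounds on a time slice. -/

/-- The square root of `lgw`. -/
noncomputable def lgr (k y : ℝ) : ℝ := (Real.exp (-(k / 2 * y)) + Real.exp (k / 2 * y))⁻¹

theorem lgr_pos (k y : ℝ) : 0 < lgr k y := by unfold lgr; positivity

theorem continuous_lgr (k : ℝ) : Continuous (lgr k) := by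
  unfold lgr
  exact Continuous.inv₀ (by fun_prop) fun y => by positivity

theorem lgr_sq (k y : ℝ) : lgr k y ^ 2 = lgw k y := by
  have h : Real.exp (k * y) = Real.exp (k / 2 * y) ^ 2 := by
    rw [← Real.exp_nat_mul]; congr 1; push_cast; ring
  unfold lgr lgw lgst
  rw [h, Real.exp_neg]
  have := Real.exp_pos (k / 2 * y)
  field_simp
  ring

/-- The Cauchy–Schwarz inequality on an interval. -/
theorem sq_integral_le {g : ℝ → ℝ} (hg : Continuous g) {x y : ℝ} (hxy : x < y) :
    (∫ z in x..y, g z) ^ 2 ≤ (y - x) * ∫ z in x..y, g z ^ 2 := by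
  set I := ∫ z in x..y, g z with hI
  have hd : 0 < y - x := sub_pos.2 hxy
  set A := I / (y - x) with hA
  have h0 : 0 ≤ ∫ z in x..y, (g z - A) ^ 2 :=
    intervalIntegral.integral_nonneg hxy.le fun z _ => sq_nonneg _
  have h1 : ∫ z in x..y, (g z - A) ^ 2 =
      (∫ z in x..y, g z ^ 2) - 2 * A * I + (y - x) * A ^ 2 := by
    have e : ∀ z, (g z - A) ^ 2 = (g z ^ 2 - 2 * A * g z) + A ^ 2 := fun z => by ring
    simp only [e]
    rw [integral_add_of_continuous (by fun_prop) (by fun_prop),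
      integral_sub_of_continuous (by fun_prop) (by fun_prop), intervalIntegral.integral_const_mul,
      intervalIntegral.integral_const, smul_eq_mul]
  have h2 : (y - x) * A = I := by rw [hA]; field_simp
  have h3 : 0 ≤ (∫ z in x..y, g z ^ 2) - A * I := by
    have : (y - x) * A ^ 2 = A * I := by rw [← h2]; ring
    linarith
  have h4 := mul_nonneg hd.le h3
  have h5 : (y - x) * (A * I) = I ^ 2 := by rw [← h2]; ring
  linarith

/-- Lower bound for the increments of the antiderivative of `s ↦ s^{k/2} / (1 + s^k)`, in
logarithmic variables. -/
theorem increment_le_integral_lgr {k y₁ y₂ : ℝ} (hk : 0 < k) (h : y₁ < y₂) :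
    (Real.exp y₂ - Real.exp y₁) / 2 ≤
      (((Real.exp y₂ - Real.exp y₁) / 2) ^ (-(k / 2)) + Real.exp y₂ ^ (k / 2)) *
        ∫ z in y₁..y₂, lgr k z * Real.exp z := by
  set a := Real.exp y₁ with ha
  set b := Real.exp y₂ with hb
  have ha0 : 0 < a := Real.exp_pos _
  have hab : a < b := Real.exp_lt_exp.2 h
  have hδ : 0 < (b - a) / 2 := by linarith
  set D := ((b - a) / 2) ^ (-(k / 2)) + b ^ (k / 2) with hD
  have hD0 : 0 < D := by
    have := Real.rpow_pos_of_pos hδ (-(k / 2))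
    have := Real.rpow_pos_of_pos (ha0.trans hab) (k / 2)
    positivity
  -- Only the upper half of the increment is kept: there `(b - a) / 2 ≤ e^z ≤ b`, so the weight is
  -- at least `D⁻¹`, while half of the increment is still covered.
  set m := Real.log ((a + b) / 2) with hm
  have hmid : 0 < (a + b) / 2 := by linarith
  have hem : Real.exp m = (a + b) / 2 := Real.exp_log hmid
  have h1m : y₁ ≤ m := by rw [← Real.exp_le_exp, hem]; linarith
  have hm2 : m ≤ y₂ := by rw [← Real.exp_le_exp, hem]; linarith
  have cr := continuous_lgr k
  have e1 : ∫ z in m..y₂, lgr k z * Real.exp z ≤ ∫ z in y₁..y₂, lgr k z * Real.exp z :=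
    intervalIntegral.integral_mono_interval h1m hm2 le_rfl
      (Eventually.of_forall fun z => (mul_pos (lgr_pos k z) (Real.exp_pos z)).le)
      ((cr.fun_mul Real.continuous_exp).intervalIntegrable _ _)
  have e2 : ∫ z in m..y₂, D⁻¹ * Real.exp z ≤ ∫ z in m..y₂, lgr k z * Real.exp z := by
    refine integral_mono_of_continuous (by fun_prop) (by fun_prop) hm2 fun z hz => ?_
    have hz1 : (b - a) / 2 ≤ Real.exp z := by
      have := Real.exp_le_exp.2 hz.1
      rw [hem] at this
      linarith
    have hz2 : Real.exp z ≤ b := Real.exp_le_exp.2 hz.2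
    have f1 : Real.exp (-(k / 2 * z)) ≤ ((b - a) / 2) ^ (-(k / 2)) := by
      have : Real.exp (-(k / 2 * z)) = Real.exp z ^ (-(k / 2)) := by
        rw [← Real.exp_mul]; congr 1; ring
      rw [this]
      exact Real.rpow_le_rpow_of_nonpos hδ hz1 (by linarith)
    have f2 : Real.exp (k / 2 * z) ≤ b ^ (k / 2) := by
      have : Real.exp (k / 2 * z) = Real.exp z ^ (k / 2) := by
        rw [← Real.exp_mul]; congr 1; ring
      rw [this]
      exact Real.rpow_le_rpow (Real.exp_pos z).le hz2 (by linarith)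
    unfold lgr
    gcongr
    rw [hD]
    linarith
  rw [intervalIntegral.integral_const_mul, integral_exp, hem] at e2
  have e3 := mul_le_mul_of_nonneg_left (e2.trans e1) hD0.le
  have e4 : D * (D⁻¹ * (b - (a + b) / 2)) = (b - a) / 2 := by field_simp; ring
  rw [← hb, e4] at e3
  exact e3

section Slice

variable {ℓ ℓx : ℝ → ℝ} {k Z : ℝ}

/-- Modulus of continuity from the weighted gradient bound. -/
theorem sq_sub_le_of_weighted_gradient (hk : 0 < k) (hk2 : k < 1 / 2)
    (hℓ : ∀ x, HasDerivAt ℓ (ℓx x) x)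
    (hc : Continuous ℓx) (hB : ∀ n : ℕ, ∫ x in (-(n : ℝ))..n,
      lgw k (ℓ x) * (Real.exp (ℓ x) * ℓx x) ^ 2 ≤ Z) {x y : ℝ} (hxy : ℓ x < ℓ y) :
    (Real.exp (ℓ y) - Real.exp (ℓ x)) ^ 2 ≤ 16 * Z * |x - y| *
      ((Real.exp (ℓ y) - Real.exp (ℓ x)) ^ (-k) + Real.exp (ℓ y) ^ k) := by
  have cℓ : Continuous ℓ := continuous_iff_continuousAt.2 fun x => (hℓ x).continuousAt
  have cr : Continuous fun x => lgr k (ℓ x) := (continuous_lgr k).comp cℓ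
  set g : ℝ → ℝ := fun x => lgr k (ℓ x) * Real.exp (ℓ x) * ℓx x with hg
  have cg : Continuous g := by fun_prop
  -- The derivative of `Φ ∘ ℓ` is `g`, whose square is the weighted energy density. Cauchy–Schwarz
  -- makes `Φ ∘ ℓ` Hölder of exponent `1/2`, and `increment_le_integral_lgr` converts this into
  -- increments of the density.
  set Φ : ℝ → ℝ := fun u => ∫ z in (0 : ℝ)..u, lgr k z * Real.exp z with hΦ
  have cΦ : Continuous fun z => lgr k z * Real.exp z :=
    (continuous_lgr k).fun_mul Real.continuous_exp
  have hΦd : ∀ u, HasDerivAt Φ (lgr k u * Real.exp u) u := fun u =>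
    intervalIntegral.integral_hasDerivAt_right (cΦ.intervalIntegrable _ _)
      (cΦ.stronglyMeasurableAtFilter _ _) cΦ.continuousAt
  have hΦsub : ∀ u v, ∫ z in u..v, lgr k z * Real.exp z = Φ v - Φ u := fun u v =>
    intervalIntegral.integral_eq_sub_of_hasDerivAt (fun z _ => hΦd z)
      (cΦ.intervalIntegrable _ _)
  have hftc : ∀ u v, ∫ z in u..v, g z = Φ (ℓ v) - Φ (ℓ u) := fun u v =>
    intervalIntegral.integral_eq_sub_of_hasDerivAt (f := fun z => Φ (ℓ z))
      (fun z _ => (hΦd (ℓ z)).comp z (hℓ z)) (cg.intervalIntegrable _ _)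
  have hg2 : ∀ z, g z ^ 2 = lgw k (ℓ z) * (Real.exp (ℓ z) * ℓx z) ^ 2 := fun z => by
    rw [← lgr_sq]; simp only [hg]; ring
  have hB' : ∀ u v, u ≤ v → ∫ z in u..v, g z ^ 2 ≤ Z := by
    intro u v huv
    obtain ⟨n, hn⟩ := exists_nat_ge (max |u| |v|)
    refine le_trans ?_ (hB n)
    simp only [← hg2]
    exact intervalIntegral.integral_mono_interval
      (by have := (le_max_left _ _).trans hn; have := neg_abs_le u; linarith) huv
      ((le_abs_self v).trans ((le_max_right _ _).trans hn))
      (Eventually.of_forall fun z => sq_nonneg _) ((cg.pow 2).intervalIntegrable _ _)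
  have hΦ2 : (Φ (ℓ y) - Φ (ℓ x)) ^ 2 ≤ |x - y| * Z := by
    rcases lt_trichotomy x y with h | h | h
    · rw [← hftc, abs_sub_comm, abs_of_pos (sub_pos.2 h)]
      exact (sq_integral_le cg h).trans (mul_le_mul_of_nonneg_left (hB' _ _ h.le) (by linarith))
    · rw [h] at hxy
      exact absurd hxy (lt_irrefl _)
    · rw [← neg_sub, neg_sq, ← hftc, abs_of_pos (sub_pos.2 h)]
      exact (sq_integral_le cg h).trans (mul_le_mul_of_nonneg_left (hB' _ _ h.le) (by linarith))
  have key := increment_le_integral_lgr hk hxy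
  rw [hΦsub] at key
  have hlt : Real.exp (ℓ x) < Real.exp (ℓ y) := Real.exp_lt_exp.2 hxy
  have hb0 := Real.exp_pos (ℓ y)
  set b := Real.exp (ℓ y)
  set δ := b - Real.exp (ℓ x) with hδ
  have hδ0 : 0 < δ := by linarith
  set u := (δ / 2) ^ (-(k / 2)) with hu
  set v := b ^ (k / 2) with hv
  have hu2 : u ^ 2 ≤ 2 * δ ^ (-k) := by
    have e1 : u ^ 2 = (δ / 2) ^ (-k) := by
      rw [hu, ← Real.rpow_natCast, ← Real.rpow_mul (by positivity)]; congr 1; push_cast; ring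
    have e2 : (2 : ℝ) ^ k ≤ 2 := by
      calc (2 : ℝ) ^ k ≤ 2 ^ (1 : ℝ) := Real.rpow_le_rpow_of_exponent_le one_le_two (by linarith)
        _ = 2 := Real.rpow_one 2
    rw [e1, Real.div_rpow hδ0.le zero_le_two, Real.rpow_neg zero_le_two, div_inv_eq_mul, mul_comm]
    have := Real.rpow_pos_of_pos hδ0 (-k)
    gcongr
  have hv2 : v ^ 2 = b ^ k := by
    rw [hv, ← Real.rpow_natCast, ← Real.rpow_mul hb0.le]; congr 1; push_cast; ring
  have hbk := Real.rpow_pos_of_pos hb0 k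
  have hδk := Real.rpow_pos_of_pos hδ0 (-k)
  have h1 : (δ / 2) ^ 2 ≤ ((u + v) * (Φ (ℓ y) - Φ (ℓ x))) ^ 2 :=
    pow_le_pow_left₀ (by positivity) key 2
  have h2 : ((u + v) * (Φ (ℓ y) - Φ (ℓ x))) ^ 2 ≤ (4 * δ ^ (-k) + 4 * b ^ k) * (|x - y| * Z) := by
    rw [mul_pow]
    have : (u + v) ^ 2 ≤ 4 * δ ^ (-k) + 4 * b ^ k := by nlinarith [sq_nonneg (u - v)]
    gcongr
  linear_combination 4 * h1 + 4 * h2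

/-- Sup bound from the mass and the weighted gradient bound. -/
theorem rpow_le_of_weighted_gradient (hk : 0 < k) (hk2 : k < 1 / 2) (hZ : 1 ≤ Z)
    (hℓ : ∀ x, HasDerivAt ℓ (ℓx x) x)
    (hc : Continuous ℓx) (hB : ∀ n : ℕ, ∫ x in (-(n : ℝ))..n,
      lgw k (ℓ x) * (Real.exp (ℓ x) * ℓx x) ^ 2 ≤ Z)
    (hm : ∀ l r, l ≤ r → ∫ x in l..r, Real.exp (ℓ x) ≤ 1) (x : ℝ) :
    Real.exp (ℓ x) ^ (3 - k) ≤ 576 * Z := by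
  have cℓ : Continuous ℓ := continuous_iff_continuousAt.2 fun x => (hℓ x).continuousAt
  have hb0 := Real.exp_pos (ℓ x)
  rcases le_or_gt (Real.exp (ℓ x)) 1 with h1 | h1
  · have := Real.rpow_le_one hb0.le h1 (show 0 ≤ 3 - k by linarith)
    linarith
  -- If the density stayed above half its value at `x` over the length `3 / ρ(x)`, its mass there
  -- would be at least `3/2`.
  obtain ⟨y, hy, hylt⟩ : ∃ y ∈ Icc x (x + 3 / Real.exp (ℓ x)),
      Real.exp (ℓ y) < Real.exp (ℓ x) / 2 := by
    by_contra! hcon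
    have hd : 0 < 3 / Real.exp (ℓ x) := by positivity
    have e1 := integral_mono_of_continuous continuous_const (by fun_prop)
      (show x ≤ x + 3 / Real.exp (ℓ x) by linarith) hcon
    have e2 := e1.trans (hm _ _ (by linarith))
    rw [intervalIntegral.integral_const, smul_eq_mul, add_sub_cancel_left] at e2
    have e3 : 3 / Real.exp (ℓ x) * (Real.exp (ℓ x) / 2) = 3 / 2 := by field_simp
    linarith
  have hlt : ℓ y < ℓ x := by rw [← Real.exp_lt_exp]; linarith
  have key := sq_sub_le_of_weighted_gradient hk hk2 hℓ hc hB hlt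
  have hy0 := Real.exp_pos (ℓ y)
  set b := Real.exp (ℓ x)
  set δ := b - Real.exp (ℓ y)
  have hδ : b / 2 ≤ δ := by simp only [δ]; linarith
  have hδ0 : 0 < δ := by linarith
  have hbk := Real.rpow_pos_of_pos hb0 k
  have hδk : δ ^ (-k) ≤ 2 * b ^ k := by
    have e0 : δ ^ (-k) ≤ (b / 2) ^ (-k) :=
      Real.rpow_le_rpow_of_nonpos (by positivity) hδ (by linarith)
    have e1 : (1 / 2 : ℝ) ^ (-k) ≤ 2 := by
      rw [one_div, Real.inv_rpow zero_le_two, ← Real.rpow_neg zero_le_two, neg_neg]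
      calc (2 : ℝ) ^ k ≤ 2 ^ (1 : ℝ) := Real.rpow_le_rpow_of_exponent_le one_le_two (by linarith)
        _ = 2 := Real.rpow_one 2
    have e2 : (b / 2) ^ (-k) = (1 / 2 : ℝ) ^ (-k) * b ^ (-k) := by
      rw [← Real.mul_rpow (by norm_num) hb0.le]; congr 1; ring
    have e3 : b ^ (-k) ≤ b ^ k := Real.rpow_le_rpow_of_exponent_le h1.le (by linarith)
    rw [e2] at e0
    refine e0.trans ?_
    have := Real.rpow_pos_of_pos hb0 (-k)
    gcongr
  have hd : |y - x| ≤ 3 / b := by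
    rw [abs_of_nonneg (by linarith [hy.1])]
    linarith [hy.2]
  have h2 : b ^ 2 ≤ 4 * (16 * Z * (3 / b) * (3 * b ^ k)) := by
    calc b ^ 2 ≤ 4 * δ ^ 2 := by nlinarith
      _ ≤ 4 * (16 * Z * |y - x| * (δ ^ (-k) + b ^ k)) := by gcongr
      _ ≤ _ := by
        have : δ ^ (-k) + b ^ k ≤ 3 * b ^ k := by linarith
        have : 0 ≤ δ ^ (-k) + b ^ k := by positivity
        gcongr
  have h3 : b ^ 3 ≤ 576 * Z * b ^ k := by
    have : 4 * (16 * Z * (3 / b) * (3 * b ^ k)) = 576 * Z * b ^ k / b := by field_simp; ring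
    rw [this, le_div_iff₀ hb0] at h2
    linarith [h2]
  rw [Real.rpow_sub hb0, div_le_iff₀ hbk]
  exact_mod_cast h3

/-- Interpolation: Hölder bound with exponent `α` of the increments. -/
theorem increment_le_of_sq_le {α δ d M : ℝ} (hα : 0 < α) (hk : 0 < k)
    (hk2 : k ≤ 1 / 2 - α) (hM : 1 ≤ M) (hZ0 : 0 < Z) (hZ : Z ≤ M ^ (3 - k)) (hδ : 0 < δ) (hδM : δ ≤ M)
    (hd : 0 < d) (h : δ ^ 2 ≤ 16 * Z * d * (δ ^ (-k) + M ^ k)) :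
    δ ≤ 32 * M ^ (1 + α) * d ^ α := by
  have hM0 : 0 < M := by linarith
  have h32 : (32 : ℝ) ^ α ≤ 32 := by
    calc (32 : ℝ) ^ α ≤ 32 ^ (1 : ℝ) :=
          Real.rpow_le_rpow_of_exponent_le (by norm_num) (by linarith)
      _ = 32 := Real.rpow_one _
  have hdα := Real.rpow_pos_of_pos hd α
  have hMα := Real.rpow_pos_of_pos hM0 (1 + α)
  have hMk := Real.rpow_pos_of_pos hM0 k
  have hδk := Real.rpow_pos_of_pos hδ (-k)
  -- When `M^k` dominates, the estimate is raised to the power `α` and the rest is supplied by `δ^(1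
  -- - 2α) ≤ M^(1 - 2α)`. When `δ^(-k)` dominates, `δ ≤ 1` because `M ≥ 1`, and excess powers of `δ`
  -- are dropped.
  rcases le_total (δ ^ (-k)) (M ^ k) with hc | hc
  · have h1 : δ ^ 2 ≤ 32 * d * M ^ (3 : ℝ) := by
      calc δ ^ 2 ≤ 16 * Z * d * (M ^ k + M ^ k) := h.trans (by gcongr)
        _ = 32 * d * (Z * M ^ k) := by ring
        _ ≤ 32 * d * (M ^ (3 - k) * M ^ k) := by gcongr
        _ = _ := by rw [← Real.rpow_add hM0]; congr 2; ring
    have h2 : (δ ^ 2) ^ α ≤ (32 * d * M ^ (3 : ℝ)) ^ α :=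
      Real.rpow_le_rpow (by positivity) h1 hα.le
    rw [Real.mul_rpow (by positivity) (by positivity), Real.mul_rpow (by positivity) hd.le,
      ← Real.rpow_mul hM0.le, ← Real.rpow_natCast, ← Real.rpow_mul hδ.le] at h2
    have h3 : δ ^ (1 - 2 * α) ≤ M ^ (1 - 2 * α) := Real.rpow_le_rpow hδ.le hδM (by linarith)
    have h4 : δ = δ ^ (((2 : ℕ) : ℝ) * α) * δ ^ (1 - 2 * α) := by
      rw [← Real.rpow_add hδ]
      push_cast
      rw [show 2 * α + (1 - 2 * α) = 1 by ring, Real.rpow_one]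
    have p1 := Real.rpow_pos_of_pos hδ (1 - 2 * α)
    calc δ = δ ^ (((2 : ℕ) : ℝ) * α) * δ ^ (1 - 2 * α) := h4
      _ ≤ (32 ^ α * d ^ α * M ^ (3 * α)) * M ^ (1 - 2 * α) := by gcongr
      _ = 32 ^ α * (M ^ (3 * α) * M ^ (1 - 2 * α)) * d ^ α := by ring
      _ = 32 ^ α * M ^ (1 + α) * d ^ α := by
        rw [← Real.rpow_add hM0]; congr 3; ring
      _ ≤ _ := by gcongr
  · have hδ1 : δ ≤ 1 := by
      by_contra! hcon
      have e1 : δ ^ (-k) < 1 := Real.rpow_lt_one_of_one_lt_of_neg hcon (by linarith)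
      have e2 : 1 ≤ M ^ k := Real.one_le_rpow hM hk.le
      linarith
    have h1 : δ ^ (2 + k) ≤ 32 * d * M ^ (3 - k) := by
      have e1 : δ ^ 2 ≤ 32 * d * M ^ (3 - k) * δ ^ (-k) := by
        calc δ ^ 2 ≤ 16 * Z * d * (δ ^ (-k) + δ ^ (-k)) := h.trans (by gcongr)
          _ = 32 * d * Z * δ ^ (-k) := by ring
          _ ≤ _ := by gcongr
      rw [Real.rpow_neg hδ.le, ← div_eq_mul_inv, le_div_iff₀ (Real.rpow_pos_of_pos hδ k)] at e1
      rw [Real.rpow_add hδ]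
      exact_mod_cast e1
    have h2 : (δ ^ (2 + k)) ^ α ≤ (32 * d * M ^ (3 - k)) ^ α :=
      Real.rpow_le_rpow (by positivity) h1 hα.le
    rw [Real.mul_rpow (by positivity) (by positivity), Real.mul_rpow (by positivity) hd.le,
      ← Real.rpow_mul hM0.le, ← Real.rpow_mul hδ.le] at h2
    -- The requirement `(2 + k) α ≤ 1` follows from `k ≤ 1/2 - α` and `(1 - 2α)(1 - α/2) ≥ 0`.
    have h3 : δ ≤ δ ^ ((2 + k) * α) := by
      conv_lhs => rw [← Real.rpow_one δ]
      exact Real.rpow_le_rpow_of_exponent_ge hδ hδ1 (by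
        nlinarith [mul_nonneg (show 0 ≤ 1 - 2 * α by linarith) (show 0 ≤ 1 - α / 2 by linarith)])
    have h5 : M ^ ((3 - k) * α) ≤ M ^ (1 + α) :=
      Real.rpow_le_rpow_of_exponent_le hM (by nlinarith)
    calc δ ≤ 32 ^ α * d ^ α * M ^ ((3 - k) * α) := h3.trans h2
      _ ≤ 32 * d ^ α * M ^ (1 + α) := by gcongr
      _ = _ := by ring

/-- Hölder bound of a density in terms of its weighted gradient. -/
theorem abs_sub_le_of_weighted_gradient {α : ℝ} (hα : 0 < α) (hk : 0 < k)
    (hkα : k ≤ 1 / 2 - α) (hZ : 1 ≤ Z)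
    (hℓ : ∀ x, HasDerivAt ℓ (ℓx x) x)
    (hc : Continuous ℓx) (hB : ∀ n : ℕ, ∫ x in (-(n : ℝ))..n,
      lgw k (ℓ x) * (Real.exp (ℓ x) * ℓx x) ^ 2 ≤ Z)
    (hm : ∀ l r, l ≤ r → ∫ x in l..r, Real.exp (ℓ x) ≤ 1) (x y : ℝ) :
    |Real.exp (ℓ x) - Real.exp (ℓ y)| ≤
      18432 * Z ^ ((1 + α) / (3 - k)) * |x - y| ^ α := by
  have hk2 : k < 1 / 2 := by linarith
  have h3k : 0 < 3 - k := by linarith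
  have hZ0 : 0 < Z := by linarith
  set M := (576 * Z) ^ (1 / (3 - k)) with hM
  have hM1 : 1 ≤ M := Real.one_le_rpow (by linarith) (by positivity)
  have hMp : M ^ (3 - k) = 576 * Z := by
    rw [hM, ← Real.rpow_mul (by positivity), one_div_mul_cancel h3k.ne', Real.rpow_one]
  have hle : ∀ z, Real.exp (ℓ z) ≤ M := by
    intro z
    have h := rpow_le_of_weighted_gradient hk hk2 hZ hℓ hc hB hm z
    rw [← hMp] at h
    exact (Real.rpow_le_rpow_iff (Real.exp_pos _).le (by linarith) h3k).1 h
  have hMα : M ^ (1 + α) ≤ 576 * Z ^ ((1 + α) / (3 - k)) := by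
    rw [hM, ← Real.rpow_mul (by positivity), one_div_mul_eq_div,
      Real.mul_rpow (by norm_num) hZ0.le]
    have : (576 : ℝ) ^ ((1 + α) / (3 - k)) ≤ 576 := by
      calc (576 : ℝ) ^ ((1 + α) / (3 - k)) ≤ 576 ^ (1 : ℝ) :=
            Real.rpow_le_rpow_of_exponent_le (by norm_num)
              ((div_le_one h3k).2 (by linarith))
        _ = 576 := Real.rpow_one _
    gcongr
  have main : ∀ x y, ℓ x < ℓ y → |Real.exp (ℓ x) - Real.exp (ℓ y)| ≤
      18432 * Z ^ ((1 + α) / (3 - k)) * |x - y| ^ α := by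
    intro x y hxy
    have hlt : Real.exp (ℓ x) < Real.exp (ℓ y) := Real.exp_lt_exp.2 hxy
    have hne : x ≠ y := fun h => by rw [h] at hxy; exact lt_irrefl _ hxy
    have hd : 0 < |x - y| := abs_pos.2 (sub_ne_zero.2 hne)
    rw [abs_sub_comm, abs_of_pos (sub_pos.2 hlt)]
    have h1 := sq_sub_le_of_weighted_gradient hk hk2 hℓ hc hB hxy
    have h2 : (Real.exp (ℓ y) - Real.exp (ℓ x)) ^ 2 ≤ 16 * Z * |x - y| *
        ((Real.exp (ℓ y) - Real.exp (ℓ x)) ^ (-k) + M ^ k) := by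
      refine h1.trans ?_
      have := hle y
      gcongr
    have hx0 := Real.exp_pos (ℓ x)
    have h3 := increment_le_of_sq_le hα hk hkα hM1 hZ0 (by linarith) (sub_pos.2 hlt)
      (by linarith [hle y]) hd h2
    refine h3.trans ?_
    have hdα := Real.rpow_nonneg hd.le α
    calc 32 * M ^ (1 + α) * |x - y| ^ α
        ≤ 32 * (576 * Z ^ ((1 + α) / (3 - k))) * |x - y| ^ α := by gcongr
      _ = _ := by ring
  rcases lt_trichotomy (ℓ x) (ℓ y) with h | h | h
  · exact main x y h
  · rw [h, sub_self, abs_zero]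
    positivity
  · rw [abs_sub_comm, abs_sub_comm x y]
    exact main y x h

end Slice

/-! ### Integration in time. -/

/-- Young's inequality in the form used to interpolate in time. -/
theorem rpow_le_mul_add_rpow {Z q s : ℝ} (hZ : 0 < Z) (hq0 : 0 ≤ q) (hq1 : q < 1) (hs : 0 < s) :
    Z ^ q ≤ s * Z + s ^ (-(q / (1 - q))) := by
  have h1q : 0 < 1 - q := by linarith
  have hp := Real.rpow_pos_of_pos hs (-(q / (1 - q)))
  rcases le_total (Z ^ q) (s * Z) with h | h
  · linarith
  have h3 : Z ^ (1 - q) ≤ s⁻¹ := by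
    rw [Real.rpow_sub hZ, Real.rpow_one, div_le_iff₀ (Real.rpow_pos_of_pos hZ q),
      inv_mul_eq_div, le_div_iff₀ hs]
    linarith
  have h4 := Real.rpow_le_rpow (by positivity) h3 (div_nonneg hq0 h1q.le)
  rw [← Real.rpow_mul hZ.le, mul_div_cancel₀ _ h1q.ne', Real.inv_rpow hs.le,
    ← Real.rpow_neg hs.le] at h4
  have : 0 < s * Z := by positivity
  linarith

theorem eHolderNorm_le_of_abs_sub_le {f : ℝ → ℝ} {α : ℝ≥0} {C : ℝ}
    (h : ∀ x y, |f x - f y| ≤ C * |x - y| ^ (α : ℝ)) (hC : 0 ≤ C) :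
    eHolderNorm α f ≤ ENNReal.ofReal C := by
  refine HolderWith.eHolderNorm_le (C := C.toNNReal) fun x y => ?_
  rw [edist_dist, edist_dist, Real.dist_eq, Real.dist_eq,
    ENNReal.ofReal_rpow_of_nonneg (abs_nonneg _) α.coe_nonneg]
  change _ ≤ ENNReal.ofReal C * _
  rw [← ENNReal.ofReal_mul hC]
  exact ENNReal.ofReal_le_ofReal (h x y)

namespace MFGPair

variable {ε : ℝ} (P : MFGPair ε)

/-- The weighted energy `∫ ρ^k (1 + ρ^k)⁻² ρ_x² dx`, as an increasing limit. -/
noncomputable def gradEnergy (k t : ℝ) : ℝ≥0∞ :=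
  ⨆ n : ℕ, ENNReal.ofReal (∫ x in (-(n : ℝ))..n,
    lgw k (P.logρ x t) * (P.ρ x t * P.logρx x t) ^ 2)

/-- The slice estimate with `k = 1/2 - α` and `Z = 1 + gradEnergy`, followed by Young's inequality
with parameter `1 - t`, the weight for which the energy is integrable up to the final time. -/
theorem eHolderNorm_le {α : ℝ≥0} (hα0 : 0 < α) (hα : α < 1 / 2) {t : ℝ}
    (ht : t ∈ Ioo (0 : ℝ) 1) :
    eHolderNorm α (fun x => P.ρ x t) ≤ ENNReal.ofReal 18432 *
      (1 + ENNReal.ofReal (1 - t) * P.gradEnergy (1 / 2 - α) t +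
        ENNReal.ofReal ((1 - t) ^ (-((1 + (α : ℝ)) / (3 - (1 / 2 - α)) /
          (1 - (1 + (α : ℝ)) / (3 - (1 / 2 - α))))))) := by
  have ha0 : (0 : ℝ) < α := hα0
  have ha : (α : ℝ) < 1 / 2 := by exact_mod_cast hα
  set a : ℝ := (α : ℝ) with haα
  set k : ℝ := 1 / 2 - a with hk
  set q : ℝ := (1 + a) / (3 - k) with hq
  have hk0 : 0 < k := by linarith
  have h3k : 0 < 3 - k := by linarith
  have hq0 : 0 ≤ q := by positivity
  have hq1 : q < 1 := by rw [hq, div_lt_one h3k]; linarith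
  have hs : 0 < 1 - t := sub_pos.2 ht.2
  -- Finiteness of the energy holds only for almost every time; where it fails the right side is
  -- infinite.
  by_cases hE : P.gradEnergy k t = ⊤
  · rw [hE, ENNReal.mul_top (by simpa using hs), add_top, top_add, ENNReal.mul_top (by norm_num)]
    exact le_top
  set Z := 1 + (P.gradEnergy k t).toReal with hZ
  have hE0 : 0 ≤ (P.gradEnergy k t).toReal := ENNReal.toReal_nonneg
  have hZ1 : 1 ≤ Z := by linarith
  have hB : ∀ n : ℕ, ∫ x in (-(n : ℝ))..n,
      lgw k (P.logρ x t) * (Real.exp (P.logρ x t) * P.logρx x t) ^ 2 ≤ Z := by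
    intro n
    simp only [← P.ρ_eq_exp]
    have h1 : ENNReal.ofReal (∫ x in (-(n : ℝ))..n,
        lgw k (P.logρ x t) * (P.ρ x t * P.logρx x t) ^ 2) ≤ P.gradEnergy k t :=
      le_iSup (fun n : ℕ => ENNReal.ofReal (∫ x in (-(n : ℝ))..n,
        lgw k (P.logρ x t) * (P.ρ x t * P.logρx x t) ^ 2)) n
    have h2 := (ENNReal.ofReal_le_iff_le_toReal hE).1 h1
    linarith
  have hm : ∀ l r, l ≤ r → ∫ x in l..r, Real.exp (P.logρ x t) ≤ 1 := by
    simp only [← P.ρ_eq_exp]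
    exact P.mass_le t ht
  have key := abs_sub_le_of_weighted_gradient ha0 hk0 le_rfl hZ1
    (fun x => P.logρ_reg.x x t ht) (P.logρ_reg.cx.continuous_slice ht) hB hm
  simp only [← P.ρ_eq_exp] at key
  refine (eHolderNorm_le_of_abs_sub_le key (by positivity)).trans ?_
  have hy := rpow_le_mul_add_rpow (show 0 < Z by linarith) hq0 hq1 hs
  have hp := Real.rpow_pos_of_pos hs (-(q / (1 - q)))
  have h1 : Z ^ q ≤ 1 + (1 - t) * (P.gradEnergy k t).toReal + (1 - t) ^ (-(q / (1 - q))) := by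
    have : (1 - t) * Z = (1 - t) + (1 - t) * (P.gradEnergy k t).toReal := by rw [hZ]; ring
    linarith [ht.1]
  rw [ENNReal.ofReal_mul (by norm_num)]
  refine mul_le_mul_right ((ENNReal.ofReal_le_ofReal h1).trans ?_) _
  rw [ENNReal.ofReal_add (by positivity) hp.le, ENNReal.ofReal_add one_pos.le (by positivity),
    ENNReal.ofReal_one, ENNReal.ofReal_mul hs.le, ENNReal.ofReal_toReal hE]

theorem contStrip_gradEnergy (k : ℝ) : ContStrip 0 1 fun x t =>
    lgw k (P.logρ x t) * (P.ρ x t * P.logρx x t) ^ 2 :=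
  ((continuous_lgw k).comp_continuousOn P.logρ_reg.c).mul ((P.ρ_reg.c.mul P.logρ_reg.cx).pow 2)

theorem gradEnergy_integrand_nonneg (k x t : ℝ) :
    0 ≤ lgw k (P.logρ x t) * (P.ρ x t * P.logρx x t) ^ 2 :=
  mul_nonneg (lgw_pos k _).le (sq_nonneg _)

/-- The a priori estimate is used on `[θ/2, b]`. For `θ < t < 2b - 1` one has `t - θ/2 ≥ θ/2` and `b
- t ≥ (1 - t) / 2`, so the time weight dominates `(θ / 4)(1 - t)`. -/
theorem setLIntegral_le {k θ : ℝ} (hk0 : 0 < k) (hk : k < 1 / 2) (hθ : 0 < θ) {b r : ℝ}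
    (hb0 : 1 / 2 ≤ b) (hb1 : b < 1) (hθ1 : θ < 1) (hr : 0 ≤ r) :
    ∫⁻ t in Ioo θ (2 * b - 1), ENNReal.ofReal (1 - t) * ENNReal.ofReal (∫ x in (-r)..r,
      lgw k (P.logρ x t) * (P.ρ x t * P.logρx x t) ^ 2) ≤
      ENNReal.ofReal (4 / θ * (16 / (k * (1 - k)))) := by
  have ha : 0 < θ / 2 := by positivity
  have hab : θ / 2 ≤ b := by linarith
  set G : ℝ → ℝ := fun t => ∫ x in (-r)..r,
    lgw k (P.logρ x t) * (P.ρ x t * P.logρx x t) ^ 2 with hG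
  have hG0 : ∀ t, 0 ≤ G t := fun t =>
    intervalIntegral.integral_nonneg (by linarith) fun x _ => P.gradEnergy_integrand_nonneg k x t
  have hGi : IntervalIntegrable G volume (θ / 2) b :=
    intervalIntegrable_integral_strip (P.contStrip_gradEnergy k) (-r) r ha hab hb1
  have hHi : IntervalIntegrable (fun t => 4 / θ * ((t - θ / 2) * (b - t) * G t)) volume
      (θ / 2) b := (hGi.continuousOn_mul (by fun_prop)).const_mul _
  have key := P.weighted_gradient_estimate hk0 hk ha hab hb1 hr
  have h1 : ∫⁻ t in Ioc (θ / 2) b, ENNReal.ofReal (4 / θ * ((t - θ / 2) * (b - t) * G t)) ≤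
      ENNReal.ofReal (4 / θ * (16 / (k * (1 - k)))) := by
    rw [← ofReal_integral_eq_lintegral_ofReal
      ((intervalIntegrable_iff_integrableOn_Ioc_of_le hab).1 hHi)]
    · rw [← intervalIntegral.integral_of_le hab, intervalIntegral.integral_const_mul]
      exact ENNReal.ofReal_le_ofReal (mul_le_mul_of_nonneg_left key (by positivity))
    · filter_upwards [ae_restrict_mem measurableSet_Ioc] with t ht
      have e1 : 0 ≤ (t - θ / 2) * (b - t) := mul_nonneg (by linarith [ht.1]) (by linarith [ht.2])
      have e2 := hG0 t
      change 0 ≤ 4 / θ * ((t - θ / 2) * (b - t) * G t)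
      positivity
  refine le_trans ?_ h1
  refine le_trans (setLIntegral_mono' measurableSet_Ioo fun t ht => ?_)
    (lintegral_mono_set (fun t ht => ⟨by linarith [ht.1], by linarith [ht.2]⟩ :
      Ioo θ (2 * b - 1) ⊆ Ioc (θ / 2) b))
  rw [← ENNReal.ofReal_mul (by linarith [ht.2])]
  refine ENNReal.ofReal_le_ofReal ?_
  rw [← mul_assoc]
  refine mul_le_mul_of_nonneg_right ?_ (hG0 t)
  have e1 : θ / 2 ≤ t - θ / 2 := by linarith [ht.1]
  have e2 : (1 - t) / 2 ≤ b - t := by linarith [ht.2]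
  have e3 : θ / 2 * ((1 - t) / 2) ≤ (t - θ / 2) * (b - t) := by
    have : 0 ≤ 1 - t := by linarith [ht.2]
    gcongr
    linarith
  calc 1 - t = 4 / θ * (θ / 2 * ((1 - t) / 2)) := by field_simp; ring
    _ ≤ _ := by gcongr

/-- Monotone convergence, with the space interval growing to the line and the time interval to `(θ,
1)` along the same index, since the bound of `setLIntegral_le` depends on neither. -/
theorem lintegral_gradEnergy_le {k θ : ℝ} (hk0 : 0 < k) (hk : k < 1 / 2) (hθ : 0 < θ)
    (hθ1 : θ < 1) :
    ∫⁻ t in Ioo θ 1, ENNReal.ofReal (1 - t) * P.gradEnergy k t ≤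
      ENNReal.ofReal (4 / θ * (16 / (k * (1 - k)))) := by
  set G : ℕ → ℝ → ℝ := fun n t => ∫ x in (-(n : ℝ))..n,
    lgw k (P.logρ x t) * (P.ρ x t * P.logρx x t) ^ 2 with hG
  -- Chosen so that `2 b n - 1 = 1 - 1 / (n + 1)`, which increases to `1`.
  set b : ℕ → ℝ := fun n => 1 - 1 / (2 * ((n : ℝ) + 1)) with hb
  have hb1 : ∀ n, b n < 1 := fun n => by
    have : 0 < 1 / (2 * ((n : ℝ) + 1)) := by positivity
    simp only [hb]; linarith
  have hb2 : ∀ n, 2 * b n - 1 = 1 - 1 / ((n : ℝ) + 1) := fun n => by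
    simp only [hb]; field_simp; ring
  have hb0 : ∀ n, 1 / 2 ≤ b n := fun n => by
    have : 1 / ((n : ℝ) + 1) ≤ 1 := by
      rw [div_le_one (by positivity)]
      linarith [n.cast_nonneg (α := ℝ)]
    linarith [hb2 n]
  set F : ℕ → ℝ → ℝ≥0∞ := fun n => (Ioo θ (2 * b n - 1)).indicator fun t =>
    ENNReal.ofReal (1 - t) * ENNReal.ofReal (G n t) with hF
  have hmeas : ∀ n, AEMeasurable (F n) (volume.restrict (Ioo θ 1)) := by
    intro n
    refine AEMeasurable.restrict ?_
    rw [aemeasurable_indicator_iff measurableSet_Ioo]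
    have hc : ContinuousOn (G n) (Ioo θ (2 * b n - 1)) :=
      (continuousOn_integral_strip (P.contStrip_gradEnergy k) _ _).mono fun t ht =>
        ⟨hθ.trans ht.1, by linarith [ht.2, hb1 n]⟩
    exact (Measurable.aemeasurable (by fun_prop)).mul
      (hc.aemeasurable measurableSet_Ioo).ennreal_ofReal
  have hmono : ∀ t, Monotone fun n => F n t := by
    intro t n m hnm
    have hnm' : (n : ℝ) ≤ m := Nat.cast_le.2 hnm
    simp only [hF]
    have hsub : Ioo θ (2 * b n - 1) ⊆ Ioo θ (2 * b m - 1) := by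
      refine Ioo_subset_Ioo_right ?_
      rw [hb2, hb2]
      gcongr
    by_cases htn : t ∈ Ioo θ (2 * b n - 1)
    · rw [indicator_of_mem htn, indicator_of_mem (hsub htn)]
      have ht : t ∈ Ioo (0 : ℝ) 1 := ⟨hθ.trans htn.1, by linarith [htn.2, hb1 n]⟩
      gcongr
      exact intervalIntegral.integral_mono_interval (by linarith)
        (by linarith [n.cast_nonneg (α := ℝ)]) hnm'
        (Eventually.of_forall fun x => P.gradEnergy_integrand_nonneg k x t)
        (((P.contStrip_gradEnergy k).continuous_slice ht).intervalIntegrable _ _)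
    · rw [indicator_of_notMem htn]
      exact zero_le
  have hsup : ∀ t ∈ Ioo θ 1, ENNReal.ofReal (1 - t) * P.gradEnergy k t ≤ ⨆ n, F n t := by
    intro t ht
    rw [gradEnergy, ENNReal.mul_iSup]
    refine iSup_le fun n => ?_
    obtain ⟨m, hm⟩ := exists_nat_one_div_lt (sub_pos.2 ht.2)
    refine le_iSup_of_le (max n m) ?_
    have htm : t ∈ Ioo θ (2 * b (max n m) - 1) := by
      refine ⟨ht.1, ?_⟩
      rw [hb2]
      have : 1 / (((max n m : ℕ) : ℝ) + 1) ≤ 1 / ((m : ℝ) + 1) := by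
        gcongr
        exact le_max_right _ _
      linarith
    have ht' : t ∈ Ioo (0 : ℝ) 1 := ⟨hθ.trans ht.1, ht.2⟩
    have hnm : (n : ℝ) ≤ (max n m : ℕ) := Nat.cast_le.2 (le_max_left _ _)
    simp only [hF]
    rw [indicator_of_mem htm]
    gcongr
    exact intervalIntegral.integral_mono_interval (by linarith)
      (by linarith [n.cast_nonneg (α := ℝ)]) hnm
      (Eventually.of_forall fun x => P.gradEnergy_integrand_nonneg k x t)
      (((P.contStrip_gradEnergy k).continuous_slice ht').intervalIntegrable _ _)
  refine (setLIntegral_mono' measurableSet_Ioo hsup).trans ?_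
  rw [lintegral_iSup' hmeas (Eventually.of_forall hmono)]
  refine iSup_le fun n => ?_
  refine (lintegral_mono' Measure.restrict_le_self le_rfl).trans ?_
  simp only [hF]
  rw [lintegral_indicator measurableSet_Ioo]
  exact P.setLIntegral_le hk0 hk hθ (hb0 n) (hb1 n) hθ1 n.cast_nonneg

end MFGPair

theorem setLIntegral_one_sub_rpow_lt_top {e : ℝ} (he : e < 1) :
    ∫⁻ t in Ioo (0 : ℝ) 1, ENNReal.ofReal ((1 - t) ^ (-e)) < ⊤ := by
  have h := (intervalIntegral.intervalIntegrable_rpow' (a := 1) (b := 0) (r := -e)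
    (by linarith)).comp_sub_left 1
  simp only [sub_self, sub_zero] at h
  exact (((intervalIntegrable_iff_integrableOn_Ioc_of_le zero_le_one).1 h).mono_set
    Ioo_subset_Ioc_self).setLIntegral_lt_top

/-- The estimate for strictly positive densities, with a constant independent of `ε`. -/
theorem exists_setLIntegral_eHolderNorm_le {θ : ℝ} (hθ : θ ∈ Ioo (0 : ℝ) 1) {α : ℝ≥0}
    (hα₀ : 0 < α) (hα : α < 1 / 2) :
    ∃ C : ℝ, 0 < C ∧ ∀ (ε : ℝ) (P : MFGPair ε),
      ∫⁻ t in Ioo θ 1, eHolderNorm α (fun x => P.ρ x t) ≤ ENNReal.ofReal C := by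
  have ha0 : (0 : ℝ) < α := hα₀
  have ha : (α : ℝ) < 1 / 2 := by exact_mod_cast hα
  set k : ℝ := 1 / 2 - (α : ℝ) with hk
  set q : ℝ := (1 + (α : ℝ)) / (3 - k) with hq
  have hk0 : 0 < k := by linarith
  have hk2 : k < 1 / 2 := by linarith
  have h3k : 0 < 3 - k := by linarith
  -- Since `3 - k = 5/2 + α`, this is equivalent to `α < 1/2`. It gives `q / (1 - q) < 1`, the
  -- integrability of the remainder at the final time.
  have hq1 : q < 1 / 2 := by rw [hq, div_lt_iff₀ h3k]; linarith
  have he : q / (1 - q) < 1 := by rw [div_lt_one (by linarith)]; linarith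
  set c := 4 / θ * (16 / (k * (1 - k))) with hc
  have hc0 : 0 ≤ c := by
    have := hθ.1
    have : 0 < 1 - k := by linarith
    positivity
  set I := ∫⁻ t in Ioo (0 : ℝ) 1, ENNReal.ofReal ((1 - t) ^ (-(q / (1 - q)))) with hI
  have hIt : I ≠ ⊤ := (setLIntegral_one_sub_rpow_lt_top he).ne
  have hI0 : 0 ≤ I.toReal := ENNReal.toReal_nonneg
  refine ⟨18432 * (1 + c + I.toReal), by positivity, fun ε P => ?_⟩
  have hmp : Measurable fun t : ℝ => ENNReal.ofReal ((1 - t) ^ (-(q / (1 - q)))) := by fun_prop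
  calc ∫⁻ t in Ioo θ 1, eHolderNorm α (fun x => P.ρ x t)
      ≤ ∫⁻ t in Ioo θ 1, ENNReal.ofReal 18432 *
        (1 + ENNReal.ofReal (1 - t) * P.gradEnergy k t +
          ENNReal.ofReal ((1 - t) ^ (-(q / (1 - q))))) :=
        setLIntegral_mono' measurableSet_Ioo fun t ht =>
          P.eHolderNorm_le hα₀ hα ⟨hθ.1.trans ht.1, ht.2⟩
    _ = ENNReal.ofReal 18432 * ((∫⁻ _ in Ioo θ 1, 1) +
          (∫⁻ t in Ioo θ 1, ENNReal.ofReal (1 - t) * P.gradEnergy k t) +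
          ∫⁻ t in Ioo θ 1, ENNReal.ofReal ((1 - t) ^ (-(q / (1 - q))))) := by
        rw [lintegral_const_mul' _ _ ENNReal.ofReal_ne_top, lintegral_add_right _ hmp,
          lintegral_add_left measurable_const]
    _ ≤ ENNReal.ofReal 18432 * (1 + ENNReal.ofReal c + I) := by
        gcongr
        · rw [setLIntegral_one, Real.volume_Ioo, ← ENNReal.ofReal_one]
          exact ENNReal.ofReal_le_ofReal (by linarith [hθ.1])
        · exact P.lintegral_gradEnergy_le hk0 hk2 hθ.1 hθ.2
        · exact lintegral_mono_set (Ioo_subset_Ioo_left hθ.1.le)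
    _ = ENNReal.ofReal (18432 * (1 + c + I.toReal)) := by
        rw [ENNReal.ofReal_mul (p := 18432) (by norm_num), ENNReal.ofReal_add (by positivity) hI0,
          ENNReal.ofReal_add one_pos.le hc0, ENNReal.ofReal_one, ENNReal.ofReal_toReal hIt]

/-! ### From solutions of the system to the symmetric pair. -/

theorem IsSolution.classical {ε η : ℝ} {u ρ : ℝ → ℝ → ℝ} {m : ℝ → ProbabilityMeasure ℝ}
    (hε : 0 < ε) (h : IsSolution ε η u ρ m) :
    Classical ε u (dt u) (dx u) (dx (dx u)) ρ (dt ρ) (dx ρ) (dx (dx ρ)) where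
  pos := hε
  u_reg := h.u_classical.c21
  ρ_reg := h.ρ_classical.c21
  nonneg := h.ρ_nonneg
  hj := h.hamilton_jacobi
  fp x t ht := by
    have h1 : dx (fun y s => dx u y s * ρ y s) x t =
        dx (dx u) x t * ρ x t + dx u x t * dx ρ x t :=
      ((h.u_classical.c21.xx x t ht).mul (h.ρ_classical.c21.x x t ht)).deriv
    rw [← h1]
    exact h.fokker_planck x t ht
  mass_le t ht l r hlr := by
    have cρ : Continuous fun x => ρ x t := h.ρ_classical.c21.c.continuous_slice ht
    have h1 : ∫⁻ x in Ioc l r, ENNReal.ofReal (ρ x t) ≤ 1 := by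
      rw [← withDensity_apply _ measurableSet_Ioc, ← h.ρ_density t ht]
      exact prob_le_one
    rw [intervalIntegral.integral_of_le hlr]
    rw [← ofReal_integral_eq_lintegral_ofReal
      ((intervalIntegrable_iff_integrableOn_Ioc_of_le hlr).1 (cρ.intervalIntegrable l r))
      (Eventually.of_forall fun x => h.ρ_nonneg x t ht)] at h1
    exact ENNReal.ofReal_le_one.1 h1
  ne_zero t ht := by
    by_contra! hcon
    have h1 := h.ρ_density t ht
    simp only [hcon, ENNReal.ofReal_zero] at h1
    have h2 : (m t : Measure ℝ) univ = 1 := measure_univ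
    rw [h1, withDensity_apply _ MeasurableSet.univ, lintegral_zero] at h2
    exact zero_ne_one h2

/-- Positivity of the density permits `δ = 0` in `exists_hjSub`. The factor `φ / (φ + δ)` is then
one, and the backward potential `-2ε log (ρ e^{u / (2ε)}) = -2ε log ρ - u` solves the equation with
source exactly `ρ`. -/
theorem Classical.exists_mfgPair {ε : ℝ} {u ut ux uxx ρ ρt ρx ρxx : ℝ → ℝ → ℝ}
    (h : Classical ε u ut ux uxx ρ ρt ρx ρxx) :
    ∃ P : MFGPair ε, ∀ x, ∀ t ∈ Ioo (0 : ℝ) 1, P.ρ x t = ρ x t := by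
  have hε := h.pos
  have hpos : ∀ x, ∀ t ∈ Ioo (0 : ℝ) 1, 0 < ρ x t * Real.exp (u x t / (2 * ε)) + 0 :=
    fun x t ht => by
      have := h.density_pos x ht
      positivity
  obtain ⟨gt, gx, gxx, hreg, hhj, -⟩ := h.exists_hjSub le_rfl hpos
  have hρ : ∀ x, ∀ t ∈ Ioo (0 : ℝ) 1, Real.exp (-(u x t +
      -2 * ε * Real.log (ρ x t * Real.exp (u x t / (2 * ε)) + 0)) / (2 * ε)) = ρ x t := by
    intro x t ht
    have h0 := h.density_pos x ht
    rw [add_zero, Real.log_mul h0.ne' (Real.exp_ne_zero _), Real.log_exp]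
    conv_rhs => rw [← Real.exp_log h0]
    congr 1
    field_simp
    ring
  refine ⟨⟨u, ut, ux, uxx, _, gt, gx, gxx, hε, h.u_reg, hreg, fun x t ht => ?_, fun x t ht => ?_,
    fun t ht l r hlr => ?_⟩, hρ⟩
  · rw [hρ x t ht]
    exact h.hj x t ht
  · have h0 := hpos x t ht
    rw [hρ x t ht, hhj x t ht]
    rw [add_zero] at h0 ⊢
    rw [div_self h0.ne', mul_one]
  · have e : ∀ x, Real.exp (-(u x t +
        -2 * ε * Real.log (ρ x t * Real.exp (u x t / (2 * ε)) + 0)) / (2 * ε)) = ρ x t :=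
      fun x => hρ x t ht
    simp only [e]
    exact h.mass_le t ht l r hlr

end MFGPlanning

theorem mainTheorem6 (θ : ℝ) (hθ : θ ∈ Ioo (0 : ℝ) 1)
    (α : ℝ≥0) (hα₀ : 0 < α) (hα : α < 1 / 2) :
    ∃ C : ℝ, 0 < C ∧
      ∀ (ε η : ℝ), 0 < ε → 0 < η →
        ∀ (u ρ : ℝ → ℝ → ℝ) (m : ℝ → ProbabilityMeasure ℝ),
          MFGPlanning.IsSolution ε η u ρ m →
            ∫⁻ t in Ioo θ 1, eHolderNorm α (fun x => ρ x t) ≤ ENNReal.ofReal C := by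
  obtain ⟨C, hC0, hC⟩ := MFGPlanning.exists_setLIntegral_eHolderNorm_le hθ hα₀ hα
  refine ⟨C, hC0, fun ε η hε _ u ρ m h => ?_⟩
  obtain ⟨P, hP⟩ := (h.classical hε).exists_mfgPair
  refine le_of_eq_of_le (setLIntegral_congr_fun measurableSet_Ioo fun t ht => ?_) (hC ε P)
  have e : (fun x => ρ x t) = fun x => P.ρ x t :=
    funext fun x => (hP x t ⟨hθ.1.trans ht.1, ht.2⟩).symm
  simp only [e]
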